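/- **Conventions.** A proper metric space $X$ has *bounded geometry* if it contains a uniformly discrete subset $\Gamma$ (i.e. $\inf_{x\neq y\in\Gamma}d(x,y)>0$) which is a $C$-net for some $C>0$ and satisfies $\sup_{x\in\Gamma}\#(B(x,R)\cap\Gamma)<\infty$ for every $R\ge 0$. A *coarse map* $f:X\to Y$ is a (not necessarily continuous or Borel) map that is uniformly expansive, i.e. $d_Y(f(x),f(x'))\le\rho(d_X(x,x'))$ for some non-decreasing $\rho:[0,\infty)\to[0,\infty)$, and proper, i.e. preimages of bounded sets are bounded. An *ample $X$-module* $\mathcal H_X$ is an infinite-dimensional separable Hilbert space with a non-degenerate $*$-representation of $C_0(X)$ in which no non-zero function acts as a compact operator; the representation extends to bounded Borel functions, and $\chi_E$ denotes the resulting projection for a Borel set $E\subseteq X$. Fix an infinite-dimensional separable Hilbert space $\mathscr H$, and let $\mathfrak K_1$ be the closed unit ball of the compact operators $\mathfrak K(\mathscr H)$. For a bounded strongly measurable map $g:X\to\mathfrak K(\mathscr H)$ let $\Lambda(g)\in\mathfrak B(\mathcal H_X\otimes\mathscr H)$ be the norm limit of the operators $\Lambda(g_n)$, where the $g_n$ are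 bounded countably valued Borel maps converging uniformly to $g$, and where $\Lambda(h)=\sum_k\chi_{E_k}\otimes a_k$ (strongly convergent) if $h$ has the value $a_k$ on $E_k$, for a countable Borel partition $(E_k)$ of $X$. An operator $T\in\mathfrak B(\mathcal H_X)$ is *locally compact* if $fT$ and $Tf$ are compact for all $f\in C_0(X)$, and *strongly quasi-local* if for every $\varepsilon>0$ there are $\delta,R>0$ such that $\|[T\otimes\mathrm{Id}_{\mathscr H},\Lambda(g)]\|<\varepsilon$ for every strongly measurable $g:X\to\mathfrak K_1$ with $(\delta,R)$-variation, i.e. such that $\|g(x)-g(y)\|<\delta$ whenever $d_X(x,y)<R$. The $C^*$-algebra of all locally compact strongly quasi-local operators on $\mathcal H_X$ is denoted $C^*_{sq}(\mathcal H_X)$. An isometry $V:\mathcal H_X\to\mathcal H_Y$ *covers* $f:X\to Y$ if there is $R_0$ with $\mathrm{supp}(V)\subseteq\{(y,x): d_Y(f(x),y)<R_0\}$, where $\mathrm{supp}(V)$ is the set of all $(y,x)\in Y\times X$ such that $\chi_WV\chi_U\neq0$ for all open neighbourhoods $U$ of $x$ and $W$ of $y$. For $i=0,1$, $K_i$ denotes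 operator $K$-theory. **Proposition.** Let $X,Y$ be proper metric spaces with bounded geometry, $\mathcal H_X,\mathcal H_Y$ ample modules for $X$ and $Y$, and $f:X\to Y$ a coarse map. 1. For every isometry $V:\mathcal H_X\to\mathcal H_Y$ covering $f$, the formula $\mathrm{Ad}_V(T)=VTV^*$ defines a $*$-homomorphism $\mathrm{Ad}_V:C^*_{sq}(\mathcal H_X)\to C^*_{sq}(\mathcal H_Y)$. 2. The induced maps $(\mathrm{Ad}_V)_*:K_i(C^*_{sq}(\mathcal H_X))\to K_i(C^*_{sq}(\mathcal H_Y))$, $i=0,1$, do not depend on the choice of the covering isometry $V$; they are denoted $f_*$. 3. The assignment $f\mapsto f_*$ is functorial. If $Z$ is a further proper metric space with bounded geometry, $\mathcal H_Z$ an ample $Z$-module and $g:Y\to Z$ a coarse map, then $(g\circ f)_*=g_*\circ f_*$, i.e. $(\mathrm{Ad}_U)_*=(\mathrm{Ad}_W)_*\circ(\mathrm{Ad}_V)_*$ on $K_0$ and $K_1$ for all isometries $V:\mathcal H_X\to\mathcal H_Y$, $W:\mathcal H_Y\to\mathcal H_Z$, $U:\mathcal H_X\to\mathcal H_Z$ covering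 $f$, $g$, $g\circ f$. Moreover $(\mathrm{id}_X)_*=\mathrm{id}$, i.e. $(\mathrm{Ad}_U)_*=\mathrm{id}$ on $K_0$ and $K_1$ for every isometry $U:\mathcal H_X\to\mathcal H_X$ covering $\mathrm{id}_X$. -/

import Mathlib

open scoped Topology Matrix ZeroAtInfty CompactlySupported ENNReal
open MeasureTheory

noncomputable section

/-! ### Coarse geometry -/

/-- Bounded geometry: there is a uniformly discrete net `Γ` in `X` such that, for each radius `R`,
the balls of radius `R` centred in `Γ` contain a uniformly bounded number of points of `Γ`. -/
def BoundedGeometry (X : Type*) [MetricSpace X] : Prop :=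
  ∃ Γ : Set X,
    (∃ C > 0, ∀ x : X, ∃ y ∈ Γ, dist x y ≤ C) ∧
    (∃ c > 0, ∀ x ∈ Γ, ∀ y ∈ Γ, x ≠ y → c ≤ dist x y) ∧
    ∀ R : ℝ, 0 ≤ R → ∃ N : ℕ, ∀ x ∈ Γ, (Metric.ball x R ∩ Γ).encard ≤ N

/-- Coarse maps: uniformly expansive and (metrically) proper; no continuity or measurability. -/
structure IsCoarseMap {X Y : Type*} [MetricSpace X] [MetricSpace Y] (f : X → Y) : Prop where
  expansive : ∃ ρ : NNReal → NNReal, Monotone ρ ∧ ∀ x y, nndist (f x) (f y) ≤ ρ (nndist x y)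
  proper : ∀ B : Set Y, Bornology.IsBounded B → Bornology.IsBounded (f ⁻¹' B)

/-! ### Ample modules and their Borel functional calculus -/

/-- An ample `X`-module: a non-degenerate `*`-representation of `C₀(X)` on an infinite-dimensional
separable Hilbert space, such that no non-zero function acts as a compact operator. -/
structure AmpleModule (X : Type*) [MetricSpace X] (H : Type*)
    [NormedAddCommGroup H] [InnerProductSpace ℂ H] [CompleteSpace H] where
  rep : C₀(X, ℂ) →⋆ₙₐ[ℂ] (H →L[ℂ] H)
  separable : TopologicalSpace.SeparableSpace H
  infinite : ¬ FiniteDimensional ℂ H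
  nondegenerate : (Submodule.span ℂ {v : H | ∃ f ξ, v = rep f ξ}).topologicalClosure = ⊤
  ample : ∀ f : C₀(X, ℂ), f ≠ 0 → ¬ IsCompactOperator (rep f)

/-- A real compactly supported function, seen as an element of `C₀(X, ℂ)`. -/
def ccToC0 {X : Type*} [TopologicalSpace X] (f : C_c(X, ℝ)) : C₀(X, ℂ) where
  toFun x := (f x : ℂ)
  continuous_toFun := by fun_prop
  zero_at_infty' := by
    have h : HasCompactSupport (fun x => (f x : ℂ)) :=
      f.hasCompactSupport.comp_left (g := fun r : ℝ => (r : ℂ)) (by simp)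
    exact h.is_zero_at_infty

@[simp] theorem ccToC0_apply {X : Type*} [TopologicalSpace X] (f : C_c(X, ℝ)) (x : X) :
    ccToC0 f x = (f x : ℂ) := rfl

namespace AmpleModule

variable {X : Type*} [MetricSpace X] {H : Type*}
  [NormedAddCommGroup H] [InnerProductSpace ℂ H] [CompleteSpace H] (M : AmpleModule X H)

/-- The action of a real compactly supported function. -/
def act (f : C_c(X, ℝ)) : H →L[ℂ] H := M.rep (ccToC0 f)

theorem act_add (f g : C_c(X, ℝ)) : M.act (f + g) = M.act f + M.act g := by
  rw [act, act, act, ← map_add]; congr 1; ext x; simp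

theorem act_sub (f g : C_c(X, ℝ)) : M.act (f - g) = M.act f - M.act g := by
  rw [act, act, act, ← map_sub]; congr 1; ext x; simp

theorem act_smul (c : ℝ) (f : C_c(X, ℝ)) : M.act (c • f) = (c : ℂ) • M.act f := by
  rw [act, act, ← map_smul]; congr 1; ext x; simp

theorem act_mul (f g : C_c(X, ℝ)) : M.act (f * g) = M.act f * M.act g := by
  rw [act, act, act, ← map_mul]; congr 1; ext x; simp

theorem star_act (f : C_c(X, ℝ)) : star (M.act f) = M.act f := by
  rw [act, ← map_star]; congr 1; ext x; simp

theorem inner_act (f : C_c(X, ℝ)) (ξ η : H) :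
    inner ℂ ξ (M.act f η) = inner ℂ (M.act f ξ) η := by
  conv_lhs => rw [← M.star_act f, ContinuousLinearMap.star_eq_adjoint]
  rw [ContinuousLinearMap.adjoint_inner_right]

theorem inner_act_mul (f g : C_c(X, ℝ)) (ξ : H) :
    inner ℂ ξ (M.act (f * g) ξ) = inner ℂ (M.act f ξ) (M.act g ξ) := by
  rw [act_mul, mul_apply_eq_comp, inner_act]

theorem norm_act_sq (f : C_c(X, ℝ)) (ξ : H) :
    ‖M.act f ξ‖ ^ 2 = (inner ℂ ξ (M.act (f * f) ξ)).re := by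
  rw [inner_act_mul, inner_self_eq_norm_sq_to_K]
  norm_cast

theorem norm_act_le (f : C_c(X, ℝ)) (hf : ∀ x, ‖f x‖ ≤ 1) : ‖M.act f‖ ≤ 1 := by
  refine (NonUnitalStarAlgHom.norm_apply_le M.rep (ccToC0 f)).trans ?_
  rw [← ZeroAtInftyContinuousMap.norm_toBCF_eq_norm]
  refine (BoundedContinuousFunction.norm_le zero_le_one).2 fun x => ?_
  simpa using hf x

/-- The positive linear functional `f ↦ ⟨ξ, f ξ⟩` on `C_c(X, ℝ)`. -/
def vectorFunctional (ξ : H) : C_c(X, ℝ) →ₚ[ℝ] ℝ :=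
  PositiveLinearMap.mk₀
    { toFun := fun f => (inner ℂ ξ (M.act f ξ)).re
      map_add' := fun f g => by simp [act_add, inner_add_right]
      map_smul' := fun c f => by simp [act_smul, inner_smul_right] }
    (by
      intro f hf
      let g : C_c(X, ℝ) := ⟨⟨fun x => √(f x), by fun_prop⟩,
        f.hasCompactSupport.comp_left (g := Real.sqrt) (by simp)⟩
      have hg : f = g * g := by
        ext x
        have : 0 ≤ f x := hf x
        simp [g, Real.mul_self_sqrt this]
      change 0 ≤ (inner ℂ ξ (M.act f ξ)).re
      rw [hg, ← norm_act_sq]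
      positivity)

theorem vectorFunctional_apply (ξ : H) (f : C_c(X, ℝ)) :
    M.vectorFunctional ξ f = (inner ℂ ξ (M.act f ξ)).re := rfl

variable [ProperSpace X] [MeasurableSpace X] [BorelSpace X]

/-- The spectral measure of a vector `ξ`: the Radon measure `μ_ξ` on `X` with
`∫ f dμ_ξ = ⟨ξ, f ξ⟩`, given by the Riesz-Markov-Kakutani theorem. -/
def vectorMeasure (ξ : H) : Measure X := RealRMK.rieszMeasure (M.vectorFunctional ξ)

instance (ξ : H) : (M.vectorMeasure ξ).Regular := by
  unfold vectorMeasure; infer_instance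

theorem integral_vectorMeasure (ξ : H) (f : C_c(X, ℝ)) :
    ∫ x, f x ∂(M.vectorMeasure ξ) = (inner ℂ ξ (M.act f ξ)).re := by
  rw [vectorMeasure, RealRMK.integral_rieszMeasure, vectorFunctional_apply]

/-- Cut-off functions. -/
theorem exists_cutoff {K U : Set X} (hK : IsCompact K) (hU : IsOpen U) (hKU : K ⊆ U) :
    ∃ f : C_c(X, ℝ), (∀ x ∈ K, f x = 1) ∧ (∀ x ∉ U, f x = 0) ∧ ∀ x, 0 ≤ f x ∧ f x ≤ 1 := by
  obtain ⟨f, hf1, hf2, hf3, hf4⟩ := exists_continuousMap_one_of_isCompact_subset_isOpen hK hU hKU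
  refine ⟨⟨f, hf2⟩, fun x hx => hf1 hx, fun x hx => ?_, fun x => hf4 x⟩
  exact image_eq_zero_of_notMem_tsupport (fun h => hx (hf3 h))

theorem vectorMeasure_univ_le (ξ : H) :
    M.vectorMeasure ξ Set.univ ≤ ENNReal.ofReal (‖ξ‖ ^ 2) := by
  rw [isOpen_univ.measure_eq_iSup_isCompact]
  refine iSup₂_le fun K _ => iSup_le fun hK => ?_
  obtain ⟨f, hf1, -, hf⟩ := exists_cutoff hK isOpen_univ (Set.subset_univ K)
  refine (RealRMK.rieszMeasure_le_of_eq_one _ (fun x => (hf x).1) hK hf1).trans ?_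
  refine ENNReal.ofReal_le_ofReal ?_
  rw [vectorFunctional_apply]
  refine (Complex.re_le_norm _).trans ((norm_inner_le_norm _ _).trans ?_)
  rw [sq]
  refine mul_le_mul_of_nonneg_left ?_ (norm_nonneg _)
  refine (M.act f).le_of_opNorm_le (M.norm_act_le f fun x => ?_) ξ |>.trans (by simp)
  rw [Real.norm_of_nonneg (hf x).1]; exact (hf x).2

instance (ξ : H) : IsFiniteMeasure (M.vectorMeasure ξ) :=
  ⟨(M.vectorMeasure_univ_le ξ).trans_lt ENNReal.ofReal_lt_top⟩

theorem vectorMeasure_parallelogram (ξ η : H) :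
    M.vectorMeasure (ξ + η) + M.vectorMeasure (ξ - η)
      = (2 : NNReal) • M.vectorMeasure ξ + (2 : NNReal) • M.vectorMeasure η := by
  refine Measure.ext_of_integral_eq_on_compactlySupported fun f => ?_
  have hi (ζ : H) : Integrable f (M.vectorMeasure ζ) := f.integrable
  rw [integral_add_measure (hi _) (hi _),
    integral_add_measure ((hi _).smul_measure_nnreal) ((hi _).smul_measure_nnreal),
    integral_smul_nnreal_measure, integral_smul_nnreal_measure]
  simp only [integral_vectorMeasure, NNReal.smul_def]
  simp [inner_add_left, inner_add_right, inner_sub_left, inner_sub_right]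
  ring

theorem vectorMeasure_add_le (ξ η : H) (A : Set X) :
    M.vectorMeasure (ξ + η) A ≤ 2 * M.vectorMeasure ξ A + 2 * M.vectorMeasure η A := by
  have h := congrArg (fun μ : Measure X => μ A) (M.vectorMeasure_parallelogram ξ η)
  simp only [Measure.add_apply, Measure.smul_apply] at h
  calc M.vectorMeasure (ξ + η) A ≤ _ := le_self_add
    _ = _ := h
    _ = _ := by simp [ENNReal.smul_def]

theorem vectorMeasure_smul (c : ℂ) (ξ : H) :
    M.vectorMeasure (c • ξ) = (‖c‖₊ ^ 2) • M.vectorMeasure ξ := by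
  refine Measure.ext_of_integral_eq_on_compactlySupported fun f => ?_
  rw [integral_smul_nnreal_measure]
  simp only [integral_vectorMeasure, NNReal.smul_def]
  rw [map_smul, inner_smul_left, inner_smul_right, ← mul_assoc, Complex.conj_mul',
    ← Complex.ofReal_pow, Complex.re_ofReal_mul]
  simp

theorem vectorMeasure_zero : M.vectorMeasure (0 : H) = 0 := by
  have := M.vectorMeasure_smul 0 (0 : H)
  simpa using this

/-- The range of `χ_E`: the closed subspace of all vectors `ξ` whose spectral measure is
concentrated on `E`. -/
def spectralSubspace (E : Set X) : Submodule ℂ H where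
  carrier := {ξ | M.vectorMeasure ξ Eᶜ = 0}
  add_mem' {ξ η} hξ hη := by
    have := M.vectorMeasure_add_le ξ η Eᶜ
    rw [Set.mem_ofPred_eq] at *
    simpa [hξ, hη] using this
  zero_mem' := by simp [vectorMeasure_zero]
  smul_mem' c ξ hξ := by
    rw [Set.mem_ofPred_eq] at *
    simp [vectorMeasure_smul, hξ]

theorem mem_spectralSubspace {E : Set X} {ξ : H} :
    ξ ∈ M.spectralSubspace E ↔ M.vectorMeasure ξ Eᶜ = 0 := Iff.rfl

theorem isClosed_spectralSubspace (E : Set X) :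
    IsClosed (M.spectralSubspace E : Set H) := by
  refine isClosed_of_closure_subset fun ξ hξ => ?_
  rw [SetLike.mem_coe, mem_spectralSubspace]
  refine le_antisymm (le_of_forall_pos_le_add fun ε hε => ?_) bot_le
  rw [Metric.mem_closure_iff] at hξ
  obtain ⟨δ, hδ, hδε⟩ : ∃ δ : ℝ, 0 < δ ∧ 2 * ENNReal.ofReal (δ ^ 2) ≤ ε := by
    rcases eq_or_ne ε ⊤ with rfl | hε'
    · exact ⟨1, one_pos, le_top⟩
    · refine ⟨√(ε.toReal / 2), by have := ENNReal.toReal_pos hε.ne' hε'; positivity, ?_⟩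
      rw [Real.sq_sqrt (by positivity), ENNReal.ofReal_div_of_pos two_pos, ENNReal.ofReal_toReal hε']
      simp [ENNReal.mul_div_cancel]
  obtain ⟨η, hη, hd⟩ := hξ δ hδ
  have h := M.vectorMeasure_add_le η (ξ - η) Eᶜ
  rw [(M.mem_spectralSubspace).1 hη, mul_zero, zero_add, add_sub_cancel] at h
  rw [zero_add]
  refine h.trans (le_trans ?_ hδε)
  gcongr
  refine (measure_mono (Set.subset_univ _)).trans ((M.vectorMeasure_univ_le _).trans ?_)
  refine ENNReal.ofReal_le_ofReal ?_
  rw [dist_eq_norm] at hd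
  gcongr

instance (E : Set X) : (M.spectralSubspace E).HasOrthogonalProjection :=
  haveI : CompleteSpace (M.spectralSubspace E) :=
    (M.isClosed_spectralSubspace E).completeSpace_coe
  inferInstance

/-- The operator `χ_E` of a Borel set `E`, i.e. the value at the indicator function of `E` of the
extension of the representation to bounded Borel functions. -/
def χ (E : Set X) : H →L[ℂ] H := (M.spectralSubspace E).starProjection



/-! The basic properties of `χ`: these are what makes the operators `Λ(g)` below well-defined. -/

theorem exists_cutoff_close (ξ : H) {ε : ℝ} (hε : 0 < ε) :
    ∃ K : Set X, IsCompact K ∧ ∀ f : C_c(X, ℝ), (∀ x ∈ K, f x = 1) →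
      (∀ x, 0 ≤ f x ∧ f x ≤ 1) → ‖M.act f ξ - ξ‖ ≤ ε := by
  have hmem : ξ ∈ (Submodule.span ℂ {v : H | ∃ f ξ, v = M.rep f ξ}).topologicalClosure := by
    rw [M.nondegenerate]; trivial
  rw [← SetLike.mem_coe, Submodule.topologicalClosure_coe, Metric.mem_closure_iff] at hmem
  obtain ⟨η, hη, hd⟩ := hmem (ε / 3) (by positivity)
  have key : ∀ η ∈ Submodule.span ℂ {v : H | ∃ f ξ, v = M.rep f ξ}, ∀ ε > 0,
      ∃ K : Set X, IsCompact K ∧ ∀ f : C_c(X, ℝ), (∀ x ∈ K, f x = 1) →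
      (∀ x, 0 ≤ f x ∧ f x ≤ 1) → ‖M.act f η - η‖ ≤ ε := by
    intro η hη
    induction hη using Submodule.span_induction with
    | mem v hv =>
      obtain ⟨g, ζ, rfl⟩ := hv
      intro ε hε
      have hz := g.zero_at_infty'
      have hz' : ∀ᶠ x in Filter.cocompact X, ‖g x‖ < ε / (‖ζ‖ + 1) := by
        have := (Metric.tendsto_nhds.1 hz) (ε / (‖ζ‖ + 1)) (by positivity)
        simpa using this
      obtain ⟨K, hK, hK'⟩ := Filter.mem_cocompact.1 hz'
      refine ⟨K, hK, fun f hf1 hf => ?_⟩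
      have : M.act f (M.rep g ζ) - M.rep g ζ = M.rep (ccToC0 f * g - g) ζ := by
        rw [map_sub, map_mul]; rfl
      rw [this]
      have hn : ‖M.rep (ccToC0 f * g - g)‖ ≤ ε / (‖ζ‖ + 1) := by
        refine (NonUnitalStarAlgHom.norm_apply_le M.rep _).trans ?_
        rw [← ZeroAtInftyContinuousMap.norm_toBCF_eq_norm]
        refine (BoundedContinuousFunction.norm_le (by positivity)).2 fun x => ?_
        change ‖(f x : ℂ) * g x - g x‖ ≤ _
        by_cases hx : x ∈ K
        · simp [hf1 x hx]; positivity
        · have h1 : ‖g x‖ < ε / (‖ζ‖ + 1) := hK' hx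
          have h2 : (f x : ℂ) * g x - g x = ((f x - 1 : ℝ) : ℂ) * g x := by push_cast; ring
          rw [h2, norm_mul]
          have h3 : ‖((f x - 1 : ℝ) : ℂ)‖ ≤ 1 := by
            rw [Complex.norm_real, Real.norm_eq_abs, abs_le]
            constructor <;> linarith [(hf x).1, (hf x).2]
          nlinarith [norm_nonneg (g x)]
      refine ((M.rep (ccToC0 f * g - g)).le_of_opNorm_le hn ζ).trans ?_
      rw [div_mul_eq_mul_div, div_le_iff₀ (by positivity)]
      nlinarith [norm_nonneg ζ]
    | zero => exact fun ε hε => ⟨∅, isCompact_empty, fun f _ _ => by simpa using hε.le⟩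
    | add u v _ _ hu hv =>
      intro ε hε
      obtain ⟨K, hK, h⟩ := hu (ε / 2) (by positivity)
      obtain ⟨L, hL, h'⟩ := hv (ε / 2) (by positivity)
      refine ⟨K ∪ L, hK.union hL, fun f hf1 hf => ?_⟩
      have e : M.act f (u + v) - (u + v) = (M.act f u - u) + (M.act f v - v) := by
        rw [map_add]; abel
      rw [e]
      refine (norm_add_le _ _).trans ?_
      have := h f (fun x hx => hf1 x (.inl hx)) hf
      have := h' f (fun x hx => hf1 x (.inr hx)) hf
      linarith
    | smul c u _ hu =>
      intro ε hε
      obtain ⟨K, hK, h⟩ := hu (ε / (‖c‖ + 1)) (by positivity)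
      refine ⟨K, hK, fun f hf1 hf => ?_⟩
      rw [map_smul, ← smul_sub, norm_smul]
      have := h f hf1 hf
      rw [le_div_iff₀ (by positivity)] at this
      nlinarith [norm_nonneg (M.act f u - u), norm_nonneg c]
  obtain ⟨K, hK, h⟩ := key η hη (ε / 3) (by positivity)
  refine ⟨K, hK, fun f hf1 hf => ?_⟩
  have h1 := h f hf1 hf
  have h2 : ‖M.act f (ξ - η)‖ ≤ ‖ξ - η‖ := by
    refine ((M.act f).le_of_opNorm_le (M.norm_act_le f fun x => ?_) _).trans (by simp)
    rw [Real.norm_of_nonneg (hf x).1]; exact (hf x).2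
  rw [dist_eq_norm] at hd
  have e : M.act f ξ - ξ = M.act f (ξ - η) + (M.act f η - η) - (ξ - η) := by
    rw [map_sub]; abel
  rw [e]
  have h3 := norm_sub_le (M.act f (ξ - η) + (M.act f η - η)) (ξ - η)
  have h4 := norm_add_le (M.act f (ξ - η)) (M.act f η - η)
  linarith

/-- `μ_ξ` has total mass `‖ξ‖²`. -/
theorem vectorMeasure_univ (ξ : H) :
    M.vectorMeasure ξ Set.univ = ENNReal.ofReal (‖ξ‖ ^ 2) := by
  refine le_antisymm (M.vectorMeasure_univ_le ξ) ?_
  suffices h : ‖ξ‖ ^ 2 ≤ (M.vectorMeasure ξ).real Set.univ by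
    rw [← ENNReal.ofReal_toReal (measure_ne_top (M.vectorMeasure ξ) Set.univ)]
    exact ENNReal.ofReal_le_ofReal h
  refine le_of_forall_pos_le_add fun ε hε => ?_
  obtain ⟨K, hK, h⟩ := M.exists_cutoff_close ξ (ε := ε / (‖ξ‖ + 1)) (by positivity)
  obtain ⟨f, hf1, -, hf⟩ := exists_cutoff hK isOpen_univ (Set.subset_univ K)
  have h1 := h f hf1 hf
  have h2 : ∫ x, f x ∂(M.vectorMeasure ξ) ≤ (M.vectorMeasure ξ).real Set.univ := by
    have : ∫ x, f x ∂(M.vectorMeasure ξ) ≤ ∫ _, (1 : ℝ) ∂(M.vectorMeasure ξ) :=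
      integral_mono f.integrable (integrable_const _) fun x => (hf x).2
    simpa using this
  rw [integral_vectorMeasure] at h2
  have h3 : ‖ξ‖ ^ 2 = (inner ℂ ξ (M.act f ξ)).re - (inner ℂ ξ (M.act f ξ - ξ)).re := by
    rw [inner_sub_right, inner_self_eq_norm_sq_to_K, Complex.sub_re]
    have : (((‖ξ‖ : ℝ) : ℂ) ^ 2).re = ‖ξ‖ ^ 2 := by norm_cast
    erw [this]; ring
  have h4 : |(inner ℂ ξ (M.act f ξ - ξ)).re| ≤ ‖ξ‖ * ‖M.act f ξ - ξ‖ :=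
    (Complex.abs_re_le_norm _).trans (norm_inner_le_norm _ _)
  rw [le_div_iff₀ (by positivity)] at h1
  have h5 := neg_abs_le (inner ℂ ξ (M.act f ξ - ξ)).re
  nlinarith [norm_nonneg (M.act f ξ - ξ)]

theorem norm_act_sq_eq_integral (ξ : H) (f : C_c(X, ℝ)) :
    ‖M.act f ξ‖ ^ 2 = ∫ x, f x ^ 2 ∂(M.vectorMeasure ξ) := by
  rw [norm_act_sq, ← integral_vectorMeasure]
  simp [sq]

/-- If `f` vanishes off a set `A` of measure at most `ε` then `‖f ξ‖² ≤ ε`. -/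
theorem norm_act_sq_le (ξ : H) {A : Set X} (hA : MeasurableSet A) (f : C_c(X, ℝ))
    (hf : ∀ x, |f x| ≤ 1) (hfA : ∀ x ∉ A, f x = 0) :
    ‖M.act f ξ‖ ^ 2 ≤ (M.vectorMeasure ξ).real A := by
  rw [norm_act_sq_eq_integral, ← integral_indicator_one hA]
  have hint : Integrable (fun x => f x ^ 2) (M.vectorMeasure ξ) := by
    have := (f * f).integrable (μ := M.vectorMeasure ξ)
    refine this.congr (.of_forall fun x => ?_)
    simp [sq]
  refine integral_mono hint ((integrable_const 1).indicator hA) fun x => ?_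
  by_cases hx : x ∈ A
  · simpa [hx] using hf x
  · simp [hx, hfA x hx]

/-- If `f = 1` on a compact set `K` then `μ_ξ(K) ≤ ‖f ξ‖²`. -/
theorem le_norm_act_sq (ξ : H) {K : Set X} (hK : IsCompact K) (f : C_c(X, ℝ))
    (hf : ∀ x ∈ K, f x = 1) :
    (M.vectorMeasure ξ).real K ≤ ‖M.act f ξ‖ ^ 2 := by
  rw [norm_act_sq_eq_integral, ← integral_indicator_one hK.measurableSet]
  have hint : Integrable (fun x => f x ^ 2) (M.vectorMeasure ξ) := by
    have := (f * f).integrable (μ := M.vectorMeasure ξ)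
    refine this.congr (.of_forall fun x => ?_)
    simp [sq]
  refine integral_mono ((integrable_const 1).indicator hK.measurableSet) hint fun x => ?_
  by_cases hx : x ∈ K
  · simp [hx, hf x hx]
  · simp [hx, sq_nonneg]

/-- For compact `K` there is a vector in the range of `χ_K` whose inner product with `ξ` is
`μ_ξ(K)`. -/
theorem exists_mem_spectralSubspace_compact (ξ : H) {K : Set X} (hK : IsCompact K) :
    ∃ ζ ∈ M.spectralSubspace K, (inner ℂ ξ ζ).re = (M.vectorMeasure ξ).real K := by
  set μ := M.vectorMeasure ξ with hμ
  have hU (n : ℕ) : ∃ U ⊇ K, IsOpen U ∧ U ⊆ Metric.thickening ((1 : ℝ) / (n + 1)) K ∧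
      μ.real (U \ K) < 1 / (n + 1) := by
    obtain ⟨U, hKU, hU, hlt⟩ := K.exists_isOpen_lt_add (μ := μ) (measure_ne_top _ _)
      (ε := ENNReal.ofReal (1 / (n + 1))) (by simp; positivity)
    refine ⟨U ∩ Metric.thickening ((1 : ℝ) / (n + 1)) K, Set.subset_inter hKU
      (Metric.self_subset_thickening (by positivity) K), hU.inter Metric.isOpen_thickening,
      Set.inter_subset_right, ?_⟩
    have h1 : μ (U \ K) < ENNReal.ofReal (1 / (n + 1)) := by
      rw [measure_sdiff hKU hK.measurableSet.nullMeasurableSet (measure_ne_top _ _)]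
      exact ENNReal.sub_lt_of_lt_add (measure_mono hKU) (by rwa [add_comm])
    have h2 : μ.real (U \ K) < 1 / (n + 1) := by
      rw [Measure.real, ← ENNReal.lt_ofReal_iff_toReal_lt (measure_ne_top _ _)]
      exact h1
    refine (measureReal_mono ?_).trans_lt h2
    exact Set.sdiff_subset_sdiff_left Set.inter_subset_left
  choose U hKU hUo hUt hUm using hU
  choose f hf1 hf0 hf using fun n => exists_cutoff hK (hUo n) (hKU n)
  have hcauchy : CauchySeq fun n => M.act (f n) ξ := by
    refine Metric.cauchySeq_iff.2 fun ε hε => ?_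
    obtain ⟨N, hN⟩ := exists_nat_gt (2 / ε ^ 2)
    have hN' : 2 / ((N : ℝ) + 1) < ε ^ 2 := by
      rw [div_lt_iff₀ (by positivity)] at hN ⊢
      nlinarith [sq_nonneg ε]
    refine ⟨N, fun m hm n hn => ?_⟩
    rw [dist_eq_norm, ← sub_apply, ← act_sub]
    refine lt_of_pow_lt_pow_left₀ 2 hε.le (lt_of_le_of_lt ?_ hN')
    refine (M.norm_act_sq_le ξ (A := (U m \ K) ∪ (U n \ K))
      (((hUo m).measurableSet.diff hK.measurableSet).union
        ((hUo n).measurableSet.diff hK.measurableSet)) (f m - f n) (fun x => ?_)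
      (fun x hx => ?_)).trans ?_
    · rw [CompactlySupportedContinuousMap.sub_apply, abs_le]
      constructor <;> linarith [(hf m x).1, (hf m x).2, (hf n x).1, (hf n x).2]
    · rw [CompactlySupportedContinuousMap.sub_apply]
      by_cases hxK : x ∈ K
      · rw [hf1 m x hxK, hf1 n x hxK, sub_self]
      · rw [hf0 m x fun h => hx (.inl ⟨h, hxK⟩), hf0 n x fun h => hx (.inr ⟨h, hxK⟩), sub_self]
    · refine (measureReal_union_le _ _).trans ?_
      have h1 : (1 : ℝ) / (m + 1) ≤ 1 / (N + 1) := by gcongr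
      have h2 : (1 : ℝ) / (n + 1) ≤ 1 / (N + 1) := by gcongr
      have h3 : (2 : ℝ) / (N + 1) = 1 / (N + 1) + 1 / (N + 1) := by ring
      linarith [hUm m, hUm n]
  obtain ⟨ζ, hζ⟩ := cauchySeq_tendsto_of_complete hcauchy
  have hlim0 : Filter.Tendsto (fun n : ℕ => (1 : ℝ) / (n + 1)) Filter.atTop (𝓝 0) :=
    tendsto_one_div_add_atTop_nhds_zero_nat
  refine ⟨ζ, ?_, ?_⟩
  · rw [mem_spectralSubspace, hK.isClosed.isOpen_compl.measure_eq_iSup_isCompact]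
    refine le_antisymm (iSup₂_le fun L hL => iSup_le fun hLc => ?_) bot_le
    -- a cut-off function of `L` supported away from `K`
    obtain ⟨δ, hδ, hdisj⟩ := Set.disjoint_left.2 (fun x hx => hL hx) |>.exists_thickenings
      hLc hK.isClosed
    obtain ⟨g, hg1, hg0, hg⟩ := exists_cutoff hLc Metric.isOpen_thickening
      (Metric.self_subset_thickening hδ L)
    have hev : ∀ᶠ n in Filter.atTop, M.act g (M.act (f n) ξ) = 0 := by
      filter_upwards [hlim0.eventually (gt_mem_nhds hδ)] with n hn
      rw [← mul_apply_eq_comp, ← act_mul]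
      have : g * f n = 0 := by
        ext x
        rw [CompactlySupportedContinuousMap.mul_apply]
        by_cases hx : x ∈ Metric.thickening δ L
        · have hx' : x ∉ U n := fun h =>
            Set.disjoint_left.1 hdisj hx (Metric.thickening_mono hn.le K (hUt n h))
          simp [hf0 n x hx']
        · simp [hg0 x hx]
      rw [this]
      have h0 : M.act (0 : C_c(X, ℝ)) = 0 := by simpa using M.act_smul 0 0
      rw [h0]; rfl
    have hg0' : M.act g ζ = 0 := by
      have h1 : Filter.Tendsto (fun n => M.act g (M.act (f n) ξ)) Filter.atTop (𝓝 (M.act g ζ)) :=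
        ((M.act g).continuous.tendsto ζ).comp hζ
      exact tendsto_nhds_unique_of_eventuallyEq h1 tendsto_const_nhds hev
    have h2 := M.le_norm_act_sq ζ hLc g hg1
    rw [hg0', norm_zero, zero_pow two_ne_zero] at h2
    have h3 := le_antisymm h2 measureReal_nonneg
    rw [measureReal_eq_zero_iff] at h3
    exact h3.le
  · have h1 : Filter.Tendsto (fun n => (inner ℂ ξ (M.act (f n) ξ)).re) Filter.atTop
        (𝓝 (inner ℂ ξ ζ).re) :=
      (Complex.continuous_re.tendsto _).comp ((tendsto_const_nhds).inner hζ)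
    refine tendsto_nhds_unique h1 ?_
    refine tendsto_of_tendsto_of_tendsto_of_le_of_le (g := fun _ => μ.real K)
      (h := fun n : ℕ => μ.real K + 1 / (n + 1)) tendsto_const_nhds
      (by simpa using hlim0.const_add (μ.real K)) (fun n => ?_) (fun n => ?_)
    · change _ ≤ (inner ℂ ξ (M.act (f n) ξ)).re
      rw [← integral_vectorMeasure, ← integral_indicator_one hK.measurableSet]
      refine integral_mono ((integrable_const 1).indicator hK.measurableSet) (f n).integrable
        fun x => ?_
      by_cases hx : x ∈ K
      · simp [hx, hf1 n x hx]
      · simpa [hx] using (hf n x).1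
    · change (inner ℂ ξ (M.act (f n) ξ)).re ≤ _
      rw [← integral_vectorMeasure]
      have h2 : ∫ x, f n x ∂(M.vectorMeasure ξ) ≤ μ.real (U n) := by
        rw [← integral_indicator_one (hUo n).measurableSet]
        refine integral_mono (f n).integrable ((integrable_const 1).indicator
          (hUo n).measurableSet) fun x => ?_
        by_cases hx : x ∈ U n
        · simpa [hx] using (hf n x).2
        · simp [hx, hf0 n x hx]
      have h3 : μ.real (U n) = μ.real K + μ.real (U n \ K) := by
        rw [measureReal_sdiff (hKU n) hK.measurableSet]; ring
      linarith [hUm n]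

theorem spectralSubspace_mono {E F : Set X} (h : E ⊆ F) :
    M.spectralSubspace E ≤ M.spectralSubspace F := fun _ hξ =>
  measure_mono_null (Set.compl_subset_compl.2 h) hξ

/-- Spectral subspaces of disjoint Borel sets are orthogonal. -/
theorem spectralSubspace_orthogonal {E F : Set X} (hE : MeasurableSet E) (hF : MeasurableSet F)
    (hEF : Disjoint E F) : M.spectralSubspace E ⟂ M.spectralSubspace F := by
  rw [Submodule.isOrtho_iff_inner_eq]
  intro ξ hξ η hη
  rw [← norm_eq_zero]
  refine le_antisymm (le_of_forall_pos_le_add fun ε hε => ?_) (norm_nonneg _)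
  rw [zero_add]
  set δ := ε / (‖ξ‖ + ‖η‖ + 1) with hδ
  have hδ0 : 0 < δ := by positivity
  have aux {G : Set X} (hG : MeasurableSet G) {ζ : H} (hζ : ζ ∈ M.spectralSubspace G) :
      ∃ K ⊆ G, IsCompact K ∧ (M.vectorMeasure ζ).real Kᶜ ≤ δ ^ 2 := by
    obtain ⟨K, hKG, hK, hlt⟩ := hG.exists_isCompact_sdiff_lt (μ := M.vectorMeasure ζ)
      (measure_ne_top _ _) (ε := ENNReal.ofReal (δ ^ 2)) (by simp; positivity)
    refine ⟨K, hKG, hK, ?_⟩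
    have : Kᶜ ⊆ Gᶜ ∪ G \ K := by
      intro x hx; by_cases hxG : x ∈ G
      · exact .inr ⟨hxG, hx⟩
      · exact .inl hxG
    refine ENNReal.toReal_le_of_le_ofReal (by positivity) ?_
    refine (measure_mono this).trans ((measure_union_le _ _).trans ?_)
    rw [M.mem_spectralSubspace.1 hζ, zero_add]
    exact hlt.le
  obtain ⟨K, hKE, hK, hKm⟩ := aux hE hξ
  obtain ⟨L, hLF, hL, hLm⟩ := aux hF hη
  have hKL : K ⊆ Lᶜ := fun x hx hx' => Set.disjoint_left.1 hEF (hKE hx) (hLF hx')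
  obtain ⟨f, hf1, hf0, hf⟩ := exists_cutoff hK hL.isClosed.isOpen_compl hKL
  have h1 : ‖M.act f η‖ ≤ δ := by
    refine le_of_sq_le_sq ?_ hδ0.le
    refine (M.norm_act_sq_le η (A := Lᶜ) hL.measurableSet.compl f (fun x => ?_)
      (fun x hx => hf0 x hx)).trans hLm
    rw [abs_of_nonneg (hf x).1]; exact (hf x).2
  have h2 : ‖ξ - M.act f ξ‖ ≤ δ := by
    refine le_of_forall_pos_le_add fun ε' hε' => ?_
    obtain ⟨K', hK', h⟩ := M.exists_cutoff_close ξ hε'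
    obtain ⟨e, he1, -, he⟩ := exists_cutoff (hK'.union f.hasCompactSupport) isOpen_univ
      (Set.subset_univ _)
    have h3 := h e (fun x hx => he1 x (.inl hx)) he
    have hef (x : X) : f x ≤ e x := by
      by_cases hx : x ∈ tsupport f
      · rw [he1 x (.inr hx)]; exact (hf x).2
      · rw [image_eq_zero_of_notMem_tsupport hx]; exact (he x).1
    have h4 : ‖M.act (e - f) ξ‖ ≤ δ := by
      refine le_of_sq_le_sq ?_ hδ0.le
      refine (M.norm_act_sq_le ξ (A := Kᶜ) hK.measurableSet.compl (e - f) (fun x => ?_)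
        (fun x hx => ?_)).trans hKm
      · rw [CompactlySupportedContinuousMap.sub_apply, abs_le]
        constructor <;> linarith [(hf x).1, (hf x).2, (he x).1, (he x).2]
      · rw [CompactlySupportedContinuousMap.sub_apply]
        have hxK := not_not.1 hx
        have h5 := hef x
        rw [hf1 x hxK] at h5 ⊢
        linarith [(he x).2]
    rw [act_sub, sub_apply] at h4
    have e1 : ξ - M.act f ξ = (M.act e ξ - M.act f ξ) - (M.act e ξ - ξ) := by abel
    rw [e1]
    exact (norm_sub_le _ _).trans (add_le_add h4 h3)
  have e2 : (inner ℂ ξ η : ℂ) = inner ℂ (ξ - M.act f ξ) η + inner ℂ ξ (M.act f η) := by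
    rw [inner_sub_left, inner_act]; ring
  rw [e2]
  have h5 := norm_inner_le_norm (𝕜 := ℂ) (ξ - M.act f ξ) η
  have h6 := norm_inner_le_norm (𝕜 := ℂ) ξ (M.act f η)
  have h7 := norm_add_le (inner ℂ (ξ - M.act f ξ) η) (inner ℂ ξ (M.act f η))
  have h8 : δ * (‖ξ‖ + ‖η‖ + 1) = ε := by rw [hδ]; field_simp
  nlinarith [norm_nonneg ξ, norm_nonneg η]

/-- A vector orthogonal to the range of `χ_E` is `μ_ξ(E)`-null. -/
theorem vectorMeasure_eq_zero_of_orthogonal {E : Set X} (hE : MeasurableSet E) {ξ : H}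
    (h : ∀ η ∈ M.spectralSubspace E, inner ℂ ξ η = 0) : M.vectorMeasure ξ E = 0 := by
  rw [hE.measure_eq_iSup_isCompact_of_ne_top (measure_ne_top _ _)]
  refine le_antisymm (iSup₂_le fun K hK => iSup_le fun hKc => ?_) bot_le
  obtain ⟨ζ, hζ, hζ'⟩ := M.exists_mem_spectralSubspace_compact ξ hKc
  rw [h ζ (M.spectralSubspace_mono hK hζ), Complex.zero_re] at hζ'
  have := hζ'.symm
  rw [measureReal_eq_zero_iff] at this
  exact this.le

theorem isSelfAdjoint_χ (E : Set X) : IsSelfAdjoint (M.χ E) := isSelfAdjoint_starProjection _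

theorem χ_mul_of_subset {E F : Set X} (h : E ⊆ F) : M.χ F * M.χ E = M.χ E := by
  ext ξ
  exact Submodule.starProjection_eq_self_iff.2
    (M.spectralSubspace_mono h (Submodule.starProjection_apply_mem _ _))

theorem χ_mul_self (E : Set X) : M.χ E * M.χ E = M.χ E := M.χ_mul_of_subset subset_rfl

theorem χ_mul_of_disjoint {E F : Set X} (hE : MeasurableSet E) (hF : MeasurableSet F)
    (hEF : Disjoint E F) : M.χ E * M.χ F = 0 :=
  (M.spectralSubspace_orthogonal hE hF hEF).starProjection_comp_starProjection

theorem χ_empty : M.χ (∅ : Set X) = 0 := by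
  have h := M.χ_mul_of_disjoint (E := ∅) (F := ∅) .empty .empty (by simp)
  rwa [χ_mul_self] at h

theorem norm_χ_le (E : Set X) : ‖M.χ E‖ ≤ 1 := Submodule.starProjection_norm_le _

/-- A vector killed by all `χ_{E_i}`, for a countable Borel cover `(E_i)`, is zero. -/
theorem eq_zero_of_χ_eq_zero {ι : Type*} [Countable ι] {E : ι → Set X}
    (hE : ∀ i, MeasurableSet (E i)) (hU : ⋃ i, E i = Set.univ) {ξ : H}
    (h : ∀ i, M.χ (E i) ξ = 0) : ξ = 0 := by
  have h0 : M.vectorMeasure ξ Set.univ = 0 := by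
    rw [← hU, measure_iUnion_null_iff]
    intro i
    refine M.vectorMeasure_eq_zero_of_orthogonal (hE i) fun η hη => ?_
    have h1 : M.χ (E i) η = η := Submodule.starProjection_eq_self_iff.2 hη
    rw [← h1, ← (M.isSelfAdjoint_χ (E i)).star_eq, ContinuousLinearMap.star_eq_adjoint,
      ContinuousLinearMap.adjoint_inner_right, h i, inner_zero_left]
  rw [vectorMeasure_univ, ENNReal.ofReal_eq_zero] at h0
  have : ‖ξ‖ = 0 := by nlinarith [norm_nonneg ξ]
  exact norm_eq_zero.1 this


end AmpleModule

/-! ### Hilbert space tensor products -/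

open scoped TensorProduct

/-- The Hilbert space tensor product `H ⊗ K`: the completion of the algebraic tensor product. -/
def HTensor (H K : Type*) [NormedAddCommGroup H] [InnerProductSpace ℂ H]
    [NormedAddCommGroup K] [InnerProductSpace ℂ K] : Type _ :=
  UniformSpace.Completion (H ⊗[ℂ] K)

section Tensor

variable {H K : Type*} [NormedAddCommGroup H] [InnerProductSpace ℂ H]
  [NormedAddCommGroup K] [InnerProductSpace ℂ K]

instance : NormedAddCommGroup (HTensor H K) :=
  inferInstanceAs (NormedAddCommGroup (UniformSpace.Completion (H ⊗[ℂ] K)))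

instance : InnerProductSpace ℂ (HTensor H K) :=
  inferInstanceAs (InnerProductSpace ℂ (UniformSpace.Completion (H ⊗[ℂ] K)))

instance : CompleteSpace (HTensor H K) :=
  inferInstanceAs (CompleteSpace (UniformSpace.Completion (H ⊗[ℂ] K)))

/-- The inclusion of the algebraic tensor product. -/
def HTensor.coe : (H ⊗[ℂ] K) →L[ℂ] HTensor H K :=
  UniformSpace.Completion.toComplL (𝕜 := ℂ) (E := H ⊗[ℂ] K)

theorem HTensor.denseRange_coe : DenseRange (HTensor.coe : (H ⊗[ℂ] K) →L[ℂ] HTensor H K) :=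
  UniformSpace.Completion.denseRange_coe

theorem HTensor.norm_coe (z : H ⊗[ℂ] K) : ‖HTensor.coe z‖ = ‖z‖ :=
  UniformSpace.Completion.norm_coe z

theorem HTensor.inner_coe (z w : H ⊗[ℂ] K) :
    inner ℂ (HTensor.coe z) (HTensor.coe w) = inner ℂ z w :=
  UniformSpace.Completion.inner_coe z w

/-- The elementary tensor operator `S ⊗ T` on the Hilbert space tensor product. -/
def opTensor (S : H →L[ℂ] H) (T : K →L[ℂ] K) : HTensor H K →L[ℂ] HTensor H K :=
  (TensorProduct.mapL S T).completion

theorem opTensor_coe (S : H →L[ℂ] H) (T : K →L[ℂ] K) (z : H ⊗[ℂ] K) :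
    opTensor S T (HTensor.coe z) = HTensor.coe (TensorProduct.mapL S T z) :=
  ContinuousLinearMap.completion_apply_coe _ _

theorem opTensor_ext {A B : HTensor H K →L[ℂ] HTensor H K}
    (h : ∀ (ξ : H) (b : K), A (HTensor.coe (ξ ⊗ₜ[ℂ] b)) = B (HTensor.coe (ξ ⊗ₜ[ℂ] b))) :
    A = B := by
  refine ContinuousLinearMap.ext fun z => ?_
  refine HTensor.denseRange_coe.induction_on z (isClosed_eq A.continuous B.continuous) fun w => ?_
  induction w using TensorProduct.induction_on with
  | zero => rw [map_zero, map_zero, map_zero]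
  | tmul ξ b => exact h ξ b
  | add u v hu hv => rw [map_add, map_add, map_add, hu, hv]

theorem opTensor_tmul (S : H →L[ℂ] H) (T : K →L[ℂ] K) (ξ : H) (b : K) :
    opTensor S T (HTensor.coe (ξ ⊗ₜ[ℂ] b)) = HTensor.coe (S ξ ⊗ₜ[ℂ] T b) := by
  rw [opTensor_coe]; rfl

theorem opTensor_mul (S S' : H →L[ℂ] H) (T T' : K →L[ℂ] K) :
    opTensor S T * opTensor S' T' = opTensor (S * S') (T * T') := by
  refine opTensor_ext fun ξ b => ?_
  simp only [mul_apply_eq_comp, opTensor_tmul]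

theorem opTensor_one_one : opTensor (1 : H →L[ℂ] H) (1 : K →L[ℂ] K) = 1 := by
  refine opTensor_ext fun ξ b => ?_
  simp [opTensor_tmul]

theorem opTensor_add_left (S S' : H →L[ℂ] H) (T : K →L[ℂ] K) :
    opTensor (S + S') T = opTensor S T + opTensor S' T := by
  refine opTensor_ext fun ξ b => ?_
  simp [opTensor_tmul, TensorProduct.add_tmul]

theorem opTensor_smul_left (c : ℂ) (S : H →L[ℂ] H) (T : K →L[ℂ] K) :
    opTensor (c • S) T = c • opTensor S T := by
  refine opTensor_ext fun ξ b => ?_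
  simp [opTensor_tmul, ← TensorProduct.smul_tmul']

theorem opTensor_sub_left (S S' : H →L[ℂ] H) (T : K →L[ℂ] K) :
    opTensor (S - S') T = opTensor S T - opTensor S' T := by
  refine opTensor_ext fun ξ b => ?_
  simp [opTensor_tmul, TensorProduct.sub_tmul]

theorem opTensor_sub_right (S : H →L[ℂ] H) (T T' : K →L[ℂ] K) :
    opTensor S (T - T') = opTensor S T - opTensor S T' := by
  refine opTensor_ext fun ξ b => ?_
  simp [opTensor_tmul, TensorProduct.tmul_sub]

theorem opTensor_zero_left (T : K →L[ℂ] K) : opTensor (0 : H →L[ℂ] H) T = 0 := by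
  refine opTensor_ext fun ξ b => ?_
  simp [opTensor_tmul]

theorem norm_opTensor_le (S : H →L[ℂ] H) (T : K →L[ℂ] K) : ‖opTensor S T‖ ≤ ‖S‖ * ‖T‖ := by
  refine ContinuousLinearMap.opNorm_le_bound _ (by positivity) fun z => ?_
  refine HTensor.denseRange_coe.induction_on z
    (isClosed_le (by fun_prop) (by fun_prop)) fun w => ?_
  rw [opTensor_coe, HTensor.norm_coe, HTensor.norm_coe]
  exact (TensorProduct.mapL S T).le_of_opNorm_le (TensorProduct.norm_mapL_le S T) w

theorem star_opTensor [CompleteSpace H] [CompleteSpace K] (S : H →L[ℂ] H) (T : K →L[ℂ] K) :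
    star (opTensor S T) = opTensor (star S) (star T) := by
  rw [ContinuousLinearMap.star_eq_adjoint, eq_comm, ContinuousLinearMap.eq_adjoint_iff]
  intro x y
  refine HTensor.denseRange_coe.induction_on₂
    (p := fun x y => inner ℂ (opTensor (star S) (star T) x) y = inner ℂ x (opTensor S T y))
    (isClosed_eq (by fun_prop) (by fun_prop)) (fun u v => ?_) x y
  rw [opTensor_coe, opTensor_coe, HTensor.inner_coe, HTensor.inner_coe]
  induction u using TensorProduct.induction_on with
  | zero => simp
  | add u u' hu hu' => rw [map_add, inner_add_left, inner_add_left, hu, hu']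
  | tmul ξ b =>
    induction v using TensorProduct.induction_on with
    | zero => simp
    | add u u' hu hu' => rw [map_add, inner_add_right, inner_add_right, hu, hu']
    | tmul η c =>
      simp [ContinuousLinearMap.star_eq_adjoint, ContinuousLinearMap.adjoint_inner_left]

end Tensor

/-! ### Compact operators -/

/-- The compact operators on a Hilbert space. -/
abbrev Compacts (K : Type*) [NormedAddCommGroup K] [InnerProductSpace ℂ K] :
    Submodule ℂ (K →L[ℂ] K) := compactOperator (RingHom.id ℂ) K K

theorem isCompactOperator_star {K : Type*} [NormedAddCommGroup K] [InnerProductSpace ℂ K]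
    [CompleteSpace K] {T : K →L[ℂ] K} (hT : IsCompactOperator T) :
    IsCompactOperator (star T : K →L[ℂ] K) := by
  have hTT : IsCompactOperator (T * star T : K →L[ℂ] K) := hT.comp_clm (star T)
  refine (isCompactOperator_iff_isCompact_closure_image_closedBall
    (star T : K →L[ℂ] K).toLinearMap one_pos).2 ?_
  have hTT' := hTT.isCompact_closure_image_closedBall
    (f := (T * star T : K →L[ℂ] K).toLinearMap) 1
  refine TotallyBounded.isCompact_of_isClosed ?_ isClosed_closure
  refine TotallyBounded.closure ?_
  have htb := hTT'.totallyBounded.subset subset_closure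
  rw [Metric.totallyBounded_iff] at htb ⊢
  intro ε hε
  obtain ⟨t, htf, ht⟩ := htb (ε ^ 2 / 8) (by positivity)
  classical
  have hsel (y : K) : ∃ z : K, (∃ x ∈ Metric.closedBall (0 : K) 1,
      (T * star T) x ∈ Metric.ball y (ε ^ 2 / 8)) → z ∈ Metric.closedBall (0 : K) 1 ∧
        (T * star T) z ∈ Metric.ball y (ε ^ 2 / 8) := by
    by_cases h : ∃ x ∈ Metric.closedBall (0 : K) 1, (T * star T) x ∈ Metric.ball y (ε ^ 2 / 8)
    · obtain ⟨x, hx⟩ := h; exact ⟨x, fun _ => hx⟩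
    · exact ⟨0, fun h' => absurd h' h⟩
  choose s hs using hsel
  refine ⟨(fun y => (star T : K →L[ℂ] K) (s y)) '' t, htf.image _, ?_⟩
  rintro _ ⟨x, hx, rfl⟩
  have hx' := ht ⟨x, hx, rfl⟩
  simp only [Set.mem_iUnion] at hx'
  obtain ⟨y, hy, hxy⟩ := hx'
  obtain ⟨hz1, hz2⟩ := hs y ⟨x, hx, hxy⟩
  simp only [Set.mem_iUnion]
  refine ⟨_, ⟨y, hy, rfl⟩, ?_⟩
  rw [Metric.mem_ball, dist_eq_norm]
  change ‖(star T : K →L[ℂ] K) x - (star T : K →L[ℂ] K) (s y)‖ < ε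
  rw [← map_sub]
  have h1 : ‖(star T : K →L[ℂ] K) (x - s y)‖ ^ 2 ≤
      ‖(T * star T) (x - s y)‖ * ‖x - s y‖ := by
    have : (‖(star T : K →L[ℂ] K) (x - s y)‖ ^ 2 : ℝ)
        = (inner ℂ ((T * star T) (x - s y)) (x - s y)).re := by
      rw [mul_apply_eq_comp, ← ContinuousLinearMap.adjoint_inner_right,
        ← ContinuousLinearMap.star_eq_adjoint, inner_self_eq_norm_sq_to_K]
      norm_cast
    rw [this]
    exact (Complex.re_le_norm _).trans (norm_inner_le_norm _ _)
  have h2 : ‖(T * star T) (x - s y)‖ < ε ^ 2 / 4 := by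
    rw [map_sub, ← dist_eq_norm]
    refine (dist_triangle_right _ _ y).trans_lt ?_
    have := Metric.mem_ball.1 hz2
    have h3 : dist ((T * star T) x) y < ε ^ 2 / 8 := Metric.mem_ball.1 hxy
    linarith
  have h3 : ‖x - s y‖ ≤ 2 := by
    rw [mem_closedBall_zero_iff] at hx hz1
    exact (norm_sub_le _ _).trans (by linarith)
  refine lt_of_pow_lt_pow_left₀ 2 hε.le (h1.trans_lt ?_)
  nlinarith [norm_nonneg ((T * star T) (x - s y)), norm_nonneg (x - s y), sq_pos_of_pos hε]

/-- The adjoint of a compact operator, as a compact operator. -/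
def Compacts.adj {K : Type*} [NormedAddCommGroup K] [InnerProductSpace ℂ K] [CompleteSpace K]
    (a : Compacts K) : Compacts K := ⟨star (a : K →L[ℂ] K), isCompactOperator_star a.2⟩

/-! ### The operators `Λ(g)` -/

/-- Sums of operators which are block-diagonal for a family of orthogonal projections. -/
theorem exists_blockSum {K : Type*} [NormedAddCommGroup K] [InnerProductSpace ℂ K]
    [CompleteSpace K] {ι : Type*} (Q A : ι → K →L[ℂ] K) (hsa : ∀ i, IsSelfAdjoint (Q i))
    (hid : ∀ i, Q i * Q i = Q i) (hort : Pairwise fun i j => Q i * Q j = 0) {C : ℝ} (hC : 0 ≤ C)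
    (hA : ∀ i z, ‖A i z‖ ≤ C * ‖Q i z‖) (hQA : ∀ i, Q i * A i = A i) :
    ∃ L : K →L[ℂ] K, ‖L‖ ≤ C ∧ ∀ z, HasSum (fun i => A i z) (L z) := by
  classical
  have hsym (i) (x y : K) : inner ℂ (Q i x) y = inner ℂ x (Q i y) := by
    conv_lhs => rw [← (hsa i).star_eq, ContinuousLinearMap.star_eq_adjoint]
    rw [ContinuousLinearMap.adjoint_inner_left]
  let V (i : ι) : Submodule ℂ K := LinearMap.range (Q i).toLinearMap
  have hV : OrthogonalFamily ℂ (fun i => V i) fun i => (V i).subtypeₗᵢ := by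
    intro i j hij v w
    obtain ⟨_, x, rfl⟩ := v
    obtain ⟨_, y, rfl⟩ := w
    change inner ℂ (Q i x) (Q j y) = 0
    rw [hsym, ← mul_apply_eq_comp, hort hij]
    simp
  have hAm (i) (z : K) : A i z ∈ V i := ⟨A i z, by
    change (Q i * A i) z = A i z
    rw [hQA]⟩
  have hbessel (s : Finset ι) (z : K) : ∑ i ∈ s, ‖Q i z‖ ^ 2 ≤ ‖z‖ ^ 2 := by
    have h1 := hV.norm_sum (fun i => ⟨Q i z, ⟨z, rfl⟩⟩) s
    simp only [Submodule.coe_subtypeₗᵢ, Submodule.subtype_apply, Submodule.coe_norm] at h1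
    rw [← h1]
    have h2 : ‖∑ i ∈ s, Q i z‖ ^ 2 = (inner ℂ z (∑ i ∈ s, Q i z)).re := by
      rw [h1, inner_sum, Complex.re_sum]
      refine Finset.sum_congr rfl fun i _ => ?_
      rw [← hid i, mul_apply_eq_comp, ← hsym, ← mul_apply_eq_comp, hid, inner_self_eq_norm_sq_to_K]
      norm_cast
    have h3 : (inner ℂ z (∑ i ∈ s, Q i z)).re ≤ ‖z‖ * ‖∑ i ∈ s, Q i z‖ :=
      (Complex.re_le_norm _).trans (norm_inner_le_norm _ _)
    nlinarith [sq_nonneg (‖z‖ - ‖∑ i ∈ s, Q i z‖)]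
  have hle (s : Finset ι) (z : K) : ∑ i ∈ s, ‖A i z‖ ^ 2 ≤ (C * ‖z‖) ^ 2 := by
    calc ∑ i ∈ s, ‖A i z‖ ^ 2 ≤ ∑ i ∈ s, C ^ 2 * ‖Q i z‖ ^ 2 := by
          refine Finset.sum_le_sum fun i _ => ?_
          rw [← mul_pow]; gcongr; exact hA i z
      _ = C ^ 2 * ∑ i ∈ s, ‖Q i z‖ ^ 2 := by rw [Finset.mul_sum]
      _ ≤ C ^ 2 * ‖z‖ ^ 2 := by gcongr; exact hbessel s z
      _ = _ := by ring
  have hsum (z : K) : Summable fun i => A i z := by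
    have := (hV.summable_iff_norm_sq_summable fun i => ⟨A i z, hAm i z⟩).2
      (summable_of_sum_le (c := (C * ‖z‖) ^ 2) (fun i => by positivity) fun s => hle s z)
    exact this
  let L₀ : K →ₗ[ℂ] K :=
    { toFun := fun z => ∑' i, A i z
      map_add' := fun x y => by
        rw [← (hsum x).tsum_add (hsum y)]; simp only [map_add]
      map_smul' := fun c x => by
        simp only [map_smul, RingHom.id_apply]
        exact ((hsum x).hasSum.const_smul c).tsum_eq }
  have hL₀ (z : K) : ‖L₀ z‖ ≤ C * ‖z‖ := by
    refine le_of_tendsto (hsum z).hasSum.norm (.of_forall fun s => ?_)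
    have h1 := hV.norm_sum (fun i => ⟨A i z, hAm i z⟩) s
    simp only [Submodule.coe_subtypeₗᵢ, Submodule.subtype_apply, Submodule.coe_norm] at h1
    refine le_of_sq_le_sq ?_ (by positivity)
    rw [h1]
    exact hle s z
  exact ⟨L₀.mkContinuous C hL₀, LinearMap.mkContinuous_norm_le _ hC _, fun z => (hsum z).hasSum⟩

namespace AmpleModule

variable {X : Type*} [MetricSpace X] [ProperSpace X] [MeasurableSpace X] [BorelSpace X] {H : Type*}
  [NormedAddCommGroup H] [InnerProductSpace ℂ H] [CompleteSpace H] (M : AmpleModule X H)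
  {K : Type*} [NormedAddCommGroup K] [InnerProductSpace ℂ K]

theorem exists_sum_χ_opTensor {ι : Type*} {E : ι → Set X} (hE : ∀ i, MeasurableSet (E i))
    (hdisj : Pairwise (Function.onFun Disjoint E)) (a : ι → K →L[ℂ] K) {C : ℝ} (hC : 0 ≤ C)
    [CompleteSpace K] (ha : ∀ i, ‖a i‖ ≤ C) :
    ∃ L : HTensor H K →L[ℂ] HTensor H K, ‖L‖ ≤ C ∧
      ∀ z, HasSum (fun i => opTensor (M.χ (E i)) (a i) z) (L z) := by
  refine exists_blockSum (fun i => opTensor (M.χ (E i)) 1) _ (fun i => ?_) (fun i => ?_)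
    (fun i j hij => ?_) hC (fun i z => ?_) (fun i => ?_)
  · rw [IsSelfAdjoint, star_opTensor, (M.isSelfAdjoint_χ _).star_eq, star_one]
  · rw [opTensor_mul, χ_mul_self, one_mul]
  · change opTensor _ _ * opTensor _ _ = 0
    rw [opTensor_mul, M.χ_mul_of_disjoint (hE i) (hE j) (hdisj hij), opTensor_zero_left]
  · have h1 : opTensor (M.χ (E i)) (a i) z = opTensor 1 (a i) (opTensor (M.χ (E i)) 1 z) := by
      rw [← mul_apply_eq_comp, opTensor_mul, one_mul, mul_one]
    rw [h1]
    refine ContinuousLinearMap.le_of_opNorm_le _ ((norm_opTensor_le _ _).trans ?_) _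
    calc ‖(1 : H →L[ℂ] H)‖ * ‖a i‖ ≤ 1 * C := by
          gcongr
          · exact ContinuousLinearMap.norm_id_le
          · exact ha i
      _ = C := one_mul C
  · rw [opTensor_mul, χ_mul_self, one_mul]

/-- `L` is the operator `Λ(g)` of the bounded countably-valued map `g = ∑ aₙ χ_{Eₙ}`, for a
countable Borel partition `(Eₙ)`; i.e. `L` is the strongly convergent sum of the operators
`χ_{Eₙ} ⊗ aₙ`. -/
def IsLambdaCountable (g : X → Compacts K) (L : HTensor H K →L[ℂ] HTensor H K) : Prop :=
  ∃ (E : ℕ → Set X) (a : ℕ → Compacts K),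
    (∀ n, MeasurableSet (E n)) ∧ Pairwise (Function.onFun Disjoint E) ∧ ⋃ n, E n = Set.univ ∧
    (∀ n, ∀ x ∈ E n, g x = a n) ∧ (∃ C : ℝ, ∀ n, ‖a n‖ ≤ C) ∧
    ∀ z, HasSum (fun n => opTensor (M.χ (E n)) (a n : K →L[ℂ] K) z) (L z)

/-- `L` is the operator `Λ(g)`: it is the norm limit of operators `Λ(gₙ)`, for a sequence of
bounded countably-valued maps `gₙ` which converges uniformly to `g`. -/
def IsLambda (g : X → Compacts K) (L : HTensor H K →L[ℂ] HTensor H K) : Prop :=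
  ∃ (gs : ℕ → X → Compacts K) (Ls : ℕ → HTensor H K →L[ℂ] HTensor H K),
    (∀ n, M.IsLambdaCountable (gs n) (Ls n)) ∧ TendstoUniformly gs g Filter.atTop ∧
    Filter.Tendsto Ls Filter.atTop (𝓝 L)

theorem IsLambdaCountable.isLambda {g : X → Compacts K} {L : HTensor H K →L[ℂ] HTensor H K}
    (h : M.IsLambdaCountable g L) : M.IsLambda g L :=
  ⟨fun _ => g, fun _ => L, fun _ => h, fun _ hu => .of_forall fun _ _ => refl_mem_uniformity hu,
    tendsto_const_nhds⟩

variable [CompleteSpace K]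

/-- `Λ` is isometric, in particular well-defined, on bounded countably-valued maps. -/
theorem IsLambdaCountable.norm_sub_le {g h : X → Compacts K}
    {L L' : HTensor H K →L[ℂ] HTensor H K} (hL : M.IsLambdaCountable g L)
    (hL' : M.IsLambdaCountable h L') {C : ℝ} (hC : 0 ≤ C) (hgh : ∀ x, ‖g x - h x‖ ≤ C) :
    ‖L - L'‖ ≤ C := by
  classical
  obtain ⟨E, a, hE, hEd, hEU, hga, -, hLs⟩ := hL
  obtain ⟨F, b, hF, hFd, hFU, hhb, -, hLs'⟩ := hL'
  let G : ℕ × ℕ → Set X := fun p => E p.1 ∩ F p.2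
  have hG (p) : MeasurableSet (G p) := (hE p.1).inter (hF p.2)
  have hGd : Pairwise (Function.onFun Disjoint G) := by
    intro p q hpq
    rw [Function.onFun, Set.disjoint_left]
    rintro x ⟨hx1, hx2⟩ ⟨hx3, hx4⟩
    refine hpq (Prod.ext ?_ ?_)
    · by_contra hne; exact Set.disjoint_left.1 (hEd hne) hx1 hx3
    · by_contra hne; exact Set.disjoint_left.1 (hFd hne) hx2 hx4
  have hGU : ⋃ p, G p = Set.univ := by
    refine Set.eq_univ_of_forall fun x => ?_
    have h1 : x ∈ ⋃ n, E n := by rw [hEU]; trivial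
    have h2 : x ∈ ⋃ n, F n := by rw [hFU]; trivial
    obtain ⟨n, hn⟩ := Set.mem_iUnion.1 h1
    obtain ⟨m, hm⟩ := Set.mem_iUnion.1 h2
    exact Set.mem_iUnion.2 ⟨(n, m), hn, hm⟩
  -- the sum of the `χ_{G p} ⊗ 1` is the identity
  obtain ⟨S, -, hS⟩ := M.exists_sum_χ_opTensor (K := K) hG hGd (fun _ => 1) zero_le_one
    (fun _ => ContinuousLinearMap.norm_id_le)
  obtain ⟨P, -, hP⟩ := exists_blockSum (fun p => M.χ (G p)) (fun p => M.χ (G p))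
    (fun p => M.isSelfAdjoint_χ _) (fun p => M.χ_mul_self _)
    (fun p q hpq => M.χ_mul_of_disjoint (hG p) (hG q) (hGd hpq)) zero_le_one
    (fun p z => by simp) (fun p => M.χ_mul_self _)
  have hP1 (ξ : H) : P ξ = ξ := by
    rw [← sub_eq_zero]
    refine M.eq_zero_of_χ_eq_zero hG hGU fun p => ?_
    rw [map_sub, sub_eq_zero]
    have h1 := (M.χ (G p)).hasSum (hP ξ)
    refine h1.unique ?_
    convert hasSum_single (f := fun q => M.χ (G p) (M.χ (G q) ξ)) p (fun q hq => ?_) using 1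
    · change _ = (M.χ (G p) * M.χ (G p)) ξ
      rw [χ_mul_self]
    · change (M.χ (G p) * M.χ (G q)) ξ = 0
      rw [M.χ_mul_of_disjoint (hG p) (hG q) (hGd hq.symm)]; rfl
  have hS1 : S = 1 := by
    refine opTensor_ext fun ξ c => ?_
    refine (hS _).unique ?_
    simp only [opTensor_tmul]
    have h2 := (HTensor.coe (H := H) (K := K)).hasSum
      (((TensorProduct.mkL ℂ H K).flip c).hasSum (hP ξ))
    rw [hP1] at h2
    exact h2
  -- the difference is the block sum for the common refinement
  let d : ℕ × ℕ → K →L[ℂ] K := fun p =>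
    if (G p).Nonempty then (a p.1 : K →L[ℂ] K) - (b p.2 : K →L[ℂ] K) else 0
  have hd (p) : ‖d p‖ ≤ C := by
    by_cases hp : (G p).Nonempty
    · obtain ⟨x, hx1, hx2⟩ := hp
      have := hgh x
      rw [hga _ x hx1, hhb _ x hx2] at this
      have hp : (G p).Nonempty := ⟨x, hx1, hx2⟩
      simpa [d, hp] using this
    · simpa [d, hp] using hC
  obtain ⟨D, hD, hDs⟩ := M.exists_sum_χ_opTensor hG hGd d hC hd
  have comp {E' : ℕ → Set X} {a' : ℕ → Compacts K} {L'' : HTensor H K →L[ℂ] HTensor H K}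
      (hE' : ∀ n, MeasurableSet (E' n)) (hEd' : Pairwise (Function.onFun Disjoint E'))
      (hs : ∀ z, HasSum (fun n => opTensor (M.χ (E' n)) (a' n : K →L[ℂ] K) z) (L'' z))
      (p : ℕ × ℕ) (n : ℕ) (hpn : G p ⊆ E' n) :
      L'' * opTensor (M.χ (G p)) 1 = opTensor (M.χ (G p)) (a' n : K →L[ℂ] K) := by
    refine ContinuousLinearMap.ext fun z => ?_
    have h2 := hasSum_single (f := fun m => opTensor (M.χ (E' m)) (a' m : K →L[ℂ] K)
      (opTensor (M.χ (G p)) 1 z)) n (fun m hm => by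
        change (opTensor (M.χ (E' m)) (a' m : K →L[ℂ] K) * opTensor (M.χ (G p)) 1 :
          HTensor H K →L[ℂ] HTensor H K) z = 0
        rw [opTensor_mul, M.χ_mul_of_disjoint (hE' m) (hG p)
          ((hEd' hm).mono_right hpn), opTensor_zero_left]
        rfl)
    refine ((hs (opTensor (M.χ (G p)) 1 z)).unique h2).trans ?_
    change (opTensor (M.χ (E' n)) (a' n : K →L[ℂ] K) * opTensor (M.χ (G p)) 1 :
      HTensor H K →L[ℂ] HTensor H K) z = _
    rw [opTensor_mul, M.χ_mul_of_subset hpn, mul_one]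
  have hLD : L - L' = D := by
    refine ContinuousLinearMap.ext fun z => ?_
    have h1 := (L - L').hasSum (hS z)
    rw [hS1] at h1
    have h3 (p : ℕ × ℕ) : opTensor (M.χ (G p)) (d p) = (L - L') * opTensor (M.χ (G p)) 1 := by
      rw [sub_mul, comp hE hEd hLs p p.1 Set.inter_subset_left,
        comp hF hFd hLs' p p.2 Set.inter_subset_right, ← opTensor_sub_right]
      by_cases hp : (G p).Nonempty
      · simp [d, hp]
      · rw [Set.not_nonempty_iff_eq_empty.1 hp, χ_empty, opTensor_zero_left, opTensor_zero_left]
    refine HasSum.unique h1 ?_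
    convert hDs z using 2 with p
    rw [h3]
    rfl
  rw [hLD]
  exact hD

theorem exists_isLambdaCountable {E : ℕ → Set X} {a : ℕ → Compacts K}
    (hE : ∀ n, MeasurableSet (E n)) (hd : Pairwise (Function.onFun Disjoint E))
    (hU : ⋃ n, E n = Set.univ) {g : X → Compacts K} (hg : ∀ n, ∀ x ∈ E n, g x = a n) {C : ℝ}
    (hC : ∀ n, ‖a n‖ ≤ C) : ∃ L, M.IsLambdaCountable g L := by
  obtain ⟨L, -, hL⟩ := M.exists_sum_χ_opTensor hE hd (fun n => (a n : K →L[ℂ] K))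
    ((norm_nonneg _).trans (hC 0)) hC
  exact ⟨L, E, a, hE, hd, hU, hg, ⟨C, hC⟩, hL⟩

theorem IsLambda.unique {g : X → Compacts K} {L L' : HTensor H K →L[ℂ] HTensor H K}
    (hL : M.IsLambda g L) (hL' : M.IsLambda g L') : L = L' := by
  obtain ⟨gs, Ls, h1, h2, h3⟩ := hL
  obtain ⟨gs', Ls', h1', h2', h3'⟩ := hL'
  refine eq_of_norm_sub_le_zero (le_of_forall_pos_le_add fun ε hε => ?_)
  have h4 : Filter.Tendsto (fun n => ‖Ls n - Ls' n‖) Filter.atTop (𝓝 ‖L - L'‖) :=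
    (continuous_norm.tendsto _).comp (h3.sub h3')
  refine le_of_tendsto h4 ?_
  filter_upwards [Metric.tendstoUniformly_iff.1 h2 (ε / 2) (by positivity),
    Metric.tendstoUniformly_iff.1 h2' (ε / 2) (by positivity)] with n hn hn'
  rw [zero_add]
  refine (h1 n).norm_sub_le M (h1' n) hε.le fun x => ?_
  rw [← dist_eq_norm]
  refine (dist_triangle_left _ _ (g x)).trans ?_
  linarith [hn x, hn' x]

theorem exists_isLambda {g : X → Compacts K} (hg : StronglyMeasurable g)
    (hb : ∃ C : ℝ, ∀ x, ‖g x‖ ≤ C) : ∃ L, M.IsLambda g L := by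
  classical
  obtain ⟨C, hC⟩ := hb
  rcases isEmpty_or_nonempty X with hX | hX
  · obtain ⟨L, hL⟩ := M.exists_isLambdaCountable (E := fun _ => (∅ : Set X)) (a := fun _ => 0)
      (g := g) (fun _ => .empty) (fun _ _ _ => by simp) (Subsingleton.elim _ _)
      (fun _ x => isEmptyElim x) (C := 0) (by simp)
    exact ⟨L, hL.isLambda M⟩
  have hsep := hg.isSeparable_range
  obtain ⟨c, hcs, hc⟩ : ∃ c : Set (Compacts K), c.Countable ∧ Set.range g ⊆ closure c ∧
      c ⊆ Set.range g := by
    obtain ⟨c, h1, h2, h3⟩ := hsep.exists_countable_dense_subset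
    exact ⟨c, h2, h3, h1⟩
  have hcne : c.Nonempty := by
    obtain ⟨x⟩ := hX
    exact closure_nonempty_iff.1 ⟨g x, hc.1 ⟨x, rfl⟩⟩
  obtain ⟨a, rfl⟩ := hcs.exists_eq_range hcne
  -- the first index of a point of the dense sequence which is `1/(k+1)`-close to `g x`
  have hex (k : ℕ) (x : X) : ∃ n, dist (g x) (a n) < 1 / (k + 1) := by
    have := Metric.mem_closure_iff.1 (hc.1 ⟨x, rfl⟩) (1 / (k + 1)) (by positivity)
    simpa using this
  let ν (k : ℕ) (x : X) : ℕ := Nat.find (hex k x)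
  have hνm (k n : ℕ) : MeasurableSet {x | ν k x = n} := by
    have hset (m : ℕ) : MeasurableSet {x | dist (g x) (a m) < 1 / ((k : ℝ) + 1)} :=
      measurableSet_lt (hg.dist stronglyMeasurable_const).measurable measurable_const
    have : {x | ν k x = n} = {x | dist (g x) (a n) < 1 / ((k : ℝ) + 1)} ∩
        ⋂ m ∈ Finset.range n, {x | dist (g x) (a m) < 1 / ((k : ℝ) + 1)}ᶜ := by
      ext x
      simp only [ν, Nat.find_eq_iff, Set.mem_ofPred_eq, Set.mem_inter_iff, Set.mem_iInter,
        Finset.mem_range, Set.mem_compl_iff]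
    rw [this]
    exact (hset n).inter (Finset.measurableSet_biInter _ fun m _ => (hset m).compl)
  have haC (n : ℕ) : ‖a n‖ ≤ C := by
    obtain ⟨x, hx⟩ := hc.2 ⟨n, rfl⟩
    rw [← hx]; exact hC x
  have hL (k : ℕ) : ∃ L, M.IsLambdaCountable (fun x => a (ν k x)) L :=
    M.exists_isLambdaCountable (E := fun n => {x | ν k x = n}) (a := a) (hνm k)
      (fun n m hnm => Set.disjoint_left.2 fun x hx hx' => hnm (hx.symm.trans hx'))
      (Set.eq_univ_of_forall fun x => Set.mem_iUnion.2 ⟨ν k x, rfl⟩)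
      (fun n x hx => by rw [show ν k x = n from hx]) haC
  choose Ls hLs using hL
  have hclose (k : ℕ) (x : X) : dist (g x) (a (ν k x)) < 1 / (k + 1) := Nat.find_spec (hex k x)
  have hcau : CauchySeq Ls := by
    refine Metric.cauchySeq_iff.2 fun ε hε => ?_
    obtain ⟨N, hN⟩ := exists_nat_one_div_lt (show 0 < ε / 4 by positivity)
    refine ⟨N, fun m hm n hn => ?_⟩
    rw [dist_eq_norm]
    refine ((hLs m).norm_sub_le M (hLs n) (C := ε / 2) (by positivity) fun x => ?_).trans_lt
      (by linarith)
    rw [← dist_eq_norm]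
    refine (dist_triangle_left _ _ (g x)).trans ?_
    have h1 : (1 : ℝ) / (m + 1) ≤ 1 / (N + 1) := by gcongr
    have h2 : (1 : ℝ) / (n + 1) ≤ 1 / (N + 1) := by gcongr
    linarith [hclose m x, hclose n x]
  obtain ⟨L, hL⟩ := cauchySeq_tendsto_of_complete hcau
  refine ⟨L, fun k x => a (ν k x), Ls, hLs, Metric.tendstoUniformly_iff.2 fun ε hε => ?_, hL⟩
  have hlim0 : Filter.Tendsto (fun n : ℕ => (1 : ℝ) / (n + 1)) Filter.atTop (𝓝 0) :=
    tendsto_one_div_add_atTop_nhds_zero_nat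
  filter_upwards [hlim0.eventually (gt_mem_nhds hε)] with n hn x
  exact (hclose n x).trans hn

/-- The operator `Λ(g)` on `H ⊗ K` of a bounded strongly measurable map `g`. -/
def Lambda (g : X → Compacts K) (hg : StronglyMeasurable g) (hb : ∃ C : ℝ, ∀ x, ‖g x‖ ≤ C) :
    HTensor H K →L[ℂ] HTensor H K := (M.exists_isLambda hg hb).choose

theorem isLambda_Lambda {g : X → Compacts K} (hg : StronglyMeasurable g)
    (hb : ∃ C : ℝ, ∀ x, ‖g x‖ ≤ C) : M.IsLambda g (M.Lambda g hg hb) :=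
  (M.exists_isLambda hg hb).choose_spec


theorem IsLambdaCountable.norm_le {g : X → Compacts K} {L : HTensor H K →L[ℂ] HTensor H K}
    (hL : M.IsLambdaCountable g L) {C : ℝ} (hC : 0 ≤ C) (hg : ∀ x, ‖g x‖ ≤ C) : ‖L‖ ≤ C := by
  have h0 : M.IsLambdaCountable (fun _ => (0 : Compacts K)) (0 : HTensor H K →L[ℂ] HTensor H K) := by
    refine ⟨fun n => if n = 0 then Set.univ else ∅, fun _ => 0, fun n => ?_, fun m n hmn => ?_, ?_,
      fun _ _ _ => rfl, ⟨0, by simp⟩, fun z => ?_⟩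
    · dsimp only; split_ifs <;> simp
    · simp only [Function.onFun]
      by_cases hm : m = 0
      · have : n ≠ 0 := fun h => hmn (hm.trans h.symm)
        simp [this]
      · simp [hm]
    · exact Set.eq_univ_of_forall fun x => Set.mem_iUnion.2 ⟨0, by simp⟩
    · have (S : H →L[ℂ] H) : opTensor S (0 : K →L[ℂ] K) = 0 := by
        simpa using opTensor_sub_right S (0 : K →L[ℂ] K) 0
      simp [this, hasSum_zero]
  simpa using hL.norm_sub_le M h0 hC (by simpa using hg)

theorem norm_Lambda_le {g : X → Compacts K} (hg : StronglyMeasurable g)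
    (hb : ∃ C : ℝ, ∀ x, ‖g x‖ ≤ C) {C : ℝ} (hC : 0 ≤ C) (hgC : ∀ x, ‖g x‖ ≤ C) :
    ‖M.Lambda g hg hb‖ ≤ C := by
  obtain ⟨gs, Ls, h1, h2, h3⟩ := M.isLambda_Lambda hg hb
  refine le_of_forall_pos_le_add fun ε hε => ?_
  have h4 : Filter.Tendsto (fun n => ‖Ls n‖) Filter.atTop (𝓝 ‖M.Lambda g hg hb‖) := h3.norm
  refine le_of_tendsto h4 ?_
  filter_upwards [Metric.tendstoUniformly_iff.1 h2 ε hε] with n hn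
  refine (h1 n).norm_le M (by positivity) fun x => ?_
  have h5 := hn x
  rw [dist_eq_norm] at h5
  have h6 := norm_sub_norm_le (gs n x) (g x)
  rw [norm_sub_rev] at h6
  linarith [hgC x]

theorem IsLambdaCountable.star {g : X → Compacts K} {L : HTensor H K →L[ℂ] HTensor H K}
    (hL : M.IsLambdaCountable g L) : M.IsLambdaCountable (fun x => Compacts.adj (g x)) (star L) := by
  obtain ⟨E, a, hE, hd, hU, hg, ⟨C, hC⟩, hs⟩ := hL
  have hC' (n : ℕ) : ‖Compacts.adj (a n)‖ ≤ C := by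
    rw [Submodule.coe_norm, Compacts.adj, norm_star]; exact hC n
  obtain ⟨L', -, hL'⟩ := M.exists_sum_χ_opTensor hE hd (fun n => (Compacts.adj (a n) : K →L[ℂ] K))
    ((norm_nonneg _).trans (hC 0)) hC'
  have : L' = Star.star L := by
    rw [ContinuousLinearMap.star_eq_adjoint, ContinuousLinearMap.eq_adjoint_iff]
    intro x y
    have h1 := (innerSL ℂ y).hasSum (hL' x)
    have h2 := (innerSL ℂ x).hasSum (hs y)
    have h3 := h1.star
    refine (HasSum.unique ?_ h2 : inner ℂ (L' x) y = inner ℂ x (L y))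
    convert h3 using 1
    · ext n
      change inner ℂ x (opTensor (M.χ (E n)) (a n : K →L[ℂ] K) y)
        = Star.star (inner ℂ y (opTensor (M.χ (E n)) (Star.star (a n : K →L[ℂ] K)) x))
      have e : opTensor (M.χ (E n)) (Star.star (a n : K →L[ℂ] K))
          = ContinuousLinearMap.adjoint (opTensor (M.χ (E n)) (a n : K →L[ℂ] K)) := by
        rw [← ContinuousLinearMap.star_eq_adjoint, star_opTensor, (M.isSelfAdjoint_χ (E n)).star_eq]
      rw [e, ← ContinuousLinearMap.adjoint_inner_left]
      exact (inner_conj_symm _ _).symm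
    · exact (inner_conj_symm _ _).symm
  exact ⟨E, fun n => Compacts.adj (a n), hE, hd, hU, fun n x hx => congrArg Compacts.adj (hg n x hx), ⟨C, hC'⟩, this ▸ hL'⟩

theorem norm_adj_sub (a b : Compacts K) : ‖Compacts.adj a - Compacts.adj b‖ = ‖a - b‖ := by
  rw [Submodule.coe_norm, Submodule.coe_norm, Submodule.coe_sub, Submodule.coe_sub]
  change ‖star (a : K →L[ℂ] K) - star (b : K →L[ℂ] K)‖ = _
  rw [← star_sub, norm_star]

theorem star_Lambda {g : X → Compacts K} (hg : StronglyMeasurable g)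
    (hb : ∃ C : ℝ, ∀ x, ‖g x‖ ≤ C) (hg' : StronglyMeasurable fun x => Compacts.adj (g x))
    (hb' : ∃ C : ℝ, ∀ x, ‖Compacts.adj (g x)‖ ≤ C) :
    star (M.Lambda g hg hb) = M.Lambda (fun x => Compacts.adj (g x)) hg' hb' := by
  obtain ⟨gs, Ls, h1, h2, h3⟩ := M.isLambda_Lambda hg hb
  refine IsLambda.unique M ⟨fun n x => Compacts.adj (gs n x), fun n => star (Ls n), fun n => (h1 n).star M,
    Metric.tendstoUniformly_iff.2 fun ε hε => ?_, h3.star⟩ (M.isLambda_Lambda hg' hb')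
  filter_upwards [Metric.tendstoUniformly_iff.1 h2 ε hε] with n hn x
  rw [dist_eq_norm, norm_adj_sub, ← dist_eq_norm]
  exact hn x

/-! ### The strongly quasi-local algebra -/

/-- `T` is locally compact: `f T` and `T f` are compact for all `f ∈ C₀(X)`. -/
def IsLocallyCompact {X : Type*} [MetricSpace X] {H : Type*} [NormedAddCommGroup H]
    [InnerProductSpace ℂ H] [CompleteSpace H] (M : AmpleModule X H) (T : H →L[ℂ] H) : Prop :=
  ∀ f : C₀(X, ℂ), IsCompactOperator (M.rep f * T) ∧ IsCompactOperator (T * M.rep f)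

/-- The map `g` has `(δ, R)`-variation. -/
def HasVariation {X : Type*} [MetricSpace X] {B : Type*} [NormedAddCommGroup B] (g : X → B)
    (δ R : ℝ) : Prop := ∀ x y, dist x y < R → ‖g x - g y‖ < δ

variable (K) in
/-- Strong quasi-locality of an operator `T` on `H`: the commutators of `T ⊗ 1` with `Λ(g)`, for
strongly measurable maps `g` from `X` into the unit ball of the compact operators on the auxiliary
Hilbert space `K`, are uniformly small if `g` has `(δ, R)`-variation. -/
def IsStronglyQuasiLocal (T : H →L[ℂ] H) : Prop :=
  ∀ ε > 0, ∃ δ > 0, ∃ R > 0, ∀ (g : X → Compacts K) (hg : StronglyMeasurable g)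
    (hg1 : ∀ x, ‖g x‖ ≤ 1), HasVariation g δ R →
    ‖opTensor T (1 : K →L[ℂ] K) * M.Lambda g hg ⟨1, hg1⟩
      - M.Lambda g hg ⟨1, hg1⟩ * opTensor T (1 : K →L[ℂ] K)‖ < ε

theorem HasVariation.mono {B : Type*} [NormedAddCommGroup B] {g : X → B} {δ δ' R R' : ℝ}
    (h : HasVariation g δ R) (hδ : δ ≤ δ') (hR : R' ≤ R) : HasVariation g δ' R' :=
  fun x y hxy => (h x y (hxy.trans_le hR)).trans_le hδ

theorem IsLocallyCompact.add {S T : H →L[ℂ] H} (hS : M.IsLocallyCompact S)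
    (hT : M.IsLocallyCompact T) : M.IsLocallyCompact (S + T) := fun f =>
  ⟨by rw [mul_add]; exact (hS f).1.add (hT f).1, by rw [add_mul]; exact (hS f).2.add (hT f).2⟩

theorem IsLocallyCompact.mul {S T : H →L[ℂ] H} (hS : M.IsLocallyCompact S)
    (hT : M.IsLocallyCompact T) : M.IsLocallyCompact (S * T) := fun f =>
  ⟨by rw [← mul_assoc]; exact (hS f).1.comp_clm T, by rw [mul_assoc]; exact (hT f).2.clm_comp S⟩

theorem IsLocallyCompact.smul (c : ℂ) {T : H →L[ℂ] H} (hT : M.IsLocallyCompact T) :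
    M.IsLocallyCompact (c • T) := fun f =>
  ⟨by rw [mul_smul_comm]; exact (hT f).1.smul c, by rw [smul_mul_assoc]; exact (hT f).2.smul c⟩

theorem IsLocallyCompact.star {T : H →L[ℂ] H} (hT : M.IsLocallyCompact T) :
    M.IsLocallyCompact (star T) := fun f => by
  have h := hT (Star.star f)
  refine ⟨?_, ?_⟩
  · have := isCompactOperator_star h.2
    rwa [star_mul, map_star, star_star] at this
  · have := isCompactOperator_star h.1
    rwa [star_mul, map_star, star_star] at this

theorem IsStronglyQuasiLocal.add {S T : H →L[ℂ] H} (hS : M.IsStronglyQuasiLocal K S)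
    (hT : M.IsStronglyQuasiLocal K T) : M.IsStronglyQuasiLocal K (S + T) := fun ε hε => by
  obtain ⟨δ, hδ, R, hR, h⟩ := hS (ε / 2) (by positivity)
  obtain ⟨δ', hδ', R', hR', h'⟩ := hT (ε / 2) (by positivity)
  refine ⟨min δ δ', lt_min hδ hδ', max R R', lt_max_of_lt_left hR, fun g hg hg1 hv => ?_⟩
  have h1 := h g hg hg1 (hv.mono (min_le_left _ _) (le_max_left _ _))
  have h2 := h' g hg hg1 (hv.mono (min_le_right _ _) (le_max_right _ _))
  have e : opTensor (S + T) (1 : K →L[ℂ] K) * M.Lambda g hg ⟨1, hg1⟩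
      - M.Lambda g hg ⟨1, hg1⟩ * opTensor (S + T) (1 : K →L[ℂ] K)
      = (opTensor S 1 * M.Lambda g hg ⟨1, hg1⟩ - M.Lambda g hg ⟨1, hg1⟩ * opTensor S 1)
      + (opTensor T 1 * M.Lambda g hg ⟨1, hg1⟩ - M.Lambda g hg ⟨1, hg1⟩ * opTensor T 1) := by
    rw [opTensor_add_left]; noncomm_ring
  rw [e]
  exact (norm_add_le _ _).trans_lt (by linarith)

theorem norm_opTensor_one_le (T : H →L[ℂ] H) : ‖opTensor T (1 : K →L[ℂ] K)‖ ≤ ‖T‖ := by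
  refine (norm_opTensor_le _ _).trans ?_
  have : ‖(1 : K →L[ℂ] K)‖ ≤ 1 := ContinuousLinearMap.norm_id_le
  nlinarith [norm_nonneg T]

theorem IsStronglyQuasiLocal.mul {S T : H →L[ℂ] H} (hS : M.IsStronglyQuasiLocal K S)
    (hT : M.IsStronglyQuasiLocal K T) : M.IsStronglyQuasiLocal K (S * T) := fun ε hε => by
  obtain ⟨δ, hδ, R, hR, h⟩ := hS (ε / (‖S‖ + ‖T‖ + 1)) (by positivity)
  obtain ⟨δ', hδ', R', hR', h'⟩ := hT (ε / (‖S‖ + ‖T‖ + 1)) (by positivity)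
  refine ⟨min δ δ', lt_min hδ hδ', max R R', lt_max_of_lt_left hR, fun g hg hg1 hv => ?_⟩
  have h1 := h g hg hg1 (hv.mono (min_le_left _ _) (le_max_left _ _))
  have h2 := h' g hg hg1 (hv.mono (min_le_right _ _) (le_max_right _ _))
  have e : opTensor (S * T) (1 : K →L[ℂ] K) * M.Lambda g hg ⟨1, hg1⟩
      - M.Lambda g hg ⟨1, hg1⟩ * opTensor (S * T) (1 : K →L[ℂ] K)
      = (opTensor S 1 * M.Lambda g hg ⟨1, hg1⟩ - M.Lambda g hg ⟨1, hg1⟩ * opTensor S 1)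
        * opTensor T 1
      + opTensor S 1 *
        (opTensor T 1 * M.Lambda g hg ⟨1, hg1⟩ - M.Lambda g hg ⟨1, hg1⟩ * opTensor T 1) := by
    have : opTensor (S * T) (1 : K →L[ℂ] K) = opTensor S 1 * opTensor T 1 := by
      rw [opTensor_mul, one_mul]
    rw [this]; noncomm_ring
  rw [e]
  have h3 := norm_opTensor_one_le (K := K) S
  have h4 := norm_opTensor_one_le (K := K) T
  refine (norm_add_le _ _).trans_lt ?_
  have h5 := norm_mul_le (opTensor S (1 : K →L[ℂ] K) * M.Lambda g hg ⟨1, hg1⟩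
    - M.Lambda g hg ⟨1, hg1⟩ * opTensor S 1) (opTensor T 1)
  have h6 := norm_mul_le (opTensor S (1 : K →L[ℂ] K)) (opTensor T 1 * M.Lambda g hg ⟨1, hg1⟩
    - M.Lambda g hg ⟨1, hg1⟩ * opTensor T 1)
  have h7 : ε / (‖S‖ + ‖T‖ + 1) * ‖T‖ + ‖S‖ * (ε / (‖S‖ + ‖T‖ + 1)) < ε := by
    rw [div_mul_eq_mul_div, mul_div_assoc', ← add_div, div_lt_iff₀ (by positivity)]
    nlinarith
  refine lt_of_le_of_lt (add_le_add (h5.trans ?_) (h6.trans ?_)) h7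
  · gcongr
  · gcongr

theorem IsStronglyQuasiLocal.smul (c : ℂ) {T : H →L[ℂ] H} (hT : M.IsStronglyQuasiLocal K T) :
    M.IsStronglyQuasiLocal K (c • T) := fun ε hε => by
  obtain ⟨δ, hδ, R, hR, h⟩ := hT (ε / (‖c‖ + 1)) (by positivity)
  refine ⟨δ, hδ, R, hR, fun g hg hg1 hv => ?_⟩
  have h1 := h g hg hg1 hv
  rw [opTensor_smul_left, smul_mul_assoc, mul_smul_comm, ← smul_sub, norm_smul]
  rw [lt_div_iff₀ (by positivity)] at h1
  refine lt_of_le_of_lt ?_ h1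
  rw [mul_comm]
  gcongr
  linarith

theorem IsStronglyQuasiLocal.star {T : H →L[ℂ] H} (hT : M.IsStronglyQuasiLocal K T) :
    M.IsStronglyQuasiLocal K (star T) := fun ε hε => by
  obtain ⟨δ, hδ, R, hR, h⟩ := hT ε hε
  refine ⟨δ, hδ, R, hR, fun g hg hg1 hv => ?_⟩
  have hcont : Continuous (Compacts.adj : Compacts K → Compacts K) :=
    (Isometry.of_dist_eq fun a b => by
      rw [dist_eq_norm, norm_adj_sub, ← dist_eq_norm]).continuous
  have hg' : StronglyMeasurable fun x => Compacts.adj (g x) := hcont.comp_stronglyMeasurable hg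
  have hg1' (x : X) : ‖Compacts.adj (g x)‖ ≤ 1 := by
    rw [Submodule.coe_norm, Compacts.adj, norm_star]; exact hg1 x
  have h1 := h _ hg' hg1' fun x y hxy => by rw [norm_adj_sub]; exact hv x y hxy
  rw [← M.star_Lambda hg ⟨1, hg1⟩ hg' ⟨1, hg1'⟩, ← norm_star, star_sub, star_mul, star_mul,
    star_star, star_opTensor, star_one, norm_sub_rev] at h1
  exact h1

variable (K) in
/-- The strongly quasi-local algebra `C*_sq(H)`: all locally compact strongly quasi-local
operators. -/
def sqAlgebra : NonUnitalStarSubalgebra ℂ (H →L[ℂ] H) where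
  carrier := {T | M.IsLocallyCompact T ∧ M.IsStronglyQuasiLocal K T}
  add_mem' hS hT := ⟨hS.1.add M hT.1, hS.2.add M hT.2⟩
  zero_mem' := by
    refine ⟨fun f => ?_, fun ε hε => ⟨1, one_pos, 1, one_pos, fun g hg hg1 _ => ?_⟩⟩
    · rw [mul_zero, zero_mul]; exact ⟨isCompactOperator_zero, isCompactOperator_zero⟩
    · rw [opTensor_zero_left, mul_zero, zero_mul, sub_zero, norm_zero]; exact hε
  mul_mem' hS hT := ⟨hS.1.mul M hT.1, hS.2.mul M hT.2⟩
  smul_mem' c _ hT := ⟨hT.1.smul M c, hT.2.smul M c⟩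
  star_mem' hT := ⟨hT.1.star M, hT.2.star M⟩

theorem isClosed_sqAlgebra : IsClosed (M.sqAlgebra K : Set (H →L[ℂ] H)) := by
  refine isClosed_of_closure_subset fun T hT => ⟨fun f => ⟨?_, ?_⟩, fun ε hε => ?_⟩
  · have hc : IsClosed {S : H →L[ℂ] H | IsCompactOperator (M.rep f * S)} :=
      isClosed_setOfPred_isCompactOperator.preimage (f := fun S : H →L[ℂ] H => M.rep f * S)
        (by fun_prop)
    exact closure_minimal (fun S hS => (hS.1 f).1) hc hT
  · have hc : IsClosed {S : H →L[ℂ] H | IsCompactOperator (S * M.rep f)} :=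
      isClosed_setOfPred_isCompactOperator.preimage (f := fun S : H →L[ℂ] H => S * M.rep f)
        (by fun_prop)
    exact closure_minimal (fun S hS => (hS.1 f).2) hc hT
  · obtain ⟨S, hS, hd⟩ := Metric.mem_closure_iff.1 hT (ε / 4) (by positivity)
    obtain ⟨δ, hδ, R, hR, h⟩ := hS.2 (ε / 2) (by positivity)
    refine ⟨δ, hδ, R, hR, fun g hg hg1 hv => ?_⟩
    have h1 := h g hg hg1 hv
    set Λ := M.Lambda g hg ⟨1, hg1⟩
    have hΛ : ‖Λ‖ ≤ 1 := M.norm_Lambda_le hg ⟨1, hg1⟩ zero_le_one hg1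
    have e : opTensor T (1 : K →L[ℂ] K) * Λ - Λ * opTensor T 1
        = (opTensor S 1 * Λ - Λ * opTensor S 1)
          + (opTensor (T - S) 1 * Λ - Λ * opTensor (T - S) 1) := by
      rw [opTensor_sub_left]; noncomm_ring
    rw [e]
    have h2 : ‖opTensor (T - S) (1 : K →L[ℂ] K)‖ ≤ ε / 4 := by
      refine (norm_opTensor_one_le _).trans ?_
      rw [← dist_eq_norm]; exact hd.le
    have h3 := norm_mul_le (opTensor (T - S) (1 : K →L[ℂ] K)) Λ
    have h4 := norm_mul_le Λ (opTensor (T - S) (1 : K →L[ℂ] K))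
    have h5 := norm_sub_le (opTensor (T - S) (1 : K →L[ℂ] K) * Λ) (Λ * opTensor (T - S) 1)
    have h6 := norm_add_le (opTensor S (1 : K →L[ℂ] K) * Λ - Λ * opTensor S 1)
      (opTensor (T - S) 1 * Λ - Λ * opTensor (T - S) 1)
    nlinarith [norm_nonneg Λ, norm_nonneg (opTensor (T - S) (1 : K →L[ℂ] K))]

instance : NonUnitalCStarAlgebra (M.sqAlgebra K) :=
  NonUnitalStarSubalgebra.nonUnitalCStarAlgebra _ (h_closed := M.isClosed_sqAlgebra)

end AmpleModule

/-! ### Covering isometries and the homomorphisms `Ad_V` -/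

section Covering

variable {X : Type*} [MetricSpace X] [ProperSpace X] [MeasurableSpace X] [BorelSpace X]
  {Y : Type*} [MetricSpace Y] [ProperSpace Y] [MeasurableSpace Y] [BorelSpace Y]
  {HX : Type*} [NormedAddCommGroup HX] [InnerProductSpace ℂ HX] [CompleteSpace HX]
  {HY : Type*} [NormedAddCommGroup HY] [InnerProductSpace ℂ HY] [CompleteSpace HY]

/-- The support of an operator between modules: all `(y, x)` such that `χ_W T χ_U ≠ 0` for all open
neighbourhoods `U` of `x` and `W` of `y`. -/
def opSupport (M : AmpleModule X HX) (N : AmpleModule Y HY) (T : HX →L[ℂ] HY) : Set (Y × X) :=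
  {p | ∀ (U : Set X) (W : Set Y), IsOpen U → p.2 ∈ U → IsOpen W → p.1 ∈ W →
    (N.χ W).comp (T.comp (M.χ U)) ≠ 0}

/-- The isometry `V` covers the map `f`: its support lies within bounded distance of the graph
of `f`. -/
def IsCoveringIsometry (M : AmpleModule X HX) (N : AmpleModule Y HY) (f : X → Y)
    (V : HX →ₗᵢ[ℂ] HY) : Prop :=
  ∃ R : ℝ, ∀ p ∈ opSupport M N V.toContinuousLinearMap, dist (f p.2) p.1 < R

/-- `Ad_V(T) = V T V*`, on bounded operators. -/
def adOp (V : HX →ₗᵢ[ℂ] HY) : (HX →L[ℂ] HX) →⋆ₙₐ[ℂ] (HY →L[ℂ] HY) where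
  toFun T := V.toContinuousLinearMap.comp
    (T.comp (ContinuousLinearMap.adjoint V.toContinuousLinearMap))
  map_smul' c T := by ext; simp
  map_zero' := by ext; simp
  map_add' S T := by ext; simp
  map_mul' S T := by
    ext ξ
    have h (η : HX) : ContinuousLinearMap.adjoint V.toContinuousLinearMap (V η) = η := by
      refine ext_inner_left ℂ fun v => ?_
      rw [ContinuousLinearMap.adjoint_inner_right]
      exact V.inner_map_map v η
    simp [mul_apply_eq_comp, h]
  map_star' T := by
    simp [ContinuousLinearMap.star_eq_adjoint, ContinuousLinearMap.adjoint_comp,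
      ContinuousLinearMap.comp_assoc]

/-- `Ad_V` maps `C*_sq(HX)` into `C*_sq(HY)`. -/
def AdMaps (K : Type*) [NormedAddCommGroup K] [InnerProductSpace ℂ K] [CompleteSpace K]
    (M : AmpleModule X HX) (N : AmpleModule Y HY) (V : HX →ₗᵢ[ℂ] HY) : Prop :=
  ∀ T ∈ M.sqAlgebra K, adOp V T ∈ N.sqAlgebra K

/-- The `*`-homomorphism `Ad_V : C*_sq(HX) → C*_sq(HY)`, `T ↦ V T V*`. -/
def adSq {K : Type*} [NormedAddCommGroup K] [InnerProductSpace ℂ K] [CompleteSpace K]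
    {M : AmpleModule X HX} {N : AmpleModule Y HY} {V : HX →ₗᵢ[ℂ] HY} (h : AdMaps K M N V) :
    M.sqAlgebra K →⋆ₙₐ[ℂ] N.sqAlgebra K where
  toFun T := ⟨adOp V T, h T T.2⟩
  map_smul' c T := Subtype.ext (map_smul (adOp V) c (T : HX →L[ℂ] HX))
  map_zero' := Subtype.ext (map_zero (adOp V))
  map_add' S T := Subtype.ext (map_add (adOp V) (S : HX →L[ℂ] HX) T)
  map_mul' S T := Subtype.ext (map_mul (adOp V) (S : HX →L[ℂ] HX) T)
  map_star' T := Subtype.ext (map_star (adOp V) (T : HX →L[ℂ] HX))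

end Covering


/-! ### Operator K-theory -/

namespace CStarK

/-! #### The group `K₀` -/

section K0

/-- A projection in a matrix algebra `M_n(R)`, for some `n`. -/
structure ProjMat (R : Type*) [Ring R] [StarRing R] where
  size : ℕ
  mat : Matrix (Fin size) (Fin size) R
  isProj : IsStarProjection mat

/-- Murray-von Neumann equivalence of two square matrices, possibly of different sizes. -/
def MvN {R : Type*} [Ring R] [StarRing R] {m n : Type*} [Fintype m] [Fintype n]
    (p : Matrix m m R) (q : Matrix n n R) : Prop :=
  ∃ v : Matrix n m R, vᴴ * v = p ∧ v * vᴴ = q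

section MvN

variable {R : Type*} [Ring R] [StarRing R] {l m n k : Type*}
  [Fintype l] [Fintype m] [Fintype n] [Fintype k]

theorem MvN.refl {p : Matrix m m R} (hp : IsStarProjection p) : MvN p p :=
  ⟨p, by rw [← Matrix.star_eq_conjTranspose, hp.isSelfAdjoint.star_eq, hp.isIdempotentElem.eq],
    by rw [← Matrix.star_eq_conjTranspose, hp.isSelfAdjoint.star_eq, hp.isIdempotentElem.eq]⟩

theorem MvN.symm {p : Matrix m m R} {q : Matrix n n R} (h : MvN p q) : MvN q p := by
  obtain ⟨v, h1, h2⟩ := h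
  exact ⟨vᴴ, by simpa using h2, by simpa using h1⟩

theorem MvN.trans {p : Matrix l l R} {q : Matrix m m R} {r : Matrix n n R}
    (hp : IsStarProjection p) (hr : IsStarProjection r) (h : MvN p q) (h' : MvN q r) :
    MvN p r := by
  obtain ⟨v, h1, h2⟩ := h
  obtain ⟨w, h3, h4⟩ := h'
  refine ⟨w * v, ?_, ?_⟩
  · rw [Matrix.conjTranspose_mul, Matrix.mul_assoc, ← Matrix.mul_assoc wᴴ, h3, ← h2,
      Matrix.mul_assoc, ← Matrix.mul_assoc vᴴ, h1]
    exact hp.isIdempotentElem.eq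
  · rw [Matrix.conjTranspose_mul, Matrix.mul_assoc, ← Matrix.mul_assoc v, h2, ← h3,
      Matrix.mul_assoc, ← Matrix.mul_assoc w, h4]
    exact hr.isIdempotentElem.eq

/-- The block-diagonal sum of two square matrices. -/
def dsum {R : Type*} [Zero R] {m n : Type*} (p : Matrix m m R) (q : Matrix n n R) :
    Matrix (m ⊕ n) (m ⊕ n) R := Matrix.fromBlocks p 0 0 q

theorem MvN.dsum {p : Matrix l l R} {q : Matrix m m R} {p' : Matrix n n R} {q' : Matrix k k R}
    (h : MvN p q) (h' : MvN p' q') : MvN (CStarK.dsum p p') (CStarK.dsum q q') := by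
  obtain ⟨v, h1, h2⟩ := h
  obtain ⟨w, h3, h4⟩ := h'
  refine ⟨Matrix.fromBlocks v 0 0 w, ?_, ?_⟩ <;>
    simp [CStarK.dsum, Matrix.fromBlocks_conjTranspose, Matrix.fromBlocks_multiply, h1, h2, h3, h4]

theorem isStarProjection_dsum {p : Matrix l l R} {q : Matrix m m R} (hp : IsStarProjection p)
    (hq : IsStarProjection q) : IsStarProjection (dsum p q) := by
  have h1 := hp.isSelfAdjoint.star_eq
  have h2 := hq.isSelfAdjoint.star_eq
  rw [Matrix.star_eq_conjTranspose] at h1 h2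
  constructor
  · simp [IsIdempotentElem, dsum, Matrix.fromBlocks_multiply, hp.isIdempotentElem.eq,
      hq.isIdempotentElem.eq]
  · simp [IsSelfAdjoint, Matrix.star_eq_conjTranspose, dsum, Matrix.fromBlocks_conjTranspose,
      h1, h2]

theorem isStarProjection_reindex (e : l ≃ m) {p : Matrix l l R} (hp : IsStarProjection p) :
    IsStarProjection (p.reindex e e) := by
  have h1 := hp.isSelfAdjoint.star_eq
  rw [Matrix.star_eq_conjTranspose] at h1
  constructor
  · simp [IsIdempotentElem, Matrix.submatrix_mul_equiv, hp.isIdempotentElem.eq]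
  · simp [IsSelfAdjoint, Matrix.star_eq_conjTranspose, Matrix.conjTranspose_submatrix, h1]

theorem mvN_reindex (e : l ≃ m) {p : Matrix l l R} (hp : IsStarProjection p) :
    MvN p (p.reindex e e) := by
  have h1 := hp.isSelfAdjoint.star_eq
  rw [Matrix.star_eq_conjTranspose] at h1
  refine ⟨p.submatrix e.symm id, ?_, ?_⟩
  · rw [Matrix.conjTranspose_submatrix, h1, Matrix.submatrix_mul_equiv, hp.isIdempotentElem.eq,
      Matrix.submatrix_id_id]
  · rw [Matrix.conjTranspose_submatrix, h1]
    have := Matrix.submatrix_mul_equiv p p e.symm (Equiv.refl l) e.symm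
    simpa [hp.isIdempotentElem.eq] using this

end MvN

variable (R S T : Type*) [Ring R] [StarRing R] [Ring S] [StarRing S] [Ring T] [StarRing T]

instance projSetoid : Setoid (ProjMat R) where
  r p q := MvN p.mat q.mat
  iseqv := ⟨fun p => .refl p.isProj, .symm, fun {p _ r} h h' => h.trans p.isProj r.isProj h'⟩

/-- The set of Murray-von Neumann equivalence classes of projections in matrices over `R`. -/
def V : Type _ := Quotient (projSetoid R)

variable {R S T}

/-- The block-diagonal sum `p ⊕ q`, as a matrix of size `m + n`. -/
def ProjMat.add (p q : ProjMat R) : ProjMat R where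
  size := p.size + q.size
  mat := (dsum p.mat q.mat).reindex finSumFinEquiv finSumFinEquiv
  isProj := isStarProjection_reindex _ (isStarProjection_dsum p.isProj q.isProj)

theorem ProjMat.add_mvN (p q : ProjMat R) : MvN (dsum p.mat q.mat) (p.add q).mat :=
  mvN_reindex _ (isStarProjection_dsum p.isProj q.isProj)

/-- The zero projection, of size `0`. -/
def ProjMat.zero : ProjMat R where
  size := 0
  mat := 0
  isProj := .zero _

theorem mk_eq_of_mvN {p q : ProjMat R} (h : MvN p.mat q.mat) : (⟦p⟧ : V R) = ⟦q⟧ :=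
  Quotient.sound h

/-- Addition in `V R` is the block-diagonal sum. -/
instance : Add (V R) where
  add := Quotient.map₂ ProjMat.add fun p p' h q q' h' =>
    (((p.add_mvN q).symm.trans (p.add q).isProj
      (isStarProjection_dsum p'.isProj q'.isProj) (MvN.dsum h h')).trans
        (p.add q).isProj (p'.add q').isProj (p'.add_mvN q'))

instance : Zero (V R) where
  zero := ⟦ProjMat.zero⟧

instance : AddCommMonoid (V R) where
  nsmul := nsmulRec
  add_assoc a b c := by
    induction a using Quotient.inductionOn with | _ p
    induction b using Quotient.inductionOn with | _ q
    induction c using Quotient.inductionOn with | _ r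
    refine mk_eq_of_mvN ?_
    have h1 : MvN ((p.add q).add r).mat (dsum (dsum p.mat q.mat) r.mat) :=
      ((p.add q).add_mvN r).symm.trans ((p.add q).add r).isProj
        (isStarProjection_dsum (isStarProjection_dsum p.isProj q.isProj) r.isProj)
        (MvN.dsum (p.add_mvN q).symm (.refl r.isProj))
    have h2 : MvN (dsum p.mat (dsum q.mat r.mat)) (p.add (q.add r)).mat :=
      (MvN.dsum (.refl p.isProj) (q.add_mvN r)).trans
        (isStarProjection_dsum p.isProj (isStarProjection_dsum q.isProj r.isProj))
        (p.add (q.add r)).isProj (p.add_mvN (q.add r))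
    have h3 : MvN (dsum (dsum p.mat q.mat) r.mat) (dsum p.mat (dsum q.mat r.mat)) := by
      have := mvN_reindex (Equiv.sumAssoc _ _ _)
        (isStarProjection_dsum (isStarProjection_dsum p.isProj q.isProj) r.isProj)
      convert this using 1
      ext i j
      rcases i with i | i | i <;> rcases j with j | j | j <;> simp [dsum]
    exact h1.trans ((p.add q).add r).isProj (p.add (q.add r)).isProj
      (h3.trans (isStarProjection_dsum (isStarProjection_dsum p.isProj q.isProj) r.isProj)
        (p.add (q.add r)).isProj h2)
  zero_add a := by
    induction a using Quotient.inductionOn with | _ p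
    refine mk_eq_of_mvN ?_
    have h3 : MvN p.mat (dsum (ProjMat.zero (R := R)).mat p.mat) := by
      have := mvN_reindex (Equiv.emptySum (Fin 0) (Fin p.size)).symm p.isProj
      convert! this using 1
      refine Matrix.ext fun i j => ?_
      rcases i with i | i
      · exact i.elim0
      rcases j with j | j
      · exact j.elim0
      simp [dsum]
      rfl
    exact (h3.trans p.isProj (ProjMat.zero.add p).isProj (ProjMat.zero.add_mvN p)).symm
  add_zero a := by
    induction a using Quotient.inductionOn with | _ p
    refine mk_eq_of_mvN ?_
    have h3 : MvN p.mat (dsum p.mat (ProjMat.zero (R := R)).mat) := by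
      have := mvN_reindex (Equiv.sumEmpty (Fin p.size) (Fin 0)).symm p.isProj
      convert! this using 1
      refine Matrix.ext fun i j => ?_
      rcases i with i | i
      swap
      · exact i.elim0
      rcases j with j | j
      swap
      · exact j.elim0
      simp [dsum]
      rfl
    exact (h3.trans p.isProj (p.add ProjMat.zero).isProj (p.add_mvN ProjMat.zero)).symm
  add_comm a b := by
    induction a using Quotient.inductionOn with | _ p
    induction b using Quotient.inductionOn with | _ q
    refine mk_eq_of_mvN ?_
    have h3 : MvN (dsum p.mat q.mat) (dsum q.mat p.mat) := by
      have := mvN_reindex (Equiv.sumComm _ _) (isStarProjection_dsum p.isProj q.isProj)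
      convert this using 1
      ext i j
      rcases i with i | i <;> rcases j with j | j <;> simp [dsum]
    exact (p.add_mvN q).symm.trans (p.add q).isProj (q.add p).isProj
      (h3.trans (isStarProjection_dsum p.isProj q.isProj) (q.add p).isProj (q.add_mvN p))

variable [Algebra ℂ R] [Algebra ℂ S] [Algebra ℂ T]

/-- The image of a projection under a unital `*`-homomorphism, applied entrywise. -/
def ProjMat.map (φ : R →⋆ₐ[ℂ] S) (p : ProjMat R) : ProjMat S where
  size := p.size
  mat := p.mat.map φ
  isProj := by
    have h1 := p.isProj.isSelfAdjoint.star_eq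
    rw [Matrix.star_eq_conjTranspose] at h1
    constructor
    · rw [IsIdempotentElem, ← Matrix.map_mul, p.isProj.isIdempotentElem.eq]
    · rw [IsSelfAdjoint, Matrix.star_eq_conjTranspose, ← Matrix.conjTranspose_map _ (map_star φ),
        h1]

theorem MvN.map (φ : R →⋆ₐ[ℂ] S) {m n : Type*} [Fintype m] [Fintype n]
    {p : Matrix m m R} {q : Matrix n n R} (h : MvN p q) : MvN (p.map φ) (q.map φ) := by
  obtain ⟨v, h1, h2⟩ := h
  refine ⟨v.map φ, ?_, ?_⟩
  · rw [← Matrix.conjTranspose_map _ (map_star φ), ← Matrix.map_mul, h1]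
  · rw [← Matrix.conjTranspose_map _ (map_star φ), ← Matrix.map_mul, h2]

/-- The monoid homomorphism `V R → V S` induced by a unital `*`-homomorphism `R → S`. -/
def V.map (φ : R →⋆ₐ[ℂ] S) : V R →+ V S where
  toFun := Quotient.map (ProjMat.map φ) fun _ _ h => MvN.map φ h
  map_zero' := mk_eq_of_mvN (by
    have : (ProjMat.map φ ProjMat.zero).mat = ProjMat.zero.mat :=
      Matrix.ext fun i _ => i.elim0
    rw [this]
    exact .refl ProjMat.zero.isProj)
  map_add' a b := by
    induction a using Quotient.inductionOn with | _ p
    induction b using Quotient.inductionOn with | _ q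
    refine mk_eq_of_mvN ?_
    have : (ProjMat.map φ (p.add q)).mat = ((p.map φ).add (q.map φ)).mat := by
      change (((dsum p.mat q.mat).reindex finSumFinEquiv finSumFinEquiv).map φ)
        = (dsum (p.mat.map φ) (q.mat.map φ)).reindex finSumFinEquiv finSumFinEquiv
      simp [dsum, ← Matrix.submatrix_map, Matrix.fromBlocks_map]
    rw [this]
    exact .refl ((p.map φ).add (q.map φ)).isProj

variable (R) in
/-- The Grothendieck group of `V R`; for unital `C*`-algebras this is `K₀`. -/
abbrev K00 : Type _ := Algebra.GrothendieckAddGroup (V R)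

/-- Functoriality of `K00`. -/
def K00.map (φ : R →⋆ₐ[ℂ] S) : K00 R →+ K00 S :=
  Algebra.GrothendieckAddGroup.lift (Algebra.GrothendieckAddGroup.of.comp (V.map φ))

theorem V.map_comp (ψ : S →⋆ₐ[ℂ] T) (φ : R →⋆ₐ[ℂ] S) :
    V.map (ψ.comp φ) = (V.map ψ).comp (V.map φ) := by
  ext a
  induction a using Quotient.inductionOn with | _ p
  rfl

theorem K00.map_of (φ : R →⋆ₐ[ℂ] S) (a : V R) :
    K00.map φ (Algebra.GrothendieckAddGroup.of a) = Algebra.GrothendieckAddGroup.of (V.map φ a) := by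
  have := Algebra.GrothendieckAddGroup.lift.symm_apply_apply
    (Algebra.GrothendieckAddGroup.of.comp (V.map φ))
  exact DFunLike.congr_fun this a

theorem K00.map_comp (ψ : S →⋆ₐ[ℂ] T) (φ : R →⋆ₐ[ℂ] S) :
    K00.map (ψ.comp φ) = (K00.map ψ).comp (K00.map φ) := by
  refine Algebra.GrothendieckAddGroup.lift.symm.injective ?_
  ext a
  change K00.map (ψ.comp φ) (Algebra.GrothendieckAddGroup.of a)
    = K00.map ψ (K00.map φ (Algebra.GrothendieckAddGroup.of a))
  rw [K00.map_of, K00.map_of, K00.map_of, V.map_comp]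
  rfl

end K0

variable (A B C : Type*) [NonUnitalCStarAlgebra A] [NonUnitalCStarAlgebra B]

/-- The canonical unital `*`-homomorphism `A⁺ → ℂ` from the unitization. -/
def scalarPart : Unitization ℂ A →⋆ₐ[ℂ] ℂ where
  __ := Unitization.fstHom ℂ A
  map_star' x := Unitization.fst_star x

/-- `K₀(A)`, the kernel of `K₀(A⁺) → K₀(ℂ)`. -/
def K0 : Type _ := (K00.map (scalarPart A)).ker

instance : AddCommGroup (K0 A) := inferInstanceAs (AddCommGroup (K00.map (scalarPart A)).ker)

variable {A B}

theorem scalarPart_comp_starMap (φ : A →⋆ₙₐ[ℂ] B) :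
    (scalarPart B).comp (Unitization.starMap φ) = scalarPart A := by
  ext x
  change (Unitization.starMap φ (x : Unitization ℂ A)).fst = (x : Unitization ℂ A).fst
  simp

/-- The homomorphism `K₀(A) → K₀(B)` induced by a `*`-homomorphism `A → B`. -/
def K0.map (φ : A →⋆ₙₐ[ℂ] B) : K0 A →+ K0 B :=
  ((K00.map (Unitization.starMap φ)).comp (K00.map (scalarPart A)).ker.subtype).codRestrict
    (K00.map (scalarPart B)).ker (fun x => by
      rw [AddMonoidHom.mem_ker, AddMonoidHom.comp_apply, ← AddMonoidHom.comp_apply,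
        ← K00.map_comp, scalarPart_comp_starMap]
      exact x.2)

/-! #### The group `K₁` -/

section K1

variable (R S : Type*) [CStarAlgebra R] [CStarAlgebra S]

/-- The unitary group `U_n(R)` of the matrix algebra `M_n(R)`; it carries the (entrywise, hence
norm) topology of `M_n(R)`. -/
abbrev U (n : ℕ) : Type _ := unitary (Matrix (Fin n) (Fin n) R)

variable {R S}

/-- The `n × m` matrix of the inclusion of the first `m` coordinates into `n` coordinates. -/
def incl (R : Type*) [Ring R] (m n : ℕ) : Matrix (Fin n) (Fin m) R :=
  Matrix.of fun i j => if i.val = j.val then 1 else 0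

theorem incl_conjTranspose_mul {m n : ℕ} (h : m ≤ n) : (incl R m n)ᴴ * incl R m n = 1 := by
  ext i j
  rw [Matrix.mul_apply, Finset.sum_eq_single (Fin.castLE h i)]
  · simp [incl, Matrix.one_apply, Fin.ext_iff]
  · intro b _ hb
    have : ¬ (b.val = i.val) := fun hh => hb (Fin.ext hh)
    simp [incl, this]
  · simp

theorem incl_mul {l m n : ℕ} (h : l ≤ m) : incl R m n * incl R l m = incl R l n := by
  ext i j
  rw [Matrix.mul_apply, Finset.sum_eq_single (Fin.castLE h j)]
  · simp [incl]
  · intro b _ hb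
    have : ¬ (b.val = j.val) := fun hh => hb (Fin.ext hh)
    simp [incl, this]
  · simp

/-- The stabilisation map `u ↦ diag(u, 1)` from `m × m` to `n × n` matrices, for `m ≤ n`,
written as `u ↦ 1 + ι (u - 1) ι*` where `ι` is the inclusion of the first `m` coordinates. -/
def stabMat {m : ℕ} (n : ℕ) (u : Matrix (Fin m) (Fin m) R) : Matrix (Fin n) (Fin n) R :=
  1 + incl R m n * (u - 1) * (incl R m n)ᴴ

theorem stabMat_one {m n : ℕ} : stabMat n (1 : Matrix (Fin m) (Fin m) R) = 1 := by
  simp [stabMat]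

theorem stabMat_mul {m n : ℕ} (h : m ≤ n) (u v : Matrix (Fin m) (Fin m) R) :
    stabMat n (u * v) = stabMat n u * stabMat n v := by
  have key : (incl R m n * (u - 1) * (incl R m n)ᴴ) * (incl R m n * (v - 1) * (incl R m n)ᴴ)
      = incl R m n * ((u - 1) * (v - 1)) * (incl R m n)ᴴ := by
    calc _ = incl R m n * (u - 1) * ((incl R m n)ᴴ * incl R m n) * (v - 1) * (incl R m n)ᴴ := by
          simp only [Matrix.mul_assoc]
      _ = _ := by rw [incl_conjTranspose_mul h]; simp only [Matrix.mul_assoc, Matrix.one_mul]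
  have huv : u * v - 1 = (u - 1) + (v - 1) + (u - 1) * (v - 1) := by noncomm_ring
  rw [stabMat, stabMat, stabMat, add_mul, mul_add, mul_add, key, huv, Matrix.mul_add,
    Matrix.mul_add, Matrix.add_mul, Matrix.add_mul]
  simp only [one_mul, mul_one]
  abel

theorem stabMat_star {m n : ℕ} (u : Matrix (Fin m) (Fin m) R) :
    stabMat n (star u) = star (stabMat n u) := by
  simp [stabMat, Matrix.star_eq_conjTranspose, Matrix.conjTranspose_mul, Matrix.mul_assoc]

theorem stabMat_stabMat {l m n : ℕ} (h : l ≤ m) (u : Matrix (Fin l) (Fin l) R) :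
    stabMat n (stabMat m u) = stabMat n u := by
  rw [stabMat, stabMat, stabMat, add_sub_cancel_left, ← incl_mul h (n := n)]
  simp only [Matrix.conjTranspose_mul, Matrix.mul_assoc]

theorem stabMat_self {m : ℕ} (u : Matrix (Fin m) (Fin m) R) : stabMat m u = u := by
  have : incl R m m = 1 := by ext i j; simp [incl, Matrix.one_apply, Fin.ext_iff]
  simp [stabMat, this]

/-- The group homomorphism `U_m(R) → U_n(R)`, `u ↦ diag(u, 1)`. -/
def stab (m n : ℕ) (h : m ≤ n) : U R m →* U R n where
  toFun u := ⟨stabMat n (u : Matrix (Fin m) (Fin m) R), by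
    rw [Unitary.mem_iff, ← stabMat_star, ← stabMat_mul h, ← stabMat_mul h,
      (Unitary.mem_iff.1 u.2).1, (Unitary.mem_iff.1 u.2).2, stabMat_one]
    exact ⟨rfl, rfl⟩⟩
  map_one' := Subtype.ext stabMat_one
  map_mul' u v := Subtype.ext (stabMat_mul h _ _)

theorem continuous_stab (m n : ℕ) (h : m ≤ n) : Continuous (stab (R := R) m n h) := by
  refine Continuous.subtype_mk ?_ _
  change Continuous fun u : U R m => 1 + incl R m n * ((u : Matrix (Fin m) (Fin m) R) - 1) *
    (incl R m n)ᴴ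
  fun_prop

instance : DirectedSystem (U R) (fun m n h => stab (R := R) m n h) where
  map_self _ _ := Subtype.ext (stabMat_self _)
  map_map _ _ _ h _ _ := Subtype.ext (stabMat_stabMat h _)

variable (R) in
/-- `U_∞(R)`, the union of the groups `U_n(R)` along the maps `u ↦ diag(u, 1)`. -/
abbrev UInf : Type _ := DirectLimit (U R) (stab (R := R))

variable (R) in
/-- The subgroup of all elements of `U_∞(R)` that are connected to `1` by a norm-continuous path in
some `U_n(R)`. -/
def UInf0 : Subgroup (UInf R) where
  carrier := {x | ∃ (n : ℕ) (u : U R n), x = ⟦⟨n, u⟩⟧ ∧ Joined 1 u}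
  one_mem' := ⟨0, 1, DirectLimit.one_def 0, .refl _⟩
  mul_mem' := by
    rintro _ _ ⟨m, u, rfl, hu⟩ ⟨n, v, rfl, hv⟩
    refine ⟨max m n, stab m _ (le_max_left m n) u * stab n _ (le_max_right m n) v, ?_, ?_⟩
    · rw [← DirectLimit.mul_def, DirectLimit.mk_apply, DirectLimit.mk_apply]
    · have h1 := hu.map (continuous_stab m _ (le_max_left m n))
      have h2 := hv.map (continuous_stab n _ (le_max_right m n))
      rw [map_one] at h1 h2
      simpa using h1.mul h2
  inv_mem' := by
    rintro _ ⟨m, u, rfl, hu⟩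
    refine ⟨m, u⁻¹, ?_, ?_⟩
    · exact DirectLimit.inv_def m u
    · have := hu.map (f := fun u : U R m => star u) (by fun_prop)
      rwa [star_one] at this

instance : (UInf0 R).Normal where
  conj_mem := by
    rintro _ ⟨m, u, rfl, hu⟩ g
    obtain ⟨n, v, rfl⟩ := DirectLimit.exists_eq_mk _ g
    refine ⟨max m n, stab n _ (le_max_right m n) v * stab m _ (le_max_left m n) u
      * (stab n _ (le_max_right m n) v)⁻¹, ?_, ?_⟩
    · rw [← DirectLimit.mul_def, ← DirectLimit.mul_def, ← DirectLimit.inv_def,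
        DirectLimit.mk_apply, DirectLimit.mk_apply]
    · have h1 := hu.map (continuous_stab m _ (le_max_left m n))
      rw [map_one] at h1
      have := ((Joined.refl (stab n _ (le_max_right m n) v)).mul h1).mul
        (Joined.refl (stab n _ (le_max_right m n) v)⁻¹)
      simpa using this

variable (R) in
/-- `U_∞(R) / U_∞(R)₀`. -/
abbrev K11 : Type _ := UInf R ⧸ UInf0 R

/-- Entrywise application of a unital `*`-homomorphism to a unitary matrix. -/
def U.map (φ : R →⋆ₐ[ℂ] S) (n : ℕ) : U R n →* U S n where
  toFun u := ⟨(u : Matrix (Fin n) (Fin n) R).map φ, by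
    obtain ⟨h1, h2⟩ := Unitary.mem_iff.1 u.2
    rw [Matrix.star_eq_conjTranspose] at h1 h2
    rw [Unitary.mem_iff, Matrix.star_eq_conjTranspose, ← Matrix.conjTranspose_map _ (map_star φ),
      ← Matrix.map_mul, ← Matrix.map_mul, h1, h2]
    simp⟩
  map_one' := Subtype.ext (by simp)
  map_mul' u v := Subtype.ext (by simp)

theorem U.continuous_map (φ : R →⋆ₐ[ℂ] S) (n : ℕ) : Continuous (U.map φ n) := by
  refine Continuous.subtype_mk ?_ _
  have : Continuous φ := AddMonoidHomClass.continuous_of_bound φ 1 fun x => by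
    rw [one_mul]; exact NonUnitalStarAlgHom.norm_apply_le φ x
  exact Continuous.matrix_map continuous_subtype_val this

theorem U.map_stab (φ : R →⋆ₐ[ℂ] S) (m n : ℕ) (h : m ≤ n) (u : U R m) :
    stab m n h (U.map φ m u) = U.map φ n (stab m n h u) := by
  refine Subtype.ext ?_
  have hi : (incl R m n).map φ = incl S m n := by
    ext i j; simp only [incl, Matrix.map_apply, Matrix.of_apply]; split_ifs <;> simp
  change stabMat n ((u : Matrix (Fin m) (Fin m) R).map φ)
    = (stabMat n (u : Matrix (Fin m) (Fin m) R)).map φ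
  simp only [stabMat]
  rw [Matrix.map_add _ (map_add φ), Matrix.map_mul, Matrix.map_mul, Matrix.map_sub _ (map_sub φ),
    Matrix.conjTranspose_map _ (map_star φ), hi]
  simp

/-- The homomorphism `U_∞(R) → U_∞(S)` induced by a unital `*`-homomorphism `R → S`. -/
def UInf.map (φ : R →⋆ₐ[ℂ] S) : UInf R →* UInf S where
  toFun := DirectLimit.map _ _ (fun n u => U.map φ n u) (U.map_stab φ)
  map_one' := by
    rw [DirectLimit.one_def 0, DirectLimit.map_def, DirectLimit.one_def 0, map_one]
  map_mul' := by
    refine DirectLimit.induction₂ _ fun n u v => ?_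
    simp only [DirectLimit.mul_def, DirectLimit.map_def, map_mul]

/-- Functoriality of `K11`. -/
def K11.map (φ : R →⋆ₐ[ℂ] S) : K11 R →* K11 S :=
  QuotientGroup.map _ _ (UInf.map φ) (by
    rintro _ ⟨n, u, rfl, hu⟩
    refine ⟨n, U.map φ n u, rfl, ?_⟩
    simpa using hu.map (U.continuous_map φ n))

end K1

variable (A) in
/-- `K₁(A) = U_∞(A⁺) / U_∞(A⁺)₀`, written multiplicatively. -/
def K1 : Type _ := K11 (Unitization ℂ A)

instance : Group (K1 A) := inferInstanceAs (Group (K11 (Unitization ℂ A)))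

/-- The homomorphism `K₁(A) → K₁(B)` induced by a `*`-homomorphism `A → B`. -/
def K1.map (φ : A →⋆ₙₐ[ℂ] B) : K1 A →* K1 B := K11.map (Unitization.starMap φ)

end CStarK

/-! ### The maps on K-theory induced by `Ad_V` -/

section InducedMaps

variable {X : Type*} [MetricSpace X] [ProperSpace X] [MeasurableSpace X] [BorelSpace X]
  {Y : Type*} [MetricSpace Y] [ProperSpace Y] [MeasurableSpace Y] [BorelSpace Y]
  {HX : Type*} [NormedAddCommGroup HX] [InnerProductSpace ℂ HX] [CompleteSpace HX]
  {HY : Type*} [NormedAddCommGroup HY] [InnerProductSpace ℂ HY] [CompleteSpace HY]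
  {K : Type*} [NormedAddCommGroup K] [InnerProductSpace ℂ K] [CompleteSpace K]
  {M : AmpleModule X HX} {N : AmpleModule Y HY} {V : HX →ₗᵢ[ℂ] HY}

variable (K) in
/-- `K₀(C*_sq(HX))`. -/
def K0sq (M : AmpleModule X HX) : Type _ := CStarK.K0 (M.sqAlgebra K)

variable (K) in
/-- `K₁(C*_sq(HX))`. -/
def K1sq (M : AmpleModule X HX) : Type _ := CStarK.K1 (M.sqAlgebra K)

instance : AddCommGroup (K0sq K M) := inferInstanceAs (AddCommGroup (CStarK.K0 (M.sqAlgebra K)))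

instance : Group (K1sq K M) := inferInstanceAs (Group (CStarK.K1 (M.sqAlgebra K)))

/-- `(Ad_V)_* : K₀(C*_sq(HX)) → K₀(C*_sq(HY))`. -/
def adK0 (h : AdMaps K M N V) : K0sq K M →+ K0sq K N := CStarK.K0.map (adSq h)

/-- `(Ad_V)_* : K₁(C*_sq(HX)) → K₁(C*_sq(HY))`. -/
def adK1 (h : AdMaps K M N V) : K1sq K M →* K1sq K N := CStarK.K1.map (adSq h)

end InducedMaps

end

/-!
All three assertions rest on one fact: if two isometries `V` and `V'` cover the same coarse map `f`,
then `V T V'*` belongs to the strongly quasi-local algebra of `Y` whenever `T` belongs to that of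
`X` (`IsCoveringIsometry.mem_sqAlgebra`).

Local compactness is a support argument. The blocks `χ_F V χ_E` away from the support of `V` vanish
(`χ_comp_comp_χ_eq_zero`), so that, `f` being proper, `V` relates compact sets to compact sets.

For strong quasi-locality, `f` is replaced by a nearby countably-valued Borel map `γ ∘ p` with
values in the net of `Y`, and `V ⊗ 1` is shown to almost intertwine `Λ(g)` with `Λ(g ∘ γ ∘ p)` if
`g` has small variation (`exists_discretization`). Up to a small error `g` is constant on the cells
of a Borel partition of `Y` indexed by the net, and then the difference
`Λ(g) (V ⊗ 1) - (V ⊗ 1) Λ(g ∘ γ ∘ p)` is a block matrix, with respect to the partitions of `X` and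
`Y` indexed by the net, all of whose blocks are small; by bounded geometry of `Y` the number of
non-zero blocks in each row and column is bounded, so Schur's test (`norm_le_of_band`) bounds the
norm. A commutator of `V T V'* ⊗ 1` with `Λ(g)` is thereby reduced to one of `T ⊗ 1` with
`Λ(g ∘ γ ∘ p)`.

For the independence on K-theory, rotate the isometry `(V, 0) : HX → HY ⊕ HY` to `(0, V')` through
the isometries `(cos θ V, sin θ V')`. Conjugation by these is a path of `*`-homomorphisms into
`2 × 2` matrices over the algebra of `Y`, from `diag(Ad_V, 0)` to `diag(0, Ad_V')`
(`cornerHomotopic_adSq`); all matrix entries are in the algebra by the fact above. Such a path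
identifies the induced maps on `K₀` (`CornerHomotopic.K0_map_eq`), as a path of projections has
Murray-von Neumann equivalent ends, and on `K₁` (`CornerHomotopic.K1_map_eq`).

Functoriality follows, since `W V` covers `g ∘ f` if `V` covers `f` and `W` covers `g`, and since
the identity covers the identity map.
-/

open scoped TensorProduct

noncomputable section

/-! ### Coarse maps and supports of operators -/

section CoarseMaps

variable {X Y Z : Type*} [MetricSpace X] [MetricSpace Y] [MetricSpace Z]

theorem IsCoarseMap.exists_dist_le {f : X → Y} (hf : IsCoarseMap f) (r : ℝ) :
    ∃ s : ℝ, ∀ x x', dist x x' ≤ r → dist (f x) (f x') ≤ s := by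
  obtain ⟨ρ, hρ, h⟩ := hf.expansive
  refine ⟨ρ r.toNNReal, fun x x' hx => ?_⟩
  have : nndist x x' ≤ r.toNNReal := by
    rw [← NNReal.coe_le_coe, coe_nndist]; exact hx.trans (Real.le_coe_toNNReal r)
  exact_mod_cast (h x x').trans (hρ this)

theorem IsCoarseMap.comp {f : X → Y} {g : Y → Z} (hg : IsCoarseMap g) (hf : IsCoarseMap f) :
    IsCoarseMap (g ∘ f) where
  expansive := by
    obtain ⟨ρ, hρ, h⟩ := hf.expansive
    obtain ⟨σ, hσ, h'⟩ := hg.expansive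
    exact ⟨σ ∘ ρ, hσ.comp hρ, fun x y => (h' _ _).trans (hσ (h x y))⟩
  proper B hB := hf.proper _ (hg.proper B hB)

theorem isCoarseMap_id : IsCoarseMap (id : X → X) where
  expansive := ⟨id, monotone_id, fun _ _ => le_rfl⟩
  proper _ hB := hB

end CoarseMaps

namespace AmpleModule

variable {X : Type*} [MetricSpace X] [ProperSpace X] [MeasurableSpace X] [BorelSpace X]
  {H : Type*} [NormedAddCommGroup H] [InnerProductSpace ℂ H] [CompleteSpace H]
  (M : AmpleModule X H)

/-- The vanishing of `χ_E ζ` is a null set condition on `E`; this is what allows measure-theoretic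
arguments (countable unions, inner regularity) with the projections `χ_E`. -/
theorem χ_apply_eq_zero_iff {E : Set X} (hE : MeasurableSet E) {ζ : H} :
    M.χ E ζ = 0 ↔ M.vectorMeasure ζ E = 0 := by
  constructor
  · intro h
    refine M.vectorMeasure_eq_zero_of_orthogonal hE fun η hη => ?_
    have h1 : M.χ E η = η := Submodule.starProjection_eq_self_iff.2 hη
    rw [← h1, ← (M.isSelfAdjoint_χ E).star_eq, ContinuousLinearMap.star_eq_adjoint,
      ContinuousLinearMap.adjoint_inner_right, h, inner_zero_left]
  · intro h
    have h1 : ζ ∈ M.spectralSubspace Eᶜ := by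
      rw [mem_spectralSubspace, compl_compl]; exact h
    have h2 : M.χ Eᶜ ζ = ζ := Submodule.starProjection_eq_self_iff.2 h1
    rw [← h2, ← mul_apply_eq_comp, M.χ_mul_of_disjoint hE hE.compl disjoint_compl_right]
    rfl

theorem χ_add_χ_compl {E : Set X} (hE : MeasurableSet E) : M.χ E + M.χ Eᶜ = 1 := by
  ext ζ
  rw [← sub_eq_zero]
  refine M.eq_zero_of_χ_eq_zero (ι := Bool) (E := fun b => if b then E else Eᶜ) (fun b => ?_)
    ?_ fun b => ?_
  · cases b <;> simp [hE]
  · ext x; simp [em, or_comm]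
  · have h1 := M.χ_mul_of_disjoint hE hE.compl disjoint_compl_right
    have h2 := M.χ_mul_of_disjoint hE.compl hE disjoint_compl_left
    have e1 : M.χ E * (M.χ E + M.χ Eᶜ - 1) = 0 := by
      rw [mul_sub, mul_add, χ_mul_self, h1]; simp
    have e2 : M.χ Eᶜ * (M.χ E + M.χ Eᶜ - 1) = 0 := by
      rw [mul_sub, mul_add, χ_mul_self, h2]; simp
    cases b
    · exact DFunLike.congr_fun e2 ζ
    · exact DFunLike.congr_fun e1 ζ

theorem adjoint_χ (E : Set X) : ContinuousLinearMap.adjoint (M.χ E) = M.χ E := by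
  rw [← ContinuousLinearMap.star_eq_adjoint, (M.isSelfAdjoint_χ E).star_eq]

theorem vectorMeasure_χ_compl (E : Set X) (ζ : H) : M.vectorMeasure (M.χ E ζ) Eᶜ = 0 :=
  Submodule.starProjection_apply_mem (M.spectralSubspace E) ζ

theorem act_eq_zero_of_vectorMeasure {f : C_c(X, ℝ)} {ζ : H}
    (h : ∀ᵐ x ∂(M.vectorMeasure ζ), f x = 0) : M.act f ζ = 0 := by
  have h1 := M.norm_act_sq_eq_integral ζ f
  rw [integral_eq_zero_of_ae (by filter_upwards [h] with x hx; simp [hx])] at h1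
  exact norm_eq_zero.1 (pow_eq_zero_iff two_ne_zero |>.1 h1)

/-- A function supported in `L` factors through `χ_L`. -/
theorem act_mul_χ {f : C_c(X, ℝ)} {L : Set X} (hL : MeasurableSet L) (hf : ∀ x ∉ L, f x = 0) :
    M.act f * M.χ L = M.act f := by
  have h0 : M.act f * M.χ Lᶜ = 0 := by
    ext ζ
    refine M.act_eq_zero_of_vectorMeasure ?_
    have h1 := M.vectorMeasure_χ_compl Lᶜ ζ
    rw [compl_compl] at h1
    filter_upwards [compl_mem_ae_iff.2 h1] with x hx using hf x hx
  conv_rhs => rw [← mul_one (M.act f), ← M.χ_add_χ_compl hL, mul_add, h0, add_zero]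

/-- A cut-off function which is `1` on `B` acts as the identity on the range of `χ_B`. -/
theorem act_mul_χ_eq {f : C_c(X, ℝ)} {B : Set X} (hf1 : ∀ x ∈ B, f x = 1) :
    M.act f * M.χ B = M.χ B := by
  ext ξ
  set ζ := M.χ B ξ with hζ
  change M.act f ζ = ζ
  refine eq_of_norm_sub_le_zero (le_of_forall_pos_le_add fun ε hε => ?_)
  obtain ⟨K', hK', h⟩ := M.exists_cutoff_close ζ hε
  obtain ⟨e, he1, -, he⟩ := exists_cutoff (hK'.union f.hasCompactSupport) isOpen_univ
    (Set.subset_univ _)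
  have h3 := h e (fun x hx => he1 x (.inl hx)) he
  have h4 : M.act (f - e) ζ = 0 := by
    refine M.act_eq_zero_of_vectorMeasure ?_
    filter_upwards [compl_mem_ae_iff.2 (M.vectorMeasure_χ_compl B ξ)] with x hx
    have hx' : x ∈ B := not_not.1 hx
    have hx2 : x ∈ tsupport f := subset_tsupport f (by simp [hf1 x hx'])
    rw [CompactlySupportedContinuousMap.sub_apply, hf1 x hx', he1 x (.inr hx2), sub_self]
  rw [act_sub, sub_apply, sub_eq_zero] at h4
  rw [h4, zero_add]
  exact h3

theorem χ_mul_act_eq {f : C_c(X, ℝ)} {B : Set X} (hf1 : ∀ x ∈ B, f x = 1) :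
    M.χ B * M.act f = M.χ B := by
  have h := congrArg star (M.act_mul_χ_eq hf1)
  rwa [star_mul, M.star_act, (M.isSelfAdjoint_χ B).star_eq] at h

/-- Compactness of `g T` for all `g ∈ C₀(X)` needs to be checked for compactly supported `g`
only. -/
theorem isCompactOperator_rep_mul {T : H →L[ℂ] H}
    (hT : ∀ f : C_c(X, ℝ), IsCompactOperator (M.act f * T)) (g : C₀(X, ℂ)) :
    IsCompactOperator (M.rep g * T) := by
  have hz := g.zero_at_infty'
  have hex (n : ℕ) : ∃ f : C_c(X, ℝ), ‖M.rep g * M.act f - M.rep g‖ ≤ 1 / ((n : ℝ) + 1) := by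
    have hz' : ∀ᶠ x in Filter.cocompact X, ‖g x‖ < 1 / ((n : ℝ) + 1) := by
      have := (Metric.tendsto_nhds.1 hz) (1 / ((n : ℝ) + 1)) (by positivity)
      simpa using this
    obtain ⟨K, hK, hK'⟩ := Filter.mem_cocompact.1 hz'
    obtain ⟨f, hf1, -, hf⟩ := exists_cutoff hK isOpen_univ (Set.subset_univ K)
    refine ⟨f, ?_⟩
    have : M.rep g * M.act f - M.rep g = M.rep (g * ccToC0 f - g) := by
      rw [map_sub, map_mul]; rfl
    rw [this]
    refine (NonUnitalStarAlgHom.norm_apply_le M.rep _).trans ?_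
    rw [← ZeroAtInftyContinuousMap.norm_toBCF_eq_norm]
    refine (BoundedContinuousFunction.norm_le (by positivity)).2 fun x => ?_
    change ‖g x * (f x : ℂ) - g x‖ ≤ _
    by_cases hx : x ∈ K
    · simp [hf1 x hx]; positivity
    · have h1 : ‖g x‖ < 1 / ((n : ℝ) + 1) := hK' hx
      have h2 : g x * (f x : ℂ) - g x = ((f x - 1 : ℝ) : ℂ) * g x := by push_cast; ring
      rw [h2, norm_mul]
      have h3 : ‖((f x - 1 : ℝ) : ℂ)‖ ≤ 1 := by
        rw [Complex.norm_real, Real.norm_eq_abs, abs_le]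
        constructor <;> linarith [(hf x).1, (hf x).2]
      nlinarith [norm_nonneg (g x)]
  choose f hf using hex
  have hlim : Filter.Tendsto (fun n => M.rep g * M.act (f n)) Filter.atTop (𝓝 (M.rep g)) := by
    rw [tendsto_iff_norm_sub_tendsto_zero]
    exact squeeze_zero (fun _ => norm_nonneg _) hf tendsto_one_div_add_atTop_nhds_zero_nat
  refine isClosed_setOfPred_isCompactOperator.mem_of_tendsto (hlim.mul_const T)
    (.of_forall fun n => ?_)
  have := (hT (f n)).clm_comp (M.rep g)
  rw [Set.mem_ofPred_eq, mul_assoc]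
  exact this

end AmpleModule

section Support

variable {X : Type*} [MetricSpace X] [ProperSpace X] [MeasurableSpace X] [BorelSpace X]
  {Y : Type*} [MetricSpace Y] [ProperSpace Y] [MeasurableSpace Y] [BorelSpace Y]
  {Z : Type*} [MetricSpace Z] [ProperSpace Z] [MeasurableSpace Z] [BorelSpace Z]
  {HX : Type*} [NormedAddCommGroup HX] [InnerProductSpace ℂ HX] [CompleteSpace HX]
  {HY : Type*} [NormedAddCommGroup HY] [InnerProductSpace ℂ HY] [CompleteSpace HY]
  {HZ : Type*} [NormedAddCommGroup HZ] [InnerProductSpace ℂ HZ] [CompleteSpace HZ]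
  {M : AmpleModule X HX} {N : AmpleModule Y HY} {P : AmpleModule Z HZ}

open ContinuousLinearMap in
theorem χ_comp_comp_χ_eq_zero_iff_adjoint (T : HX →L[ℂ] HY) (E : Set X) (F : Set Y) :
    (N.χ F).comp (T.comp (M.χ E)) = 0 ↔ (M.χ E).comp ((adjoint T).comp (N.χ F)) = 0 := by
  rw [← (adjoint (𝕜 := ℂ) (E := HX) (F := HY)).map_eq_zero_iff, adjoint_comp, adjoint_comp,
    M.adjoint_χ, N.adjoint_χ, ContinuousLinearMap.comp_assoc]

/-- The blocks of an operator away from its support vanish. For compact `E` this is a covering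
argument, first over `E` and then, by the Lindelöf property, over `F`; inner regularity of the
spectral measures gives the general case. -/
theorem χ_comp_comp_χ_eq_zero {T : HX →L[ℂ] HY} {E : Set X} {F : Set Y} (hE : MeasurableSet E)
    (hF : MeasurableSet F) (h : ∀ x ∈ E, ∀ y ∈ F, (y, x) ∉ opSupport M N T) :
    (N.χ F).comp (T.comp (M.χ E)) = 0 := by
  have key : ∀ L ⊆ E, IsCompact L → (N.χ F).comp (T.comp (M.χ L)) = 0 := by
    intro L hLE hL
    ext ζ
    change N.χ F (T (M.χ L ζ)) = 0
    rw [N.χ_apply_eq_zero_iff hF]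
    refine measure_null_of_locally_null _ fun y hy => ?_
    have hex (x : L) : ∃ U : Set X, ∃ W : Set Y, IsOpen U ∧ x.1 ∈ U ∧ IsOpen W ∧ y ∈ W ∧
        (N.χ W).comp (T.comp (M.χ U)) = 0 := by
      have := h x.1 (hLE x.2) y hy
      simp only [opSupport, Set.mem_ofPred_eq, not_forall, not_not] at this
      obtain ⟨U, W, h1, h2, h3, h4, h5⟩ := this
      exact ⟨U, W, h1, h2, h3, h4, h5⟩
    choose U W hU hxU hW hyW hUW using hex
    obtain ⟨t, ht⟩ := hL.elim_finite_subcover U hU fun x hx => Set.mem_iUnion.2 ⟨⟨x, hx⟩, hxU _⟩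
    let W' : Set Y := ⋂ x ∈ t, W x
    have hW' : IsOpen W' := isOpen_biInter_finset fun x _ => hW x
    have hW0 : (N.χ W').comp (T.comp (M.χ L)) = 0 := by
      rw [χ_comp_comp_χ_eq_zero_iff_adjoint]
      ext η
      change M.χ L (ContinuousLinearMap.adjoint T (N.χ W' η)) = 0
      rw [M.χ_apply_eq_zero_iff hL.measurableSet]
      refine measure_mono_null ht ((measure_biUnion_null_iff t.countable_toSet).2 fun x hx => ?_)
      rw [← M.χ_apply_eq_zero_iff (hU x).measurableSet]
      have h1 : N.χ W' η = N.χ (W x) (N.χ W' η) :=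
        (DFunLike.congr_fun (N.χ_mul_of_subset (Set.biInter_subset_of_mem hx)) η).symm
      rw [h1]
      exact DFunLike.congr_fun ((χ_comp_comp_χ_eq_zero_iff_adjoint _ _ _).1 (hUW x)) (N.χ W' η)
    refine ⟨W', mem_nhdsWithin_of_mem_nhds (hW'.mem_nhds (Set.mem_iInter₂.2 fun x _ => hyW x)), ?_⟩
    rw [← N.χ_apply_eq_zero_iff hW'.measurableSet]
    exact DFunLike.congr_fun hW0 ζ
  rw [χ_comp_comp_χ_eq_zero_iff_adjoint]
  ext η
  change M.χ E (ContinuousLinearMap.adjoint T (N.χ F η)) = 0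
  rw [M.χ_apply_eq_zero_iff hE, hE.measure_eq_iSup_isCompact_of_ne_top (measure_ne_top _ _)]
  refine le_antisymm (iSup₂_le fun L hLE => iSup_le fun hL => ?_) bot_le
  refine le_of_eq ((M.χ_apply_eq_zero_iff hL.measurableSet).1 ?_)
  exact DFunLike.congr_fun ((χ_comp_comp_χ_eq_zero_iff_adjoint _ _ _).1 (key L hLE hL)) η

theorem χ_comp_eq_comp_χ {T : HX →L[ℂ] HY} {E : Set X} {F : Set Y} (hE : MeasurableSet E)
    (hF : MeasurableSet F) (h : ∀ p ∈ opSupport M N T, p.1 ∈ F → p.2 ∈ E) :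
    (N.χ F).comp T = (N.χ F).comp (T.comp (M.χ E)) := by
  have h0 : (N.χ F).comp (T.comp (M.χ Eᶜ)) = 0 :=
    χ_comp_comp_χ_eq_zero hE.compl hF fun x hx y hy hp => hx (h _ hp hy)
  have h1 : T = T.comp (M.χ E) + T.comp (M.χ Eᶜ) := by
    rw [← ContinuousLinearMap.comp_add, M.χ_add_χ_compl hE]; rfl
  conv_lhs => rw [h1, ContinuousLinearMap.comp_add, h0, add_zero]

theorem comp_χ_eq_χ_comp {T : HX →L[ℂ] HY} {E : Set X} {F : Set Y} (hE : MeasurableSet E)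
    (hF : MeasurableSet F) (h : ∀ p ∈ opSupport M N T, p.2 ∈ E → p.1 ∈ F) :
    T.comp (M.χ E) = (N.χ F).comp (T.comp (M.χ E)) := by
  have h0 : (N.χ Fᶜ).comp (T.comp (M.χ E)) = 0 :=
    χ_comp_comp_χ_eq_zero hE hF.compl fun x hx y hy hp => hy (h _ hp hx)
  have h1 : T.comp (M.χ E) = (N.χ F + N.χ Fᶜ).comp (T.comp (M.χ E)) := by
    rw [N.χ_add_χ_compl hF]; rfl
  conv_lhs => rw [h1, ContinuousLinearMap.add_comp, h0, add_zero]

theorem IsCoveringIsometry.comp {f : X → Y} {g : Y → Z} (hf : IsCoarseMap f) (hg : IsCoarseMap g)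
    {V : HX →ₗᵢ[ℂ] HY} {W : HY →ₗᵢ[ℂ] HZ} (hV : IsCoveringIsometry M N f V)
    (hW : IsCoveringIsometry N P g W) : IsCoveringIsometry M P (g ∘ f) (W.comp V) := by
  obtain ⟨R, hR⟩ := hV
  obtain ⟨S, hS⟩ := hW
  obtain ⟨r, hr⟩ := hf.exists_dist_le 1
  obtain ⟨s, hs⟩ := hg.exists_dist_le (r + R)
  refine ⟨1 + S + s, fun p hp => ?_⟩
  by_contra! hd
  obtain ⟨z, x⟩ := p
  refine hp (Metric.ball x 1) (Metric.ball z 1) Metric.isOpen_ball (Metric.mem_ball_self one_pos)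
    Metric.isOpen_ball (Metric.mem_ball_self one_pos) ?_
  -- `V` maps the range of `χ` of a ball into the range of `χ` of a ball, on which `W` is known
  let F := Metric.ball (f x) (r + R)
  have h1 := comp_χ_eq_χ_comp (M := M) (N := N) (T := V.toContinuousLinearMap)
    (E := Metric.ball x 1) (F := F) measurableSet_ball measurableSet_ball
    fun p hp hx => by
      have h1 := hR p hp
      have h2 := hr p.2 x (Metric.mem_ball.1 hx).le
      rw [Metric.mem_ball]
      have := dist_triangle_left p.1 (f x) (f p.2)
      linarith
  have h2 := χ_comp_comp_χ_eq_zero (M := N) (N := P) (T := W.toContinuousLinearMap)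
    (E := F) (F := Metric.ball z 1) measurableSet_ball measurableSet_ball
    fun y hy z' hz' hp => by
      have h1 := hS _ hp
      have h2 := hs (f x) y (by rw [dist_comm]; exact (Metric.mem_ball.1 hy).le)
      have h3 := dist_triangle4 (g (f x)) (g y) z' z
      have h4 := Metric.mem_ball.1 hz'
      simp only [Function.comp_apply] at hd h1
      linarith
  have e : (W.comp V).toContinuousLinearMap
      = W.toContinuousLinearMap.comp V.toContinuousLinearMap := rfl
  change (P.χ _).comp ((W.comp V).toContinuousLinearMap.comp (M.χ (Metric.ball x 1))) = 0
  rw [e, ContinuousLinearMap.comp_assoc, h1, ← ContinuousLinearMap.comp_assoc,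
    ← ContinuousLinearMap.comp_assoc, ContinuousLinearMap.comp_assoc (P.χ _), h2,
    ContinuousLinearMap.zero_comp]

theorem isCoveringIsometry_id :
    IsCoveringIsometry M M id (LinearIsometry.id (R := ℂ) (E := HX)) := by
  refine ⟨1, fun p hp => ?_⟩
  by_contra! hd
  obtain ⟨y, x⟩ := p
  refine hp (Metric.ball x (1 / 2)) (Metric.ball y (1 / 2)) Metric.isOpen_ball
    (Metric.mem_ball_self (by norm_num)) Metric.isOpen_ball (Metric.mem_ball_self (by norm_num)) ?_
  refine M.χ_mul_of_disjoint measurableSet_ball measurableSet_ball (Metric.ball_disjoint_ball ?_)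
  rw [dist_comm]
  exact (by norm_num : (1 : ℝ) / 2 + 1 / 2 = 1).le.trans hd

/-- `V T V'*` is locally compact if `T` is, for isometries `V` and `V'` covering the same map: since
the map is proper, a compactly supported function on `Y` sees only a compact part of `X`. -/
theorem IsCoveringIsometry.isLocallyCompact {f : X → Y} (hf : IsCoarseMap f)
    {V V' : HX →ₗᵢ[ℂ] HY} (hV : IsCoveringIsometry M N f V) (hV' : IsCoveringIsometry M N f V')
    {T : HX →L[ℂ] HX} (hT : M.IsLocallyCompact T) :
    N.IsLocallyCompact (V.toContinuousLinearMap.comp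
      (T.comp (ContinuousLinearMap.adjoint V'.toContinuousLinearMap))) := by
  have left {V V' : HX →ₗᵢ[ℂ] HY} (hV : IsCoveringIsometry M N f V) {T : HX →L[ℂ] HX}
      (hT : M.IsLocallyCompact T) (g : C₀(Y, ℂ)) :
      IsCompactOperator (N.rep g * V.toContinuousLinearMap.comp
        (T.comp (ContinuousLinearMap.adjoint V'.toContinuousLinearMap))) := by
    refine N.isCompactOperator_rep_mul (fun a => ?_) g
    obtain ⟨R, hR⟩ := hV
    set L := tsupport a with hL
    have hLc : IsCompact L := a.hasCompactSupport
    set B := closure (f ⁻¹' (Metric.thickening R L)) with hB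
    have hBc : IsCompact B :=
      (hf.proper _ hLc.isBounded.thickening).isCompact_closure
    obtain ⟨e, he1, -, -⟩ := AmpleModule.exists_cutoff hBc isOpen_univ (Set.subset_univ B)
    have h1 := χ_comp_eq_comp_χ (M := M) (N := N) (T := V.toContinuousLinearMap) (E := B) (F := L)
      hBc.measurableSet hLc.measurableSet fun p hp hpL =>
        subset_closure (Metric.mem_thickening_iff.2 ⟨p.1, hpL, hR p hp⟩)
    have h2 : N.act a * V.toContinuousLinearMap.comp
        (T.comp (ContinuousLinearMap.adjoint V'.toContinuousLinearMap))
        = (N.act a).comp (V.toContinuousLinearMap.comp ((M.χ B).comp ((M.act e * T).comp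
          (ContinuousLinearMap.adjoint V'.toContinuousLinearMap)))) := by
      rw [← N.act_mul_χ hLc.measurableSet (fun x hx => image_eq_zero_of_notMem_tsupport hx)]
      ext η
      have e1 (ξ : HX) : N.χ L (V ξ) = N.χ L (V (M.χ B ξ)) := DFunLike.congr_fun h1 ξ
      have e2 (ξ : HX) : M.χ B (M.act e ξ) = M.χ B ξ :=
        DFunLike.congr_fun (M.χ_mul_act_eq he1) ξ
      change N.act a (N.χ L (V _)) = N.act a (N.χ L (V (M.χ B (M.act e _))))
      rw [e1, e2]
      rfl
    rw [h2]
    have h3 : IsCompactOperator (M.act e * T) := (hT _).1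
    have h4 : IsCompactOperator ((M.act e * T).comp
        (ContinuousLinearMap.adjoint V'.toContinuousLinearMap)) := h3.comp_clm _
    have h5 := (h4.clm_comp (M.χ B)).clm_comp V.toContinuousLinearMap
    exact h5.clm_comp (N.act a)
  intro g
  refine ⟨left hV hT g, ?_⟩
  have h1 := isCompactOperator_star (left (V' := V) hV' (hT.star M) (star g))
  rw [star_mul, map_star, star_star] at h1
  convert h1 using 3
  rw [ContinuousLinearMap.star_eq_adjoint, ContinuousLinearMap.star_eq_adjoint,
    ContinuousLinearMap.adjoint_comp, ContinuousLinearMap.adjoint_comp,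
    ContinuousLinearMap.adjoint_adjoint, ContinuousLinearMap.adjoint_adjoint,
    ContinuousLinearMap.comp_assoc]

end Support

/-! ### Schur's test, ampliations and discretization of spaces -/

section BandOperators

variable {H₁ H₂ : Type*} [NormedAddCommGroup H₁] [InnerProductSpace ℂ H₁] [CompleteSpace H₁]
  [NormedAddCommGroup H₂] [InnerProductSpace ℂ H₂] [CompleteSpace H₂]

theorem IsStarProjection.inner_apply_eq {P : H₁ →L[ℂ] H₁} (hP : IsStarProjection P) (z w : H₁) :
    inner ℂ z (P w) = inner ℂ (P z) (P w) := by
  conv_lhs => rw [← hP.isIdempotentElem.eq, mul_apply_eq_comp]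
  rw [← ContinuousLinearMap.adjoint_inner_left, ← ContinuousLinearMap.star_eq_adjoint,
    hP.isSelfAdjoint.star_eq]

theorem sum_norm_sq_le_of_hasSum {P : ℕ → H₁ →L[ℂ] H₁} (hP : ∀ i, IsStarProjection (P i))
    {z : H₁} (hz : HasSum (fun i => P i z) z) (s : Finset ℕ) :
    ∑ i ∈ s, ‖P i z‖ ^ 2 ≤ ‖z‖ ^ 2 := by
  have h1 : HasSum (fun i => (inner ℂ z (P i z)).re) (inner ℂ z z).re :=
    Complex.reCLM.hasSum ((innerSL ℂ z).hasSum hz)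
  have h2 (w : H₁) : (inner ℂ w w).re = ‖w‖ ^ 2 := by
    rw [inner_self_eq_norm_sq_to_K]; norm_cast
  have h3 (i : ℕ) : (inner ℂ z (P i z)).re = ‖P i z‖ ^ 2 := by rw [(hP i).inner_apply_eq, h2]
  rw [h2] at h1
  simp only [h3] at h1
  exact sum_le_hasSum s (fun i _ => by positivity) h1

/-- A block matrix with at most `N` non-zero blocks in each row and each column, all of norm at
most `δ`, has norm at most `N δ` (Schur's test). -/
theorem norm_le_of_band {P : ℕ → H₁ →L[ℂ] H₁} {Q : ℕ → H₂ →L[ℂ] H₂}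
    (hP : ∀ i, IsStarProjection (P i)) (hQ : ∀ j, IsStarProjection (Q j))
    (hP1 : ∀ z, HasSum (fun i => P i z) z) (hQ1 : ∀ z, HasSum (fun j => Q j z) z)
    (D : H₁ →L[ℂ] H₂) {r : ℕ → ℕ → Prop} {N : ℕ} (hr : ∀ i, {j | r i j}.encard ≤ N)
    (hr' : ∀ j, {i | r i j}.encard ≤ N) {δ : ℝ} (hδ : 0 ≤ δ)
    (h0 : ∀ i j z, ¬ r i j → Q j (D (P i z)) = 0)
    (h1 : ∀ i j z, r i j → ‖Q j (D (P i z))‖ ≤ δ * ‖P i z‖) : ‖D‖ ≤ N * δ := by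
  classical
  have hfin (j : ℕ) : {i | r i j}.Finite := Set.finite_of_encard_le_coe (hr' j)
  let n (j : ℕ) : Finset ℕ := (hfin j).toFinset
  have hn (i j : ℕ) : i ∈ n j ↔ r i j := by simp [n]
  have hncard (j : ℕ) : ((n j).card : ℝ) ≤ N := by
    have := hr' j
    rw [(hfin j).encard_eq_coe_toFinset_card] at this
    exact_mod_cast this
  have key (w : H₂) (z : H₁) :
      ‖(inner ℂ w (D z) : ℂ)‖ ≤ N * δ * ((‖w‖ ^ 2 + ‖z‖ ^ 2) / 2) := by
    have hblock (j : ℕ) : Q j (D z) = ∑ i ∈ n j, Q j (D (P i z)) := by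
      have e1 := ((Q j).comp D).hasSum (hP1 z)
      refine e1.unique ?_
      exact hasSum_sum_of_ne_finset_zero fun i hi => h0 i j z (mt (hn i j).2 hi)
    have hb (j : ℕ) : ‖(inner ℂ w (Q j (D z)) : ℂ)‖
        ≤ δ * ∑ i ∈ n j, (‖Q j w‖ ^ 2 + ‖P i z‖ ^ 2) / 2 := by
      rw [(hQ j).inner_apply_eq]
      refine (norm_inner_le_norm _ _).trans ?_
      rw [hblock]
      calc ‖Q j w‖ * ‖∑ i ∈ n j, Q j (D (P i z))‖
          ≤ ‖Q j w‖ * ∑ i ∈ n j, δ * ‖P i z‖ := by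
            gcongr
            exact norm_sum_le_of_le _ fun i hi => h1 i j z ((hn i j).1 hi)
        _ = δ * ∑ i ∈ n j, ‖Q j w‖ * ‖P i z‖ := by
            rw [Finset.mul_sum, Finset.mul_sum]
            exact Finset.sum_congr rfl fun i _ => by ring
        _ ≤ _ := by
            gcongr with i
            nlinarith [sq_nonneg (‖Q j w‖ - ‖P i z‖)]
    have hs (s : Finset ℕ) : ‖∑ j ∈ s, (inner ℂ w (Q j (D z)) : ℂ)‖
        ≤ N * δ * ((‖w‖ ^ 2 + ‖z‖ ^ 2) / 2) := by
      have e1 : ∑ j ∈ s, ∑ i ∈ n j, ‖Q j w‖ ^ 2 ≤ N * ‖w‖ ^ 2 := by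
        calc ∑ j ∈ s, ∑ i ∈ n j, ‖Q j w‖ ^ 2 = ∑ j ∈ s, (n j).card * ‖Q j w‖ ^ 2 := by simp
          _ ≤ ∑ j ∈ s, N * ‖Q j w‖ ^ 2 := by gcongr with j; exact_mod_cast hncard j
          _ ≤ N * ‖w‖ ^ 2 := by
            rw [← Finset.mul_sum]; gcongr; exact sum_norm_sq_le_of_hasSum hQ (hQ1 w) s
      have e2 : ∑ j ∈ s, ∑ i ∈ n j, ‖P i z‖ ^ 2 ≤ N * ‖z‖ ^ 2 := by
        rw [Finset.sum_comm' (t' := s.biUnion n) (s' := fun i => s.filter (r i ·))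
          (fun j i => by simp only [Finset.mem_biUnion, Finset.mem_filter, hn]; tauto)]
        calc ∑ i ∈ s.biUnion n, ∑ j ∈ s.filter (r i ·), ‖P i z‖ ^ 2
            = ∑ i ∈ s.biUnion n, (s.filter (r i ·)).card * ‖P i z‖ ^ 2 := by simp
          _ ≤ ∑ i ∈ s.biUnion n, N * ‖P i z‖ ^ 2 := by
            gcongr with i
            have e3 : ((s.filter (r i ·) : Finset ℕ) : Set ℕ).encard ≤ N :=
              (Set.encard_le_encard (by intro j hj; simpa using (Finset.mem_filter.1 hj).2)).trans
                (hr i)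
            rw [Set.encard_coe_eq_coe_finsetCard] at e3
            exact_mod_cast e3
          _ ≤ N * ‖z‖ ^ 2 := by
            rw [← Finset.mul_sum]; gcongr; exact sum_norm_sq_le_of_hasSum hP (hP1 z) _
      calc ‖∑ j ∈ s, (inner ℂ w (Q j (D z)) : ℂ)‖
          ≤ ∑ j ∈ s, δ * ∑ i ∈ n j, (‖Q j w‖ ^ 2 + ‖P i z‖ ^ 2) / 2 :=
            norm_sum_le_of_le _ fun j _ => hb j
        _ = δ * ((∑ j ∈ s, ∑ i ∈ n j, ‖Q j w‖ ^ 2 + ∑ j ∈ s, ∑ i ∈ n j, ‖P i z‖ ^ 2) / 2) := by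
            simp only [← Finset.mul_sum, ← Finset.sum_div, Finset.sum_add_distrib]
        _ ≤ δ * ((N * ‖w‖ ^ 2 + N * ‖z‖ ^ 2) / 2) := by gcongr
        _ = _ := by ring
    exact le_of_tendsto ((innerSL ℂ w).hasSum (hQ1 (D z))).norm (.of_forall hs)
  refine ContinuousLinearMap.opNorm_le_bound _ (by positivity) fun z => ?_
  rcases eq_or_ne (D z) 0 with hD | hD
  · rw [hD, norm_zero]; positivity
  have hz : 0 < ‖z‖ := by
    rw [norm_pos_iff]; rintro rfl; exact hD (map_zero D)
  have hD' : 0 < ‖D z‖ := norm_pos_iff.2 hD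
  -- the scaling for which the arithmetic-geometric mean inequality above is sharp
  set t : ℝ := ‖z‖ / ‖D z‖ with ht
  have ht0 : 0 < t := by positivity
  have e := key ((t : ℂ) • D z) z
  rw [inner_smul_left, norm_mul, norm_smul, inner_self_eq_norm_sq_to_K] at e
  simp only [Complex.conj_ofReal, Complex.norm_real, norm_pow, Real.norm_eq_abs, abs_of_pos ht0,
    Complex.coe_algebraMap, abs_norm] at e
  have e1 : t * ‖D z‖ = ‖z‖ := by rw [ht]; field_simp
  rw [e1, sq ‖D z‖, ← mul_assoc, e1] at e
  have e2 : ‖z‖ * ‖D z‖ ≤ ‖z‖ * (N * δ * ‖z‖) := by linarith [e]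
  exact le_of_mul_le_mul_left e2 hz

end BandOperators

section TensorMaps

variable {H₁ H₂ H₃ K : Type*} [NormedAddCommGroup H₁] [InnerProductSpace ℂ H₁]
  [NormedAddCommGroup H₂] [InnerProductSpace ℂ H₂] [NormedAddCommGroup H₃] [InnerProductSpace ℂ H₃]
  [NormedAddCommGroup K] [InnerProductSpace ℂ K]

variable (K) in
/-- The operator `S ⊗ 1` between Hilbert space tensor products, for `S : H₁ → H₂`. -/
def ampliation (S : H₁ →L[ℂ] H₂) : HTensor H₁ K →L[ℂ] HTensor H₂ K :=
  (TensorProduct.mapL S (1 : K →L[ℂ] K)).completion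

theorem ampliation_coe (S : H₁ →L[ℂ] H₂) (z : H₁ ⊗[ℂ] K) :
    ampliation K S (HTensor.coe z) = HTensor.coe (TensorProduct.mapL S (1 : K →L[ℂ] K) z) :=
  ContinuousLinearMap.completion_apply_coe _ _

theorem ampliation_tmul (S : H₁ →L[ℂ] H₂) (ξ : H₁) (b : K) :
    ampliation K S (HTensor.coe (ξ ⊗ₜ[ℂ] b)) = HTensor.coe (S ξ ⊗ₜ[ℂ] b) := by
  rw [ampliation_coe]; rfl

/-- Bounded operators are determined by elementary tensors; unlike `opTensor_ext`, this allows
different domains and codomains. -/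
theorem HTensor.clm_ext {A B : HTensor H₁ K →L[ℂ] HTensor H₂ K}
    (h : ∀ (ξ : H₁) (b : K), A (HTensor.coe (ξ ⊗ₜ[ℂ] b)) = B (HTensor.coe (ξ ⊗ₜ[ℂ] b))) :
    A = B := by
  refine ContinuousLinearMap.ext fun z => ?_
  refine HTensor.denseRange_coe.induction_on z (isClosed_eq A.continuous B.continuous) fun w => ?_
  induction w using TensorProduct.induction_on with
  | zero => rw [map_zero, map_zero, map_zero]
  | tmul ξ b => exact h ξ b
  | add u v hu hv => rw [map_add, map_add, map_add, hu, hv]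

theorem norm_ampliation_le (S : H₁ →L[ℂ] H₂) : ‖ampliation K S‖ ≤ ‖S‖ := by
  refine ContinuousLinearMap.opNorm_le_bound _ (by positivity) fun z => ?_
  refine HTensor.denseRange_coe.induction_on z
    (isClosed_le (by fun_prop) (by fun_prop)) fun w => ?_
  rw [ampliation_coe, HTensor.norm_coe, HTensor.norm_coe]
  refine (TensorProduct.mapL S 1).le_of_opNorm_le ((TensorProduct.norm_mapL_le S _).trans ?_) w
  have : ‖(1 : K →L[ℂ] K)‖ ≤ 1 := ContinuousLinearMap.norm_id_le
  nlinarith [norm_nonneg S]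

theorem adjoint_ampliation [CompleteSpace H₁] [CompleteSpace H₂] (S : H₁ →L[ℂ] H₂) :
    ContinuousLinearMap.adjoint (ampliation K S)
      = ampliation K (ContinuousLinearMap.adjoint S) := by
  rw [eq_comm, ContinuousLinearMap.eq_adjoint_iff]
  intro x y
  refine HTensor.denseRange_coe.induction_on x
    (isClosed_eq (by fun_prop) (by fun_prop)) fun u => ?_
  refine HTensor.denseRange_coe.induction_on y
    (isClosed_eq (by fun_prop) (by fun_prop)) fun v => ?_
  rw [ampliation_coe, ampliation_coe, HTensor.inner_coe, HTensor.inner_coe]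
  induction u using TensorProduct.induction_on with
  | zero => simp
  | add u u' hu hu' => rw [map_add, inner_add_left, inner_add_left, hu, hu']
  | tmul ξ b =>
    induction v using TensorProduct.induction_on with
    | zero => simp
    | add u u' hu hu' => rw [map_add, inner_add_right, inner_add_right, hu, hu']
    | tmul η c => simp [ContinuousLinearMap.adjoint_inner_left]

/-- `V T W* ⊗ 1 = (V ⊗ 1) (T ⊗ 1) (W ⊗ 1)*`. -/
theorem opTensor_eq_ampliation_comp (V W : H₁ →L[ℂ] H₂) (T : H₁ →L[ℂ] H₁)
    [CompleteSpace H₁] [CompleteSpace H₂] :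
    opTensor (V.comp (T.comp (ContinuousLinearMap.adjoint W))) (1 : K →L[ℂ] K)
      = (ampliation K V).comp ((opTensor T 1).comp
          (ContinuousLinearMap.adjoint (ampliation K W))) := by
  rw [adjoint_ampliation]
  refine HTensor.clm_ext fun ξ b => ?_
  simp [opTensor_tmul, ampliation_tmul]

end TensorMaps

section Discretization

/-- A countable net of a metric space yields a measurable map to the net which moves points by a
bounded distance only; it sends a point to the first net point that is close enough. -/
theorem exists_measurable_nearby_index {X : Type*} [MetricSpace X] [MeasurableSpace X]
    [BorelSpace X] {γ : ℕ → X} {C : ℝ} (h : ∀ x, ∃ n, dist x (γ n) ≤ C) :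
    ∃ q : X → ℕ, Measurable q ∧ (∀ x, dist x (γ (q x)) ≤ C) ∧
      Set.InjOn γ (Set.range q) := by
  classical
  refine ⟨fun x => Nat.find (h x), ?_, fun x => Nat.find_spec (h x), ?_⟩
  · refine measurable_find h fun n => ?_
    exact (isClosed_le (by fun_prop) continuous_const).measurableSet
  · rintro _ ⟨x, rfl⟩ _ ⟨y, rfl⟩ hxy
    refine le_antisymm (Nat.find_min' _ ?_) (Nat.find_min' _ ?_)
    · rw [← hxy]; exact Nat.find_spec (h x)
    · rw [hxy]; exact Nat.find_spec (h y)

theorem exists_measurable_dense_index (X : Type*) [MetricSpace X] [ProperSpace X]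
    [MeasurableSpace X] [BorelSpace X] [Nonempty X] :
    ∃ (d : ℕ → X) (r : X → ℕ), Measurable r ∧ ∀ x, dist x (d (r x)) ≤ 1 := by
  obtain ⟨r, hr, hd, -⟩ := exists_measurable_nearby_index
    (γ := TopologicalSpace.denseSeq X) (C := 1) fun x => by
      obtain ⟨n, hn⟩ := (TopologicalSpace.denseRange_denseSeq X).exists_dist_lt x one_pos
      exact ⟨n, hn.le⟩
  exact ⟨_, r, hr, hd⟩

/-- In a space of bounded geometry the net can be indexed such that each ball contains a uniformly
bounded number of the points which are used. -/
theorem BoundedGeometry.exists_index {Y : Type*} [MetricSpace Y] [ProperSpace Y]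
    [MeasurableSpace Y] [BorelSpace Y] [Nonempty Y] (hY : BoundedGeometry Y) :
    ∃ (γ : ℕ → Y) (q : Y → ℕ) (C : ℝ), Measurable q ∧ (∀ y, dist y (γ (q y)) ≤ C) ∧
      ∀ R : ℝ, ∃ N : ℕ, ∀ n, {m | m ∈ Set.range q ∧ dist (γ m) (γ n) < R}.encard ≤ N := by
  obtain ⟨Γ, ⟨C, -, hC⟩, -, hN⟩ := hY
  have hne : Γ.Nonempty := by
    obtain ⟨y⟩ := ‹Nonempty Y›
    obtain ⟨z, hz, -⟩ := hC y
    exact ⟨z, hz⟩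
  have hcount : Γ.Countable := by
    obtain ⟨z, hz⟩ := hne
    refine (Set.countable_iUnion fun n : ℕ => ?_ : (⋃ n : ℕ, Metric.ball z n ∩ Γ).Countable).mono
      fun y hy => ?_
    · obtain ⟨N, hN⟩ := hN n n.cast_nonneg
      exact (Set.finite_of_encard_le_coe (hN z hz)).countable
    · obtain ⟨n, hn⟩ := exists_nat_gt (dist y z)
      exact Set.mem_iUnion.2 ⟨n, hn, hy⟩
  obtain ⟨γ, rfl⟩ := hcount.exists_eq_range hne
  obtain ⟨q, hq, hd, hinj⟩ := exists_measurable_nearby_index (γ := γ) (C := C) fun y => by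
    obtain ⟨_, ⟨n, rfl⟩, hn⟩ := hC y
    exact ⟨n, hn⟩
  refine ⟨γ, q, C, hq, hd, fun R => ?_⟩
  obtain ⟨N, hN⟩ := hN (max R 0) (le_max_right _ _)
  refine ⟨N, fun n => ?_⟩
  refine le_trans ?_ (hN (γ n) ⟨n, rfl⟩)
  rw [← Set.InjOn.encard_image (f := γ) (hinj.mono fun m hm => hm.1)]
  refine Set.encard_le_encard ?_
  rintro _ ⟨m, hm, rfl⟩
  exact ⟨Metric.mem_ball.2 (hm.2.trans_le (le_max_left _ _)), m, rfl⟩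

end Discretization

/-! ### Isometries almost intertwine the operators `Λ(g)` -/

theorem disjoint_fibres {X : Type*} {p : X → ℕ} :
    Pairwise (Function.onFun Disjoint fun n => p ⁻¹' {n}) :=
  fun _ _ hmn => Set.disjoint_left.2 fun _ hx hx' => hmn (Eq.trans (Eq.symm hx) hx')

namespace AmpleModule

variable {X : Type*} [MetricSpace X] [ProperSpace X] [MeasurableSpace X] [BorelSpace X]
  {H : Type*} [NormedAddCommGroup H] [InnerProductSpace ℂ H] [CompleteSpace H]
  (M : AmpleModule X H)
  {K : Type*} [NormedAddCommGroup K] [InnerProductSpace ℂ K] [CompleteSpace K]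

variable (K) in
/-- The projections `χ_{p = n} ⊗ 1`, for a countably-valued map `p`. -/
def fibreProj (p : X → ℕ) (n : ℕ) : HTensor H K →L[ℂ] HTensor H K :=
  opTensor (M.χ (p ⁻¹' {n})) 1

theorem isStarProjection_fibreProj (p : X → ℕ) (n : ℕ) :
    IsStarProjection (M.fibreProj K p n) where
  isIdempotentElem := by
    rw [IsIdempotentElem, fibreProj, opTensor_mul, χ_mul_self, one_mul]
  isSelfAdjoint := by
    rw [IsSelfAdjoint, fibreProj, star_opTensor, (M.isSelfAdjoint_χ _).star_eq, star_one]

theorem hasSum_fibreProj {p : X → ℕ} (hp : Measurable p) (z : HTensor H K) :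
    HasSum (fun n => M.fibreProj K p n z) z := by
  have hE (n : ℕ) : MeasurableSet (p ⁻¹' {n}) := hp (measurableSet_singleton n)
  have hU : ⋃ n, p ⁻¹' {n} = Set.univ :=
    Set.eq_univ_of_forall fun x => Set.mem_iUnion.2 ⟨p x, rfl⟩
  obtain ⟨S, -, hS⟩ := M.exists_sum_χ_opTensor (K := K) hE disjoint_fibres (fun _ => 1) zero_le_one
    (fun _ => ContinuousLinearMap.norm_id_le)
  obtain ⟨P, -, hP⟩ := exists_blockSum (fun n => M.χ (p ⁻¹' {n})) (fun n => M.χ (p ⁻¹' {n}))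
    (fun n => M.isSelfAdjoint_χ _) (fun n => M.χ_mul_self _)
    (fun m n hmn => M.χ_mul_of_disjoint (hE m) (hE n) (disjoint_fibres hmn)) zero_le_one
    (fun n z => by simp) (fun n => M.χ_mul_self _)
  have hP1 (ξ : H) : P ξ = ξ := by
    rw [← sub_eq_zero]
    refine M.eq_zero_of_χ_eq_zero hE hU fun n => ?_
    rw [map_sub, sub_eq_zero]
    refine ((M.χ (p ⁻¹' {n})).hasSum (hP ξ)).unique ?_
    convert hasSum_single (f := fun m => M.χ (p ⁻¹' {n}) (M.χ (p ⁻¹' {m}) ξ)) n (fun m hm => ?_)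
      using 1
    · change _ = (M.χ (p ⁻¹' {n}) * M.χ (p ⁻¹' {n})) ξ
      rw [χ_mul_self]
    · change (M.χ (p ⁻¹' {n}) * M.χ (p ⁻¹' {m})) ξ = 0
      rw [M.χ_mul_of_disjoint (hE n) (hE m) (disjoint_fibres hm.symm)]; rfl
  have hS1 : S = 1 := by
    refine opTensor_ext fun ξ c => ?_
    refine (hS _).unique ?_
    simp only [opTensor_tmul]
    have h2 := (HTensor.coe (H := H) (K := K)).hasSum
      (((TensorProduct.mkL ℂ H K).flip c).hasSum (hP ξ))
    rw [hP1] at h2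
    exact h2
  have := hS z
  rwa [hS1] at this

/-- On the fibre `p = n`, the operator `Λ(k ∘ p)` is `1 ⊗ k n`. -/
theorem Lambda_comp_fibreProj {p : X → ℕ} (hp : Measurable p) {k : ℕ → Compacts K} {C : ℝ}
    (hk : ∀ n, ‖k n‖ ≤ C) (hg : StronglyMeasurable fun x => k (p x))
    (hb : ∃ C : ℝ, ∀ x, ‖k (p x)‖ ≤ C) (n : ℕ) (z : HTensor H K) :
    M.Lambda (fun x => k (p x)) hg hb (M.fibreProj K p n z)
        = opTensor (M.χ (p ⁻¹' {n})) (k n : K →L[ℂ] K) z ∧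
      M.fibreProj K p n (M.Lambda (fun x => k (p x)) hg hb z)
        = opTensor (M.χ (p ⁻¹' {n})) (k n : K →L[ℂ] K) z := by
  have hE (n : ℕ) : MeasurableSet (p ⁻¹' {n}) := hp (measurableSet_singleton n)
  have hU : ⋃ n, p ⁻¹' {n} = Set.univ :=
    Set.eq_univ_of_forall fun x => Set.mem_iUnion.2 ⟨p x, rfl⟩
  obtain ⟨L, -, hL⟩ := M.exists_sum_χ_opTensor hE disjoint_fibres (fun n => (k n : K →L[ℂ] K))
    ((norm_nonneg _).trans (hk 0)) hk
  have hL' : M.IsLambdaCountable (fun x => k (p x)) L :=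
    ⟨_, k, hE, disjoint_fibres, hU, fun n x hx => congrArg k hx, ⟨C, hk⟩, hL⟩
  rw [(M.isLambda_Lambda hg hb).unique M (hL'.isLambda M)]
  have h0 (m : ℕ) (hm : m ≠ n) : M.χ (p ⁻¹' {m}) * M.χ (p ⁻¹' {n}) = 0 :=
    M.χ_mul_of_disjoint (hE m) (hE n) (disjoint_fibres hm)
  have h0' (m : ℕ) (hm : m ≠ n) : M.χ (p ⁻¹' {n}) * M.χ (p ⁻¹' {m}) = 0 :=
    M.χ_mul_of_disjoint (hE n) (hE m) (disjoint_fibres hm.symm)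
  constructor
  · refine (hL _).unique ?_
    convert hasSum_single (f := fun m => opTensor (M.χ (p ⁻¹' {m})) (k m : K →L[ℂ] K)
      (M.fibreProj K p n z)) n (fun m hm => ?_) using 1
    · rw [fibreProj, ← mul_apply_eq_comp, opTensor_mul, χ_mul_self, mul_one]
    · rw [fibreProj, ← mul_apply_eq_comp, opTensor_mul, h0 m hm, opTensor_zero_left]; rfl
  · refine ((M.fibreProj K p n).hasSum (hL z)).unique ?_
    convert hasSum_single (f := fun m => M.fibreProj K p n
      (opTensor (M.χ (p ⁻¹' {m})) (k m : K →L[ℂ] K) z)) n (fun m hm => ?_) using 1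
    · rw [fibreProj, ← mul_apply_eq_comp, opTensor_mul, χ_mul_self, one_mul]
    · rw [fibreProj, ← mul_apply_eq_comp, opTensor_mul, h0' m hm, opTensor_zero_left]; rfl

theorem norm_Lambda_sub_le {g h : X → Compacts K} (hg : StronglyMeasurable g)
    (hgb : ∃ C : ℝ, ∀ x, ‖g x‖ ≤ C) (hh : StronglyMeasurable h) (hhb : ∃ C : ℝ, ∀ x, ‖h x‖ ≤ C)
    {C : ℝ} (hC : 0 ≤ C) (hgh : ∀ x, ‖g x - h x‖ ≤ C) :
    ‖M.Lambda g hg hgb - M.Lambda h hh hhb‖ ≤ C := by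
  obtain ⟨gs, Ls, h1, h2, h3⟩ := M.isLambda_Lambda hg hgb
  obtain ⟨gs', Ls', h1', h2', h3'⟩ := M.isLambda_Lambda hh hhb
  refine le_of_forall_pos_le_add fun ε hε => ?_
  refine le_of_tendsto (h3.sub h3').norm ?_
  filter_upwards [Metric.tendstoUniformly_iff.1 h2 (ε / 2) (by positivity),
    Metric.tendstoUniformly_iff.1 h2' (ε / 2) (by positivity)] with n hn hn'
  refine (h1 n).norm_sub_le M (h1' n) (by positivity) fun x => ?_
  have e1 := hn x
  have e2 := hn' x
  have e3 := hgh x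
  rw [dist_comm] at e1
  rw [← dist_eq_norm] at e3 ⊢
  have := dist_triangle4 (gs n x) (g x) (h x) (gs' n x)
  linarith

end AmpleModule

section QuasiLocal

variable {X : Type*} [MetricSpace X] [ProperSpace X] [MeasurableSpace X] [BorelSpace X]
  {Y : Type*} [MetricSpace Y] [ProperSpace Y] [MeasurableSpace Y] [BorelSpace Y]
  {HX : Type*} [NormedAddCommGroup HX] [InnerProductSpace ℂ HX] [CompleteSpace HX]
  {HY : Type*} [NormedAddCommGroup HY] [InnerProductSpace ℂ HY] [CompleteSpace HY]
  {K : Type*} [NormedAddCommGroup K] [InnerProductSpace ℂ K] [CompleteSpace K]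
  {M : AmpleModule X HX} {N : AmpleModule Y HY}

theorem stronglyMeasurable_comp_nat {X B : Type*} [MeasurableSpace X] [TopologicalSpace B]
    {p : X → ℕ} (hp : Measurable p) (k : ℕ → B) :
    StronglyMeasurable fun x => k (p x) :=
  (StronglyMeasurable.of_discrete (f := k)).comp_measurable hp

/-- If a contraction `V` has uniformly few non-zero blocks in each row and column, with respect to
the fibres of `p` and `q`, and the values of `k` differ little where the block is non-zero, then
`V ⊗ 1` almost intertwines `Λ(k ∘ p)` and `Λ(k ∘ q)`: the blocks of the difference are those of `V`,
tensored with `k j - k i`. -/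
theorem norm_Lambda_comp_sub_comp_Lambda_le (V : HX →L[ℂ] HY) {p : X → ℕ} {q : Y → ℕ}
    (hp : Measurable p) (hq : Measurable q) {r : ℕ → ℕ → Prop} {n : ℕ}
    (hr : ∀ i, {j | r i j}.encard ≤ n) (hr' : ∀ j, {i | r i j}.encard ≤ n)
    (hV : ∀ i j, ¬ r i j → (N.χ (q ⁻¹' {j})).comp (V.comp (M.χ (p ⁻¹' {i}))) = 0)
    (hV1 : ‖V‖ ≤ 1) {k : ℕ → Compacts K} {C δ : ℝ} (hk : ∀ m, ‖k m‖ ≤ C) (hδ : 0 ≤ δ)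
    (hkr : ∀ i j, r i j → ‖k j - k i‖ ≤ δ)
    (hkp : StronglyMeasurable fun x => k (p x)) (hkq : StronglyMeasurable fun y => k (q y))
    (hbp : ∃ C : ℝ, ∀ x, ‖k (p x)‖ ≤ C) (hbq : ∃ C : ℝ, ∀ y, ‖k (q y)‖ ≤ C) :
    ‖(N.Lambda (fun y => k (q y)) hkq hbq).comp (ampliation K V)
      - (ampliation K V).comp (M.Lambda (fun x => k (p x)) hkp hbp)‖ ≤ n * δ := by
  have hblock (i j : ℕ) :
      (N.fibreProj K q j).comp (((N.Lambda (fun y => k (q y)) hkq hbq).comp (ampliation K V)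
        - (ampliation K V).comp (M.Lambda (fun x => k (p x)) hkp hbp)).comp (M.fibreProj K p i))
      = (opTensor (N.χ (q ⁻¹' {j})) ((k j : K →L[ℂ] K) - (k i : K →L[ℂ] K))).comp
          ((ampliation K V).comp (M.fibreProj K p i)) := by
    have e1 (z : HTensor HX K) := (M.Lambda_comp_fibreProj hp hk hkp hbp i z).1
    have e2 (z : HTensor HY K) := (N.Lambda_comp_fibreProj hq hk hkq hbq j z).2
    refine HTensor.clm_ext fun ξ b => ?_
    simp only [ContinuousLinearMap.comp_apply, sub_apply, map_sub, e1, e2]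
    simp only [AmpleModule.fibreProj, opTensor_tmul, ampliation_tmul, one_apply_eq_self,
      sub_apply, TensorProduct.tmul_sub, map_sub]
  refine norm_le_of_band (r := r) (M.isStarProjection_fibreProj p) (N.isStarProjection_fibreProj q)
    (M.hasSum_fibreProj hp) (N.hasSum_fibreProj hq) _ hr hr' hδ (fun i j z hij => ?_)
    (fun i j z hij => ?_)
  · refine (DFunLike.congr_fun (hblock i j) z).trans ?_
    have h0 : (opTensor (N.χ (q ⁻¹' {j})) ((k j : K →L[ℂ] K) - (k i : K →L[ℂ] K))).comp
          ((ampliation K V).comp (M.fibreProj K p i)) = 0 := by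
      refine HTensor.clm_ext fun ξ b => ?_
      have h1 : N.χ (q ⁻¹' {j}) (V (M.χ (p ⁻¹' {i}) ξ)) = 0 := DFunLike.congr_fun (hV i j hij) ξ
      simp only [ContinuousLinearMap.comp_apply, AmpleModule.fibreProj, opTensor_tmul,
        ampliation_tmul, h1, TensorProduct.zero_tmul, map_zero, zero_apply]
    rw [h0]; rfl
  · refine (congrArg norm (DFunLike.congr_fun (hblock i j) z)).trans_le ?_
    change ‖opTensor _ _ (ampliation K V (M.fibreProj K p i z))‖ ≤ _
    have h1 : ‖opTensor (N.χ (q ⁻¹' {j})) ((k j : K →L[ℂ] K) - (k i : K →L[ℂ] K))‖ ≤ δ := by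
      refine (norm_opTensor_le _ _).trans ?_
      have h2 := N.norm_χ_le (q ⁻¹' {j})
      have h3 : ‖(k j : K →L[ℂ] K) - (k i : K →L[ℂ] K)‖ ≤ δ := hkr i j hij
      exact (mul_le_mul h2 h3 (norm_nonneg _) zero_le_one).trans (one_mul δ).le
    refine (ContinuousLinearMap.le_of_opNorm_le _ h1 _).trans ?_
    gcongr
    exact ((ampliation K V).le_of_opNorm_le ((norm_ampliation_le V).trans hV1) _).trans
      (one_mul _).le

variable (M N) in
/-- A Borel replacement of a coarse map `f`: a countably-valued map `γ ∘ p` which is uniformly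
expansive, and which is such that `Λ(g)` and `Λ(g ∘ γ ∘ p)` are almost intertwined by all isometries
covering `f`. -/
theorem exists_discretization [Nonempty X] (hY : BoundedGeometry Y) {f : X → Y}
    (hf : IsCoarseMap f) :
    ∃ (p : X → ℕ) (γ : ℕ → Y) (hp : Measurable p),
      (∀ R : ℝ, ∃ S : ℝ, ∀ x x', dist x x' < R → dist (γ (p x)) (γ (p x')) < S) ∧
      ∀ V : HX →ₗᵢ[ℂ] HY, IsCoveringIsometry M N f V → ∃ (n : ℕ) (R₀ : ℝ),
        ∀ (g : Y → Compacts K) (hg : StronglyMeasurable g) (hg1 : ∀ y, ‖g y‖ ≤ 1) (δ : ℝ), 0 ≤ δ →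
          AmpleModule.HasVariation g δ R₀ →
          ‖(N.Lambda g hg ⟨1, hg1⟩).comp (ampliation K V.toContinuousLinearMap)
            - (ampliation K V.toContinuousLinearMap).comp
              (M.Lambda (fun x => g (γ (p x))) (stronglyMeasurable_comp_nat hp fun m => g (γ m))
                ⟨1, fun _ => hg1 _⟩)‖ ≤ (n + 1) * δ := by
  obtain ⟨x₀⟩ := ‹Nonempty X›
  have : Nonempty X := ⟨x₀⟩
  have : Nonempty Y := ⟨f x₀⟩
  obtain ⟨d, r, hr, hdr⟩ := exists_measurable_dense_index X
  obtain ⟨γ, q, C, hq, hγq, hN⟩ := hY.exists_index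
  obtain ⟨s, hs⟩ := hf.exists_dist_le 1
  have hp : Measurable fun x => q (f (d (r x))) :=
    (measurable_from_nat (f := fun m => q (f (d m)))).comp hr
  -- `γ ∘ p` is close to `f`
  have hclose (x : X) : dist (f x) (γ (q (f (d (r x))))) ≤ s + C :=
    (dist_triangle _ _ _).trans (add_le_add (hs _ _ (hdr x)) (hγq _))
  refine ⟨fun x => q (f (d (r x))), γ, hp, fun R => ?_, fun V hV => ?_⟩
  · obtain ⟨t, ht⟩ := hf.exists_dist_le R
    refine ⟨2 * (s + C) + t + 1, fun x x' hxx' => ?_⟩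
    have h1 := ht x x' hxx'.le
    have h2 := dist_triangle4 (γ (q (f (d (r x))))) (f x) (f x') (γ (q (f (d (r x')))))
    have h3 := hclose x
    rw [dist_comm] at h3
    have := hclose x'
    change dist (γ (q (f (d (r x))))) (γ (q (f (d (r x'))))) < _
    linarith
  · obtain ⟨R, hR⟩ := hV
    -- the indices of a non-zero block of `V` belong to net points at distance less than `R₁`
    set R₁ := C + R + (s + C) with hR₁
    obtain ⟨n, hn⟩ := hN R₁
    refine ⟨n, max (C + 1) R₁, fun g hg hg1 δ hδ hgv => ?_⟩
    have hk1 (m : ℕ) : ‖g (γ m)‖ ≤ 1 := hg1 _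
    have hgq : StronglyMeasurable fun y => g (γ (q y)) :=
      stronglyMeasurable_comp_nat hq fun m => g (γ m)
    have hΛ := N.norm_Lambda_sub_le hg ⟨1, hg1⟩ hgq ⟨1, fun y => hg1 _⟩ hδ fun y =>
      (hgv y (γ (q y)) (((hγq y).trans_lt (lt_add_one C)).trans_le (le_max_left _ _))).le
    have hV1 : ‖V.toContinuousLinearMap‖ ≤ 1 := V.norm_toContinuousLinearMap_le
    have hD := norm_Lambda_comp_sub_comp_Lambda_le (M := M) (N := N) V.toContinuousLinearMap hp hq
      (r := fun i j => i ∈ Set.range q ∧ j ∈ Set.range q ∧ dist (γ i) (γ j) < R₁) (n := n)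
      (fun i => le_trans (Set.encard_le_encard (by
        rintro j ⟨-, hj, hd⟩
        exact ⟨hj, by rwa [dist_comm]⟩)) (hn i))
      (fun j => le_trans (Set.encard_le_encard (by
        rintro i ⟨hi, -, hd⟩
        exact ⟨hi, hd⟩)) (hn j))
      (fun i j hij => χ_comp_comp_χ_eq_zero (hp (measurableSet_singleton i))
        (hq (measurableSet_singleton j)) fun x hx y hy hxy => hij ?_)
      hV1 (k := fun m => g (γ m)) hk1 hδ
      (fun i j hij => (hgv _ _ (by
        rw [dist_comm]; exact hij.2.2.trans_le (le_max_right _ _))).le)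
      (stronglyMeasurable_comp_nat hp fun m => g (γ m)) hgq ⟨1, fun _ => hg1 _⟩ ⟨1, fun _ => hg1 _⟩
    · have e : (N.Lambda g hg ⟨1, hg1⟩).comp (ampliation K V.toContinuousLinearMap)
            - (ampliation K V.toContinuousLinearMap).comp
              (M.Lambda (fun x => g (γ (q (f (d (r x))))))
                (stronglyMeasurable_comp_nat hp fun m => g (γ m)) ⟨1, fun _ => hg1 _⟩)
          = (N.Lambda g hg ⟨1, hg1⟩ - N.Lambda (fun y => g (γ (q y))) hgq ⟨1, fun _ => hg1 _⟩).comp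
              (ampliation K V.toContinuousLinearMap)
            + ((N.Lambda (fun y => g (γ (q y))) hgq ⟨1, fun _ => hg1 _⟩).comp
              (ampliation K V.toContinuousLinearMap)
            - (ampliation K V.toContinuousLinearMap).comp
              (M.Lambda (fun x => g (γ (q (f (d (r x))))))
                (stronglyMeasurable_comp_nat hp fun m => g (γ m)) ⟨1, fun _ => hg1 _⟩)) := by
        rw [ContinuousLinearMap.sub_comp]; abel
      rw [e]
      refine (norm_add_le _ _).trans ?_
      have h1 := ((N.Lambda g hg ⟨1, hg1⟩
        - N.Lambda (fun y => g (γ (q y))) hgq ⟨1, fun _ => hg1 _⟩).opNorm_comp_le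
        (ampliation K V.toContinuousLinearMap)).trans (mul_le_mul hΛ
          ((norm_ampliation_le V.toContinuousLinearMap).trans hV1) (norm_nonneg _) hδ)
      linarith
    · obtain rfl : q (f (d (r x))) = i := hx
      obtain rfl : q y = j := hy
      refine ⟨⟨_, rfl⟩, ⟨_, rfl⟩, ?_⟩
      have h1 : dist (f x) y < R := hR _ hxy
      have h2 := dist_triangle4 (γ (q (f (d (r x))))) (f x) y (γ (q y))
      have h3 := hclose x
      rw [dist_comm] at h3
      have := hγq y
      linarith

theorem AmpleModule.nonempty {X : Type*} [MetricSpace X] {H : Type*} [NormedAddCommGroup H]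
    [InnerProductSpace ℂ H] [CompleteSpace H] (M : AmpleModule X H) : Nonempty X := by
  by_contra hX
  rw [not_nonempty_iff] at hX
  refine M.infinite ?_
  have h := M.nondegenerate
  have h0 (f : C₀(X, ℂ)) : f = 0 := by ext x; exact isEmptyElim x
  have : {v : H | ∃ f ξ, v = M.rep f ξ} ⊆ {0} := by
    rintro _ ⟨f, ξ, rfl⟩
    rw [h0 f, map_zero]; rfl
  have h2 : Submodule.span ℂ {v : H | ∃ f ξ, v = M.rep f ξ} = ⊥ := by
    rw [Submodule.span_eq_bot]; exact this
  rw [h2, IsClosed.submodule_topologicalClosure_eq (by simp)] at h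
  have : Subsingleton H := (Submodule.subsingleton_iff ℂ).1 (subsingleton_of_bot_eq_top h)
  infer_instance

/-- `V T V'*` is strongly quasi-local if `T` is, for isometries `V` and `V'` covering the same
map. -/
theorem IsCoveringIsometry.isStronglyQuasiLocal (hY : BoundedGeometry Y) {f : X → Y}
    (hf : IsCoarseMap f) {V V' : HX →ₗᵢ[ℂ] HY} (hV : IsCoveringIsometry M N f V)
    (hV' : IsCoveringIsometry M N f V') {T : HX →L[ℂ] HX} (hT : M.IsStronglyQuasiLocal K T) :
    N.IsStronglyQuasiLocal K (V.toContinuousLinearMap.comp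
      (T.comp (ContinuousLinearMap.adjoint V'.toContinuousLinearMap))) := by
  have := M.nonempty
  obtain ⟨p, γ, hp, hpγ, h⟩ := exists_discretization (K := K) M N hY hf
  obtain ⟨n, R₀, hVn⟩ := h V hV
  obtain ⟨n', R₀', hVn'⟩ := h V' hV'
  intro ε hε
  obtain ⟨δ, hδ, R, hR, hTδ⟩ := hT (ε / 2) (by positivity)
  obtain ⟨S, hS⟩ := hpγ R
  -- the two intertwining errors contribute `(n + 1 + (n' + 1)) ‖T‖` times the variation of `g`
  set c : ℝ := ((n : ℝ) + 1 + (n' + 1)) * (‖T‖ + 1) with hc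
  have hc0 : 0 < c := by positivity
  refine ⟨min δ (ε / (2 * c)), by positivity, max (max R₀ R₀') (max S 1),
    lt_max_of_lt_right (lt_max_of_lt_right one_pos), fun g hg hg1 hgv => ?_⟩
  have hδ' : 0 ≤ ε / (2 * c) := by positivity
  have e1 := hVn g hg hg1 _ hδ' (hgv.mono (min_le_right _ _)
    ((le_max_left _ _).trans (le_max_left _ _)))
  have hadj : StronglyMeasurable fun y => Compacts.adj (g y) :=
    (Isometry.of_dist_eq fun a b => by
      rw [dist_eq_norm, AmpleModule.norm_adj_sub, ← dist_eq_norm] :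
        Isometry (Compacts.adj : Compacts K → Compacts K)).continuous.comp_stronglyMeasurable hg
  have hadj1 (y : Y) : ‖Compacts.adj (g y)‖ ≤ 1 := by
    rw [Submodule.coe_norm, Compacts.adj, norm_star]; exact hg1 y
  have e2 := hVn' (fun y => Compacts.adj (g y)) hadj hadj1 _ hδ' (fun x y hxy => by
    rw [AmpleModule.norm_adj_sub]
    exact hgv.mono (min_le_right _ _) ((le_max_right R₀ R₀').trans (le_max_left _ _)) x y hxy)
  have e3 := hTδ (fun x => g (γ (p x))) (stronglyMeasurable_comp_nat hp fun m => g (γ m))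
    (fun _ => hg1 _) fun x x' hxx' => (hgv _ _ ((hS x x' hxx').trans_le
      ((le_max_left S 1).trans (le_max_right _ _)))).trans_le (min_le_left _ _)
  rw [← N.star_Lambda hg ⟨1, hg1⟩, ← M.star_Lambda (g := fun x => g (γ (p x)))
    (stronglyMeasurable_comp_nat hp fun m => g (γ m)) ⟨1, fun _ => hg1 _⟩,
    ← (ContinuousLinearMap.adjoint (𝕜 := ℂ)).norm_map, map_sub, ContinuousLinearMap.adjoint_comp,
    ContinuousLinearMap.adjoint_comp, ← ContinuousLinearMap.star_eq_adjoint (star _),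
    ← ContinuousLinearMap.star_eq_adjoint (star _), star_star, star_star] at e2
  -- by now `e2` bounds `‖(V' ⊗ 1)* Λ(g) - Λ(g ∘ γ ∘ p) (V' ⊗ 1)*‖`
  rw [opTensor_eq_ampliation_comp]
  set Λ := N.Lambda g hg ⟨1, hg1⟩
  set Λ' := M.Lambda (fun x => g (γ (p x))) (stronglyMeasurable_comp_nat hp fun m => g (γ m))
    ⟨1, fun _ => hg1 _⟩
  set A := ampliation K V.toContinuousLinearMap with hA
  set B := ContinuousLinearMap.adjoint (ampliation K V'.toContinuousLinearMap) with hB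
  set τ := opTensor T (1 : K →L[ℂ] K) with hτ
  have hA1 : ‖A‖ ≤ 1 := (norm_ampliation_le _).trans V.norm_toContinuousLinearMap_le
  have hB1 : ‖B‖ ≤ 1 := by
    rw [hB, LinearIsometryEquiv.norm_map]
    exact (norm_ampliation_le _).trans V'.norm_toContinuousLinearMap_le
  have hτ1 : ‖τ‖ ≤ ‖T‖ := AmpleModule.norm_opTensor_one_le T
  have e : A.comp (τ.comp B) * Λ - Λ * A.comp (τ.comp B)
      = A.comp (τ.comp (B.comp Λ - Λ'.comp B)) + A.comp ((τ * Λ' - Λ' * τ).comp B)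
        - (Λ.comp A - A.comp Λ').comp (τ.comp B) := by
    ext z; simp
  rw [e]
  have n1 : ‖A.comp (τ.comp (B.comp Λ - Λ'.comp B))‖ ≤ ‖T‖ * ((n' + 1) * (ε / (2 * c))) :=
    calc _ ≤ ‖A‖ * (‖τ‖ * ‖B.comp Λ - Λ'.comp B‖) :=
          (A.opNorm_comp_le _).trans (by gcongr; exact τ.opNorm_comp_le _)
      _ ≤ 1 * (‖T‖ * ((n' + 1) * (ε / (2 * c)))) := by gcongr
      _ = _ := one_mul _
  have n2 : ‖A.comp ((τ * Λ' - Λ' * τ).comp B)‖ < ε / 2 :=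
    calc _ ≤ ‖A‖ * (‖τ * Λ' - Λ' * τ‖ * ‖B‖) :=
          (A.opNorm_comp_le _).trans (by gcongr; exact ContinuousLinearMap.opNorm_comp_le _ _)
      _ ≤ 1 * (‖τ * Λ' - Λ' * τ‖ * 1) := by gcongr
      _ < ε / 2 := by rw [one_mul, mul_one]; exact e3
  have n3 : ‖(Λ.comp A - A.comp Λ').comp (τ.comp B)‖ ≤ (n + 1) * (ε / (2 * c)) * ‖T‖ :=
    calc _ ≤ ‖Λ.comp A - A.comp Λ'‖ * (‖τ‖ * ‖B‖) :=
          (ContinuousLinearMap.opNorm_comp_le _ _).trans (by gcongr; exact τ.opNorm_comp_le _)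
      _ ≤ (n + 1) * (ε / (2 * c)) * (‖T‖ * 1) := by gcongr
      _ = _ := by ring
  have n4 : ‖T‖ * ((n' + 1) * (ε / (2 * c))) + (n + 1) * (ε / (2 * c)) * ‖T‖ ≤ ε / 2 := by
    have h1 : ε / 2 = c * (ε / (2 * c)) := by field_simp
    rw [h1]
    have h2 : 0 ≤ ((n : ℝ) + 1 + (n' + 1)) * (ε / (2 * c)) := by positivity
    rw [hc] at h2 ⊢
    nlinarith
  calc _ ≤ _ := (norm_sub_le _ _).trans (add_le_add_left (norm_add_le _ _) _)
    _ < ε := by linarith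

/-- `V T V'*` belongs to the strongly quasi-local algebra if `T` does, for isometries `V` and `V'`
covering the same map. -/
theorem IsCoveringIsometry.mem_sqAlgebra (hY : BoundedGeometry Y) {f : X → Y}
    (hf : IsCoarseMap f) {V V' : HX →ₗᵢ[ℂ] HY} (hV : IsCoveringIsometry M N f V)
    (hV' : IsCoveringIsometry M N f V') {T : HX →L[ℂ] HX} (hT : T ∈ M.sqAlgebra K) :
    V.toContinuousLinearMap.comp
      (T.comp (ContinuousLinearMap.adjoint V'.toContinuousLinearMap)) ∈ N.sqAlgebra K :=
  ⟨hV.isLocallyCompact hf hV' hT.1, hV.isStronglyQuasiLocal hY hf hV' hT.2⟩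

end QuasiLocal

/-! ### Nearby projections are Murray-von Neumann equivalent -/

namespace CStarK

/-- A strictly positive element has an inverse square root in its double commutant. -/
theorem exists_inv_sqrt {A : Type*} [CStarAlgebra A] {a : A} (ha : IsSelfAdjoint a)
    (hspec : ∀ x ∈ spectrum ℝ a, 0 < x) :
    ∃ b : A, star b = b ∧ a * (b * b) = 1 ∧ ∀ c, Commute a c → Commute b c := by
  have hcont : ContinuousOn (fun x : ℝ => (√x)⁻¹) (spectrum ℝ a) :=
    Real.continuous_sqrt.continuousOn.inv₀ fun x hx => (Real.sqrt_pos.2 (hspec x hx)).ne'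
  refine ⟨cfc (fun x : ℝ => (√x)⁻¹) a, (cfc_predicate _ a : IsSelfAdjoint _).star_eq, ?_,
    fun c hc => hc.cfc_real _⟩
  have h1 := cfc_mul (fun x : ℝ => (√x)⁻¹) (fun x : ℝ => (√x)⁻¹) a hcont hcont
  have h2 := cfc_mul (fun x : ℝ => x) (fun x : ℝ => (√x)⁻¹ * (√x)⁻¹) a continuousOn_id
    (hcont.mul hcont)
  rw [cfc_id' ℝ a] at h2
  rw [← h1, ← h2, ← cfc_one ℝ a]
  refine cfc_congr fun x hx => ?_
  have h3 := hspec x hx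
  rw [← mul_inv, Real.mul_self_sqrt h3.le]
  exact mul_inv_cancel₀ h3.ne'

/-- Projections at distance less than `1` are Murray-von Neumann equivalent. -/
theorem exists_partialIsometry_of_norm_sub_lt_one {A : Type*} [CStarAlgebra A] {p q : A}
    (hp : IsStarProjection p) (hq : IsStarProjection q) (h : ‖p - q‖ < 1) :
    ∃ v : A, star v * v = p ∧ v * star v = q := by
  nontriviality A
  -- `a` commutes with both projections, and is invertible; the partial isometry is `q p a^(-1/2)`
  obtain ⟨a, ha⟩ : ∃ a : A, a = 1 - (p - q) * (p - q) := ⟨_, rfl⟩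
  have hpp := hp.isIdempotentElem.eq
  have hqq := hq.isIdempotentElem.eq
  have hps := hp.isSelfAdjoint.star_eq
  have hqs := hq.isSelfAdjoint.star_eq
  have ea : a = 1 - p - q + p * q + q * p := by
    rw [ha, sub_mul, mul_sub, mul_sub, hpp, hqq]; abel
  have hap : a * p = p * q * p := by
    rw [ea]; simp only [add_mul, sub_mul, one_mul, hpp, mul_assoc]; abel
  have hpa : p * a = p * q * p := by
    rw [ea]; simp only [mul_add, mul_sub, mul_one, ← mul_assoc, hpp]; abel
  have haq : a * q = q * p * q := by
    rw [ea]; simp only [add_mul, sub_mul, one_mul, hqq, mul_assoc]; abel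
  have hqa : q * a = q * p * q := by
    rw [ea]; simp only [mul_add, mul_sub, mul_one, ← mul_assoc, hqq]; abel
  have hsa : IsSelfAdjoint a := by
    rw [IsSelfAdjoint, ha, star_sub, star_mul, star_sub, hps, hqs, star_one]
  have hspec : ∀ x ∈ spectrum ℝ a, 0 < x := by
    intro x hx
    have h1 : 1 - x ∈ spectrum ℝ ((p - q) * (p - q)) := by
      have h2 : (p - q) * (p - q) = algebraMap ℝ A 1 - a := by rw [ha, map_one]; abel
      rw [h2, ← spectrum.singleton_sub_eq]
      exact ⟨1, rfl, x, hx, rfl⟩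
    have h2 := spectrum.norm_le_norm_of_mem h1
    have h3 := norm_mul_le (p - q) (p - q)
    have h4 := le_abs_self (1 - x)
    rw [Real.norm_eq_abs] at h2
    nlinarith [norm_nonneg (p - q)]
  obtain ⟨b, hbs, hbb, hcomm⟩ := exists_inv_sqrt hsa hspec
  have hbp : Commute b p := hcomm p (hap.trans hpa.symm)
  have hbq : Commute b q := hcomm q (haq.trans hqa.symm)
  refine ⟨q * p * b, ?_, ?_⟩
  · calc star (q * p * b) * (q * p * b) = b * (p * (q * q) * p) * b := by
          simp only [star_mul, hbs, hps, hqs, mul_assoc]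
      _ = b * (p * a) * b := by rw [hqq, hpa]
      _ = p * (a * (b * b)) := by
          rw [← mul_assoc b p, hbp.eq, mul_assoc, mul_assoc, ← mul_assoc b a,
            (hcomm a (Commute.refl a)).eq, mul_assoc]
      _ = p := by rw [hbb, mul_one]
  · calc q * p * b * star (q * p * b) = q * (p * (b * b) * p) * q := by
          simp only [star_mul, hbs, hps, hqs, mul_assoc]
      _ = (q * p * q) * (b * b) := by
          rw [mul_assoc p, mul_assoc b b p, hbp.eq, ← mul_assoc b p b, hbp.eq, mul_assoc p b b,
            ← mul_assoc p p, hpp]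
          simp only [mul_assoc]
          rw [hbq.eq, ← mul_assoc b q, hbq.eq, mul_assoc]
      _ = q * (a * (b * b)) := by rw [← hqa, mul_assoc]
      _ = q := by rw [hbb, mul_one]

/-- Projections in a matrix algebra that are connected by a path of projections are Murray-von
Neumann equivalent. -/
theorem mvN_of_path {R : Type*} [CStarAlgebra R] {m : Type*} [Fintype m] [DecidableEq m]
    {p : unitInterval → Matrix m m R} (hc : Continuous p) (hp : ∀ t, IsStarProjection (p t)) :
    MvN (p 0) (p 1) := by
  have hsymm : Std.Symm fun s t => MvN (p s) (p t) := ⟨fun _ _ => MvN.symm⟩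
  refine PreconnectedSpace.induction₂ (fun s t => MvN (p s) (p t)) (fun s => ?_)
    ⟨fun r s t h h' => h.trans (hp r) (hp t) h'⟩ 0 1
  -- the C*-norm on matrices is defined in terms of an order on the coefficients
  let _ := CStarAlgebra.spectralOrder R
  have := CStarAlgebra.spectralOrderedRing R
  let p' : unitInterval → CStarMatrix m m R := fun t => CStarMatrix.ofMatrix (p t)
  have hc' : Continuous p' := hc
  have hev : ∀ᶠ t in 𝓝 s, ‖p' s - p' t‖ < 1 := by
    have : Filter.Tendsto (fun t => ‖p' s - p' t‖) (𝓝 s) (𝓝 ‖p' s - p' s‖) :=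
      ((continuous_const.sub hc').norm).tendsto s
    rw [sub_self, norm_zero] at this
    exact this.eventually (gt_mem_nhds one_pos)
  filter_upwards [hev] with t ht
  have hproj (t) : IsStarProjection (p' t) := ⟨(hp t).isIdempotentElem, (hp t).isSelfAdjoint⟩
  obtain ⟨v, h1, h2⟩ := exists_partialIsometry_of_norm_sub_lt_one (hproj s) (hproj t) ht
  exact ⟨v, h1, h2⟩

end CStarK

/-! ### Corner homotopic homomorphisms induce the same maps on K-theory -/

namespace CStarK

section BlockMap

variable {R S : Type*} [Ring R] [StarRing R] [Algebra ℂ R] [Ring S] [StarRing S] [Algebra ℂ S]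
  {m : Type*}

/-- The matrix over `S`, of twice the size, obtained by applying a homomorphism `R → M₂(S)` to all
entries of a matrix over `R`. -/
def blockMap (Ψ : R →⋆ₐ[ℂ] Matrix (Fin 2) (Fin 2) S) (p : Matrix m m R) :
    Matrix (m ⊕ m) (m ⊕ m) S :=
  Matrix.fromBlocks (p.map fun x => Ψ x 0 0) (p.map fun x => Ψ x 0 1) (p.map fun x => Ψ x 1 0)
    (p.map fun x => Ψ x 1 1)

theorem blockMap_mul [Fintype m] (Ψ : R →⋆ₐ[ℂ] Matrix (Fin 2) (Fin 2) S) (p q : Matrix m m R) :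
    blockMap Ψ (p * q) = blockMap Ψ p * blockMap Ψ q := by
  have h (a b : Fin 2) : ((p * q).map fun x => Ψ x a b)
      = (p.map fun x => Ψ x a 0) * (q.map fun x => Ψ x 0 b)
        + (p.map fun x => Ψ x a 1) * (q.map fun x => Ψ x 1 b) := by
    ext i j
    simp only [Matrix.map_apply, Matrix.add_apply, Matrix.mul_apply, map_sum, map_mul,
      Matrix.sum_apply, Fin.sum_univ_two, Finset.sum_add_distrib]
  simp only [blockMap, Matrix.fromBlocks_multiply, h]

theorem blockMap_one [DecidableEq m] (Ψ : R →⋆ₐ[ℂ] Matrix (Fin 2) (Fin 2) S) :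
    blockMap Ψ (1 : Matrix m m R) = 1 := by
  have h (a b : Fin 2) : ((1 : Matrix m m R).map fun x => Ψ x a b)
      = if a = b then 1 else 0 := by
    ext i j
    rw [Matrix.map_apply, Matrix.one_apply]
    split_ifs with h1 h2 h2 <;> simp [h1, h2, Matrix.one_apply]
  simp only [blockMap, h]
  simp [Matrix.fromBlocks_one]

theorem blockMap_star (Ψ : R →⋆ₐ[ℂ] Matrix (Fin 2) (Fin 2) S) (p : Matrix m m R) :
    blockMap Ψ pᴴ = (blockMap Ψ p)ᴴ := by
  have h (a b : Fin 2) : (pᴴ.map fun x => Ψ x a b) = (p.map fun x => Ψ x b a)ᴴ := by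
    ext i j
    simp only [Matrix.map_apply, Matrix.conjTranspose_apply, map_star, Matrix.star_apply]
  simp only [blockMap, Matrix.fromBlocks_conjTranspose, h]

theorem isStarProjection_blockMap [Fintype m] (Ψ : R →⋆ₐ[ℂ] Matrix (Fin 2) (Fin 2) S)
    {p : Matrix m m R} (hp : IsStarProjection p) : IsStarProjection (blockMap Ψ p) where
  isIdempotentElem := by rw [IsIdempotentElem, ← blockMap_mul, hp.isIdempotentElem.eq]
  isSelfAdjoint := by
    have h := hp.isSelfAdjoint.star_eq
    rw [Matrix.star_eq_conjTranspose] at h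
    rw [IsSelfAdjoint, Matrix.star_eq_conjTranspose, ← blockMap_star, h]

end BlockMap

variable {A B : Type*} [NonUnitalCStarAlgebra A] [NonUnitalCStarAlgebra B]

/-- The unital extension `A⁺ → M₂(B⁺)` of a homomorphism `A → M₂(B)`. -/
def matUnitExt (Φ : A →⋆ₙₐ[ℂ] Matrix (Fin 2) (Fin 2) B) :
    Unitization ℂ A →⋆ₐ[ℂ] Matrix (Fin 2) (Fin 2) (Unitization ℂ B) :=
  Unitization.starLift
    { toFun := fun a => (Φ a).map fun b => (b : Unitization ℂ B)
      map_smul' := fun c a => by ext i j <;> simp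
      map_zero' := by ext i j <;> simp
      map_add' := fun a b => by ext i j <;> simp
      map_mul' := fun a b => by
        ext i j <;> simp [Matrix.mul_apply, Fin.sum_univ_two]
      map_star' := fun a => by
        refine Matrix.ext fun i j => ?_
        have h := congrFun₂ (map_star Φ a) i j
        rw [Matrix.star_apply] at h
        simp [Matrix.star_apply, h] }

theorem matUnitExt_apply (Φ : A →⋆ₙₐ[ℂ] Matrix (Fin 2) (Fin 2) B) (x : Unitization ℂ A)
    (i j : Fin 2) : matUnitExt Φ x i j
      = (if i = j then algebraMap ℂ (Unitization ℂ B) x.fst else 0)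
        + (Φ x.snd i j : Unitization ℂ B) := by
  change (algebraMap ℂ (Matrix (Fin 2) (Fin 2) (Unitization ℂ B)) x.fst
    + (Φ x.snd).map fun b => (b : Unitization ℂ B)) i j = _
  rw [Matrix.add_apply, Matrix.algebraMap_matrix_apply]
  rfl

/-- Two homomorphisms `φ, ψ : A → B` are corner homotopic if there is a path of homomorphisms
`A → M₂(B)` from `diag(φ, 0)` to `diag(0, ψ)`. -/
def CornerHomotopic (φ ψ : A →⋆ₙₐ[ℂ] B) : Prop :=
  ∃ Φ : unitInterval → A →⋆ₙₐ[ℂ] Matrix (Fin 2) (Fin 2) B, (∀ a, Continuous fun t => Φ t a) ∧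
    (∀ a, Φ 0 a = !![φ a, 0; 0, 0]) ∧ ∀ a, Φ 1 a = !![0, 0; 0, ψ a]

theorem blockMap_left {Φ : A →⋆ₙₐ[ℂ] Matrix (Fin 2) (Fin 2) B} {φ : A →⋆ₙₐ[ℂ] B}
    (h : ∀ a, Φ a = !![φ a, 0; 0, 0]) {m : Type*} (p : Matrix m m (Unitization ℂ A)) :
    blockMap (matUnitExt Φ) p = dsum (p.map (Unitization.starMap φ))
      (p.map (Unitization.starMap (0 : A →⋆ₙₐ[ℂ] B))) := by
  have h1 (x : Unitization ℂ A) : matUnitExt Φ x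
      = !![Unitization.starMap φ x, 0; 0, Unitization.starMap (0 : A →⋆ₙₐ[ℂ] B) x] := by
    refine Matrix.ext fun i j => ?_
    rw [matUnitExt_apply, h]
    fin_cases i <;> fin_cases j <;> simp
  simp only [blockMap, dsum, h1]
  congr 1

theorem blockMap_right {Φ : A →⋆ₙₐ[ℂ] Matrix (Fin 2) (Fin 2) B} {ψ : A →⋆ₙₐ[ℂ] B}
    (h : ∀ a, Φ a = !![0, 0; 0, ψ a]) {m : Type*} (p : Matrix m m (Unitization ℂ A)) :
    blockMap (matUnitExt Φ) p = dsum (p.map (Unitization.starMap (0 : A →⋆ₙₐ[ℂ] B)))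
      (p.map (Unitization.starMap ψ)) := by
  have h1 (x : Unitization ℂ A) : matUnitExt Φ x
      = !![Unitization.starMap (0 : A →⋆ₙₐ[ℂ] B) x, 0; 0, Unitization.starMap ψ x] := by
    refine Matrix.ext fun i j => ?_
    rw [matUnitExt_apply, h]
    fin_cases i <;> fin_cases j <;> simp
  simp only [blockMap, dsum, h1]
  congr 1

theorem continuous_blockMap {Φ : unitInterval → A →⋆ₙₐ[ℂ] Matrix (Fin 2) (Fin 2) B}
    (h : ∀ a, Continuous fun t => Φ t a) {m : Type*} (p : Matrix m m (Unitization ℂ A)) :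
    Continuous fun t => blockMap (matUnitExt (Φ t)) p := by
  have h1 (x : Unitization ℂ A) (i j : Fin 2) : Continuous fun t => matUnitExt (Φ t) x i j := by
    simp only [matUnitExt_apply]
    exact continuous_const.add (Unitization.continuous_inr.comp ((h x.snd).matrix_elem i j))
  refine Continuous.matrix_fromBlocks ?_ ?_ ?_ ?_ <;>
    exact continuous_matrix fun i j => h1 _ _ _

/-- The scalar part of `p`, in the other corner, is written as the image of `p` under the
unitization of the zero homomorphism. -/
theorem CornerHomotopic.mvN {φ ψ : A →⋆ₙₐ[ℂ] B} (h : CornerHomotopic φ ψ) {m : Type*} [Fintype m]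
    {p : Matrix m m (Unitization ℂ A)} (hp : IsStarProjection p) :
    MvN (dsum (p.map (Unitization.starMap φ)) (p.map (Unitization.starMap (0 : A →⋆ₙₐ[ℂ] B))))
      (dsum (p.map (Unitization.starMap (0 : A →⋆ₙₐ[ℂ] B))) (p.map (Unitization.starMap ψ))) := by
  classical
  obtain ⟨Φ, hc, h0, h1⟩ := h
  have := mvN_of_path (continuous_blockMap hc p) fun t => isStarProjection_blockMap _ hp
  rwa [blockMap_left h0, blockMap_right h1] at this

/-- Corner homotopic homomorphisms agree on `K₀`: the scalar summand which has to be added to a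
projection cancels in the Grothendieck group. -/
theorem CornerHomotopic.K0_map_eq {φ ψ : A →⋆ₙₐ[ℂ] B} (h : CornerHomotopic φ ψ) :
    K0.map φ = K0.map ψ := by
  have h00 : K00.map (Unitization.starMap φ) = K00.map (Unitization.starMap ψ) := by
    refine Algebra.GrothendieckAddGroup.lift.symm.injective ?_
    ext a
    change K00.map (Unitization.starMap φ) (Algebra.GrothendieckAddGroup.of a)
      = K00.map (Unitization.starMap ψ) (Algebra.GrothendieckAddGroup.of a)
    rw [K00.map_of, K00.map_of]
    induction a using Quotient.inductionOn with | _ p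
    set p₁ := ProjMat.map (Unitization.starMap φ) p with hp₁
    set p₂ := ProjMat.map (Unitization.starMap ψ) p with hp₂
    set s := ProjMat.map (Unitization.starMap (0 : A →⋆ₙₐ[ℂ] B)) p with hs
    let c : ProjMat (Unitization ℂ B) → V (Unitization ℂ B) := fun p => ⟦p⟧
    have hadd : c p₁ + c s = c s + c p₂ := by
      refine mk_eq_of_mvN ?_
      exact ((p₁.add_mvN s).symm.trans (p₁.add s).isProj (isStarProjection_dsum s.isProj p₂.isProj)
        (h.mvN p.isProj)).trans (p₁.add s).isProj (s.add p₂).isProj (s.add_mvN p₂)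
    have h2 := congrArg Algebra.GrothendieckAddGroup.of hadd
    rw [map_add, map_add, add_comm] at h2
    exact add_left_cancel h2
  refine AddMonoidHom.ext fun x => Subtype.ext ?_
  exact DFunLike.congr_fun h00 x.1

section K1

variable {R : Type*} [CStarAlgebra R]

/-- The unitary matrix `diag(u, v)`. -/
def unitaryDiag {n : ℕ} (u v : U R n) : U R (n + n) :=
  ⟨(dsum (u : Matrix (Fin n) (Fin n) R) (v : Matrix (Fin n) (Fin n) R)).reindex
    finSumFinEquiv finSumFinEquiv, by
    have hu := Unitary.mem_iff.1 u.2
    have hv := Unitary.mem_iff.1 v.2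
    simp only [Matrix.star_eq_conjTranspose] at hu hv
    rw [Unitary.mem_iff]
    simp only [Matrix.star_eq_conjTranspose, dsum, Matrix.reindex_apply,
      Matrix.conjTranspose_submatrix, Matrix.submatrix_mul_equiv, Matrix.fromBlocks_conjTranspose,
      Matrix.fromBlocks_multiply, hu.1, hu.2, hv.1, hv.2]
    simp⟩

/-- `diag(u, v) = diag(1, v) diag(u, 1)`, where the second factor is the stabilisation of `u`. -/
theorem unitaryDiag_eq {n : ℕ} (u v : U R n) :
    unitaryDiag u v = unitaryDiag 1 v * stab n (n + n) (Nat.le_add_right n n) u := by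
  have h : stab n (n + n) (Nat.le_add_right n n) u = unitaryDiag u 1 := by
    refine Subtype.ext ?_
    change 1 + incl R n (n + n) * ((u : Matrix (Fin n) (Fin n) R) - 1) * (incl R n (n + n))ᴴ
      = (dsum (u : Matrix (Fin n) (Fin n) R) 1).reindex finSumFinEquiv finSumFinEquiv
    have hi : incl R n (n + n) = (Matrix.fromRows 1 0 : Matrix (Fin n ⊕ Fin n) (Fin n) R).submatrix
        finSumFinEquiv.symm id := by
      refine Matrix.ext fun i j => ?_
      obtain ⟨i | i, rfl⟩ := finSumFinEquiv.surjective i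
      · simp [incl, Matrix.one_apply, Fin.ext_iff]
      · have : ¬ (n + i.val = j.val) := by omega
        rw [Matrix.submatrix_apply, Equiv.symm_apply_apply, id, Matrix.fromRows_apply_inr]
        simp only [incl, Matrix.of_apply, finSumFinEquiv_apply_right, Fin.val_natAdd, this,
          if_false, Matrix.zero_apply]
    have h1 : (dsum (u : Matrix (Fin n) (Fin n) R) 1 : Matrix (Fin n ⊕ Fin n) (Fin n ⊕ Fin n) R)
        = 1 + (Matrix.fromRows 1 0 : Matrix (Fin n ⊕ Fin n) (Fin n) R)
          * ((u : Matrix (Fin n) (Fin n) R) - 1)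
          * (Matrix.fromRows 1 0 : Matrix (Fin n ⊕ Fin n) (Fin n) R)ᴴ := by
      rw [Matrix.conjTranspose_fromRows_eq_fromCols_conjTranspose, Matrix.fromRows_mul,
        Matrix.fromRows_mul_fromCols, ← Matrix.fromBlocks_one, dsum, Matrix.fromBlocks_add]
      simp
    rw [hi, h1, Matrix.reindex_apply, Matrix.conjTranspose_submatrix]
    refine Matrix.ext fun i j => ?_
    rw [Matrix.submatrix_apply, Matrix.add_apply, Matrix.add_apply]
    refine congrArg₂ (· + ·) ?_ rfl
    simp [Matrix.one_apply]
  rw [h]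
  refine Subtype.ext ?_
  simp [unitaryDiag, dsum, Matrix.fromBlocks_multiply]

theorem joined_reindex {n : ℕ} {w : unitInterval → Matrix (Fin n ⊕ Fin n) (Fin n ⊕ Fin n) R}
    (hw : Continuous w) (hu : ∀ t, w t ∈ unitary (Matrix (Fin n ⊕ Fin n) (Fin n ⊕ Fin n) R))
    {u v u' v' : U R n} (h0 : w 0 = dsum (u : Matrix (Fin n) (Fin n) R) v)
    (h1 : w 1 = dsum (u' : Matrix (Fin n) (Fin n) R) v') :
    Joined (unitaryDiag u v) (unitaryDiag u' v') := by
  refine ⟨⟨⟨fun t => ⟨(w t).reindex finSumFinEquiv finSumFinEquiv, ?_⟩, ?_⟩, ?_, ?_⟩⟩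
  · have h := Unitary.mem_iff.1 (hu t)
    simp only [Matrix.star_eq_conjTranspose] at h
    rw [Unitary.mem_iff]
    simp only [Matrix.star_eq_conjTranspose, Matrix.reindex_apply,
      Matrix.conjTranspose_submatrix, Matrix.submatrix_mul_equiv, h.1, h.2]
    simp
  · exact (hw.matrix_submatrix _ _).subtype_mk _
  · exact Subtype.ext (congrArg (Matrix.reindex finSumFinEquiv finSumFinEquiv) h0)
  · exact Subtype.ext (congrArg (Matrix.reindex finSumFinEquiv finSumFinEquiv) h1)

theorem CornerHomotopic.joined {φ ψ : A →⋆ₙₐ[ℂ] B} (h : CornerHomotopic φ ψ) {n : ℕ}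
    (u : U (Unitization ℂ A) n) :
    Joined (unitaryDiag (U.map (Unitization.starMap φ) n u)
        (U.map (Unitization.starMap (0 : A →⋆ₙₐ[ℂ] B)) n u))
      (unitaryDiag (U.map (Unitization.starMap (0 : A →⋆ₙₐ[ℂ] B)) n u)
        (U.map (Unitization.starMap ψ) n u)) := by
  obtain ⟨Φ, hc, h0, h1⟩ := h
  have hu := Unitary.mem_iff.1 u.2
  simp only [Matrix.star_eq_conjTranspose] at hu
  refine joined_reindex (continuous_blockMap hc (u : Matrix (Fin n) (Fin n) (Unitization ℂ A)))
    (fun t => ?_) ?_ ?_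
  · rw [Unitary.mem_iff]
    simp only [Matrix.star_eq_conjTranspose, ← blockMap_star, ← blockMap_mul, hu.1, hu.2,
      blockMap_one, and_self]
  · exact blockMap_left h0 (u : Matrix (Fin n) (Fin n) (Unitization ℂ A))
  · exact blockMap_right h1 (u : Matrix (Fin n) (Fin n) (Unitization ℂ A))

/-- Corner homotopic homomorphisms agree on `K₁`; the second homotopy moves the block of `ψ` back
to the first corner. -/
theorem CornerHomotopic.K1_map_eq {φ ψ : A →⋆ₙₐ[ℂ] B} (h : CornerHomotopic φ ψ)
    (h' : CornerHomotopic ψ ψ) : K1.map φ = K1.map ψ := by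
  refine MonoidHom.ext fun x => ?_
  obtain ⟨y, rfl⟩ := QuotientGroup.mk_surjective x
  obtain ⟨n, u, rfl⟩ := DirectLimit.exists_eq_mk _ y
  change ((⟦⟨n, U.map (Unitization.starMap φ) n u⟩⟧ : UInf (Unitization ℂ B)) :
      K11 (Unitization ℂ B))
    = ((⟦⟨n, U.map (Unitization.starMap ψ) n u⟩⟧ : UInf (Unitization ℂ B)) :
      K11 (Unitization ℂ B))
  rw [QuotientGroup.eq]
  have hj := (h.joined u).trans (h'.joined u).symm
  have hj' := (Joined.refl (unitaryDiag (U.map (Unitization.starMap φ) n u)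
        (U.map (Unitization.starMap (0 : A →⋆ₙₐ[ℂ] B)) n u))⁻¹).mul hj
  rw [inv_mul_cancel, unitaryDiag_eq, unitaryDiag_eq (U.map (Unitization.starMap ψ) n u),
    mul_inv_rev, mul_assoc, inv_mul_cancel_left] at hj'
  refine ⟨n + n, _, ?_, hj'⟩
  rw [← DirectLimit.mul_def, ← DirectLimit.inv_def, DirectLimit.mk_apply, DirectLimit.mk_apply]

end K1

section Functoriality

variable {C : Type*} [NonUnitalCStarAlgebra C]

theorem K0.map_comp (ψ : B →⋆ₙₐ[ℂ] C) (φ : A →⋆ₙₐ[ℂ] B) :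
    K0.map (ψ.comp φ) = (K0.map ψ).comp (K0.map φ) := by
  refine AddMonoidHom.ext fun x => Subtype.ext ?_
  change K00.map (Unitization.starMap (ψ.comp φ)) x.1 = K00.map _ (K00.map _ x.1)
  rw [Unitization.starMap_comp, K00.map_comp]
  rfl

theorem K0.map_id : K0.map (NonUnitalStarAlgHom.id ℂ A) = AddMonoidHom.id _ := by
  refine AddMonoidHom.ext fun x => Subtype.ext ?_
  change K00.map (Unitization.starMap (NonUnitalStarAlgHom.id ℂ A)) x.1 = x.1
  rw [Unitization.starMap_id]
  have : K00.map (StarAlgHom.id ℂ (Unitization ℂ A)) = AddMonoidHom.id _ := by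
    refine Algebra.GrothendieckAddGroup.lift.symm.injective ?_
    ext a
    change K00.map _ (Algebra.GrothendieckAddGroup.of a) = Algebra.GrothendieckAddGroup.of a
    rw [K00.map_of]
    induction a using Quotient.inductionOn with | _ p
    rfl
  rw [this]; rfl

theorem K1.map_comp (ψ : B →⋆ₙₐ[ℂ] C) (φ : A →⋆ₙₐ[ℂ] B) :
    K1.map (ψ.comp φ) = (K1.map ψ).comp (K1.map φ) := by
  refine MonoidHom.ext fun x => ?_
  obtain ⟨y, rfl⟩ := QuotientGroup.mk_surjective x
  obtain ⟨n, u, rfl⟩ := DirectLimit.exists_eq_mk _ y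
  change ((⟦⟨n, U.map (Unitization.starMap (ψ.comp φ)) n u⟩⟧ : UInf (Unitization ℂ C)) :
    K11 (Unitization ℂ C)) = ((⟦⟨n, U.map _ n (U.map _ n u)⟩⟧ : UInf (Unitization ℂ C)) : K11 _)
  rw [Unitization.starMap_comp]
  rfl

theorem K1.map_id : K1.map (NonUnitalStarAlgHom.id ℂ A) = MonoidHom.id _ := by
  refine MonoidHom.ext fun x => ?_
  obtain ⟨y, rfl⟩ := QuotientGroup.mk_surjective x
  obtain ⟨n, u, rfl⟩ := DirectLimit.exists_eq_mk _ y
  change ((⟦⟨n, U.map (Unitization.starMap (NonUnitalStarAlgHom.id ℂ A)) n u⟩⟧ :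
    UInf (Unitization ℂ A)) : K11 (Unitization ℂ A)) = (⟦⟨n, u⟩⟧ : UInf (Unitization ℂ A))
  rw [Unitization.starMap_id]
  rfl

end Functoriality

end CStarK

/-! ### Rotating one covering isometry into another -/

section Rotation

variable {X : Type*} [MetricSpace X] [ProperSpace X] [MeasurableSpace X] [BorelSpace X]
  {Y : Type*} [MetricSpace Y] [ProperSpace Y] [MeasurableSpace Y] [BorelSpace Y]
  {HX : Type*} [NormedAddCommGroup HX] [InnerProductSpace ℂ HX] [CompleteSpace HX]
  {HY : Type*} [NormedAddCommGroup HY] [InnerProductSpace ℂ HY] [CompleteSpace HY]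
  {K : Type*} [NormedAddCommGroup K] [InnerProductSpace ℂ K] [CompleteSpace K]
  {M : AmpleModule X HX} {N : AmpleModule Y HY}

theorem adjoint_comp_self_linearIsometry (V : HX →ₗᵢ[ℂ] HY) :
    (ContinuousLinearMap.adjoint V.toContinuousLinearMap).comp V.toContinuousLinearMap = 1 := by
  ext η
  refine ext_inner_left ℂ fun v => ?_
  rw [ContinuousLinearMap.comp_apply, ContinuousLinearMap.adjoint_inner_right]
  exact V.inner_map_map v η

/-- The homomorphism `T ↦ (cᵢ cⱼ Vᵢ T Vⱼ*)ᵢⱼ` into `2 × 2` matrices, for two isometries `V₀`, `V₁`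
and real numbers with `c₀² + c₁² = 1`; it is conjugation by the isometry `(c₀ V₀, c₁ V₁)`. -/
def columnHom (V : Fin 2 → HX →ₗᵢ[ℂ] HY)
    (hV : ∀ i j, ∀ T ∈ M.sqAlgebra K, (V i).toContinuousLinearMap.comp
      (T.comp (ContinuousLinearMap.adjoint (V j).toContinuousLinearMap)) ∈ N.sqAlgebra K)
    (c : Fin 2 → ℝ) (hc : c 0 ^ 2 + c 1 ^ 2 = 1) :
    M.sqAlgebra K →⋆ₙₐ[ℂ] Matrix (Fin 2) (Fin 2) (N.sqAlgebra K) where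
  toFun T := Matrix.of fun i j => ((c i * c j : ℝ) : ℂ) • ⟨_, hV i j T T.2⟩
  map_smul' a T := by
    refine Matrix.ext fun i j => Subtype.ext ?_
    ext η
    simp [smul_smul, mul_comm]
  map_zero' := by
    refine Matrix.ext fun i j => Subtype.ext ?_
    ext η
    simp
  map_add' S T := by
    refine Matrix.ext fun i j => Subtype.ext ?_
    ext η
    simp
  map_mul' S T := by
    refine Matrix.ext fun i j => Subtype.ext ?_
    ext η
    have h (i : Fin 2) (ξ : HX) :
        ContinuousLinearMap.adjoint (V i).toContinuousLinearMap (V i ξ) = ξ :=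
      DFunLike.congr_fun (adjoint_comp_self_linearIsometry (V i)) ξ
    have hc' : (c 0 : ℂ) * c 0 + c 1 * c 1 = 1 := by
      have := congrArg (fun r : ℝ => (r : ℂ)) hc
      push_cast at this
      rw [← this]; ring
    simp only [Matrix.of_apply, Matrix.mul_apply, Fin.sum_univ_two]
    simp [h, smul_smul, ← add_smul]
    congr 1
    linear_combination (-(c i : ℂ) * c j) * hc'
  map_star' T := by
    refine Matrix.ext fun i j => Subtype.ext ?_
    ext η
    simp [Matrix.star_apply, ContinuousLinearMap.star_eq_adjoint, ContinuousLinearMap.adjoint_comp,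
      mul_comm]

/-- `Ad_V` and `Ad_V'` are corner homotopic: rotate the isometry `(V, 0)` to `(0, V')`. -/
theorem cornerHomotopic_adSq {V V' : HX →ₗᵢ[ℂ] HY}
    (hV : ∀ W ∈ ({V, V'} : Set (HX →ₗᵢ[ℂ] HY)), ∀ W' ∈ ({V, V'} : Set (HX →ₗᵢ[ℂ] HY)),
      ∀ T ∈ M.sqAlgebra K, W.toContinuousLinearMap.comp
        (T.comp (ContinuousLinearMap.adjoint W'.toContinuousLinearMap)) ∈ N.sqAlgebra K)
    (h : AdMaps K M N V) (h' : AdMaps K M N V') :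
    CStarK.CornerHomotopic (adSq h) (adSq h') := by
  let W : Fin 2 → HX →ₗᵢ[ℂ] HY := ![V, V']
  have hW (i : Fin 2) : W i ∈ ({V, V'} : Set (HX →ₗᵢ[ℂ] HY)) := by
    fin_cases i <;> simp [W]
  let c (t : unitInterval) : Fin 2 → ℝ := ![Real.cos (Real.pi / 2 * t), Real.sin (Real.pi / 2 * t)]
  have hc (i : Fin 2) : Continuous fun t => c t i := by
    fin_cases i <;> simp only [c] <;> dsimp <;> fun_prop
  refine ⟨fun t => columnHom W (fun i j => hV _ (hW i) _ (hW j)) (c t)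
    (Real.cos_sq_add_sin_sq _), fun T => ?_, fun T => ?_, fun T => ?_⟩
  · refine continuous_matrix fun i j => ?_
    exact (Complex.continuous_ofReal.comp ((hc i).mul (hc j))).smul continuous_const
  · have h0 : c 0 0 = 1 := by simp [c]
    have h1 : c 0 1 = 0 := by simp [c]
    refine Matrix.ext fun i j => Subtype.ext ?_
    fin_cases i <;> fin_cases j <;> simp [columnHom, h0, h1, W]
    rfl
  · have h0 : c 1 0 = 0 := by simp [c]
    have h1 : c 1 1 = 1 := by simp [c]
    refine Matrix.ext fun i j => Subtype.ext ?_
    fin_cases i <;> fin_cases j <;> simp [columnHom, h0, h1, W]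
    rfl

variable (K) in
theorem IsCoveringIsometry.adMaps (hY : BoundedGeometry Y) {f : X → Y} (hf : IsCoarseMap f)
    {V : HX →ₗᵢ[ℂ] HY} (hV : IsCoveringIsometry M N f V) : AdMaps K M N V := fun _ hT =>
  hV.mem_sqAlgebra hY hf hV hT

theorem IsCoveringIsometry.cornerHomotopic (hY : BoundedGeometry Y) {f : X → Y}
    (hf : IsCoarseMap f) {V V' : HX →ₗᵢ[ℂ] HY} (hV : IsCoveringIsometry M N f V)
    (hV' : IsCoveringIsometry M N f V') (h : AdMaps K M N V) (h' : AdMaps K M N V') :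
    CStarK.CornerHomotopic (adSq h) (adSq h') := by
  have hcov : ∀ W ∈ ({V, V'} : Set (HX →ₗᵢ[ℂ] HY)), IsCoveringIsometry M N f W := by
    rintro W (rfl | rfl)
    exacts [hV, hV']
  exact cornerHomotopic_adSq (fun W hW W' hW' T hT =>
    (hcov W hW).mem_sqAlgebra hY hf (hcov W' hW') hT) h h'

theorem IsCoveringIsometry.adK_eq (hY : BoundedGeometry Y) {f : X → Y}
    (hf : IsCoarseMap f) {V V' : HX →ₗᵢ[ℂ] HY} (hV : IsCoveringIsometry M N f V)
    (hV' : IsCoveringIsometry M N f V') (h : AdMaps K M N V) (h' : AdMaps K M N V') :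
    adK0 h = adK0 h' ∧ adK1 h = adK1 h' :=
  have hr := hV.cornerHomotopic hY hf hV' h h'
  ⟨hr.K0_map_eq, hr.K1_map_eq (hV'.cornerHomotopic hY hf hV' h' h')⟩

end Rotation

end

theorem mainTheorem5
    {X : Type*} [MetricSpace X] [ProperSpace X] [MeasurableSpace X] [BorelSpace X]
    (hX : BoundedGeometry X)
    {Y : Type*} [MetricSpace Y] [ProperSpace Y] [MeasurableSpace Y] [BorelSpace Y]
    (hY : BoundedGeometry Y)
    {HX : Type*} [NormedAddCommGroup HX] [InnerProductSpace ℂ HX] [CompleteSpace HX]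
    (M : AmpleModule X HX)
    {HY : Type*} [NormedAddCommGroup HY] [InnerProductSpace ℂ HY] [CompleteSpace HY]
    (N : AmpleModule Y HY)
    {K : Type*} [NormedAddCommGroup K] [InnerProductSpace ℂ K] [CompleteSpace K]
    [TopologicalSpace.SeparableSpace K] (hK : ¬ FiniteDimensional ℂ K)
    (f : X → Y) (hf : IsCoarseMap f) :
    -- `Ad_V` maps `C*_sq(HX)` into `C*_sq(HY)`, for every isometry `V` covering `f`
    ∃ hAd : ∀ V : HX →ₗᵢ[ℂ] HY, IsCoveringIsometry M N f V → AdMaps K M N V,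
      -- the induced maps on K-theory do not depend on `V`
      (∀ (V V' : HX →ₗᵢ[ℂ] HY) (hV : IsCoveringIsometry M N f V)
        (hV' : IsCoveringIsometry M N f V'),
        adK0 (hAd V hV) = adK0 (hAd V' hV') ∧
        adK1 (hAd V hV) = adK1 (hAd V' hV')) ∧
      -- functoriality: `(g ∘ f)_* = g_* ∘ f_*`
      (∀ {Z : Type*} [MetricSpace Z] [ProperSpace Z] [MeasurableSpace Z] [BorelSpace Z]
        {HZ : Type*} [NormedAddCommGroup HZ] [InnerProductSpace ℂ HZ] [CompleteSpace HZ]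
        (P : AmpleModule Z HZ) (g : Y → Z), BoundedGeometry Z → IsCoarseMap g →
        ∃ (hg : ∀ W : HY →ₗᵢ[ℂ] HZ, IsCoveringIsometry N P g W → AdMaps K N P W)
          (hgf : ∀ U : HX →ₗᵢ[ℂ] HZ, IsCoveringIsometry M P (g ∘ f) U → AdMaps K M P U),
          ∀ (V : HX →ₗᵢ[ℂ] HY) (W : HY →ₗᵢ[ℂ] HZ) (U : HX →ₗᵢ[ℂ] HZ)
            (hV : IsCoveringIsometry M N f V) (hW : IsCoveringIsometry N P g W)
            (hU : IsCoveringIsometry M P (g ∘ f) U),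
            adK0 (hgf U hU)
              = (adK0 (hg W hW)).comp (adK0 (hAd V hV)) ∧
            adK1 (hgf U hU)
              = (adK1 (hg W hW)).comp (adK1 (hAd V hV))) ∧
      -- functoriality: `id_* = id`
      ∃ hid : ∀ U : HX →ₗᵢ[ℂ] HX, IsCoveringIsometry M M id U → AdMaps K M M U,
        ∀ (U : HX →ₗᵢ[ℂ] HX) (hU : IsCoveringIsometry M M id U),
          adK0 (hid U hU) = AddMonoidHom.id _ ∧
          adK1 (hid U hU) = MonoidHom.id _ := by
  refine ⟨fun V hV => hV.adMaps K hY hf, fun V V' hV hV' => hV.adK_eq hY hf hV' _ _, ?_,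
    fun U hU => hU.adMaps K hX isCoarseMap_id, fun U hU => ?_⟩
  · intro Z _ _ _ _ HZ _ _ _ P g hZ hg
    refine ⟨fun W hW => hW.adMaps K hZ hg, fun U hU => hU.adMaps K hZ (hg.comp hf),
      fun V W U hV hW hU => ?_⟩
    have hWV : IsCoveringIsometry M P (g ∘ f) (W.comp V) := hV.comp hf hg hW
    have h := hU.adK_eq hZ (hg.comp hf) hWV (hU.adMaps K hZ (hg.comp hf))
      (hWV.adMaps K hZ (hg.comp hf))
    have e : adSq (hWV.adMaps K hZ (hg.comp hf))
        = (adSq (hW.adMaps K hZ hg)).comp (adSq (hV.adMaps K hY hf)) := by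
      refine NonUnitalStarAlgHom.ext fun T => Subtype.ext ?_
      change (W.toContinuousLinearMap.comp V.toContinuousLinearMap).comp
        ((T : HX →L[ℂ] HX).comp (ContinuousLinearMap.adjoint
          (W.toContinuousLinearMap.comp V.toContinuousLinearMap))) = _
      rw [ContinuousLinearMap.adjoint_comp]
      rfl
    rw [h.1, h.2, adK0, adK1, e]
    exact ⟨CStarK.K0.map_comp _ _, CStarK.K1.map_comp _ _⟩
  · have hI := (isCoveringIsometry_id (M := M)).adMaps K hX isCoarseMap_id
    have h := hU.adK_eq hX isCoarseMap_id isCoveringIsometry_id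
      (hU.adMaps K hX isCoarseMap_id) hI
    have e : adSq hI = NonUnitalStarAlgHom.id ℂ _ := by
      refine NonUnitalStarAlgHom.ext fun T => Subtype.ext ?_
      change (1 : HX →L[ℂ] HX) * (T * star (1 : HX →L[ℂ] HX)) = T
      rw [star_one, one_mul, mul_one]
    rw [h.1, h.2, adK0, adK1, e]
    exact ⟨CStarK.K0.map_id, CStarK.K1.map_id⟩
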